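/- **Setting.** Let $\varphi$ be a norm on $\mathbb{R}^2$ of the form $\varphi(s,t)=|s|\,\nu(|t/s|)$ for $s\neq 0$, where $\nu:[0,\infty)\to(0,\infty)$ is nondecreasing and $\nu(0)=1$; extend $\nu$ to an even function on $\mathbb{R}$, so that $\nu(z)=\varphi(1,z)$ (its derivative $\nu'$, odd, exists outside a countable set). Let $\Omega\subset\mathbb{R}^2$ be compact and connected and let $f,u:\Omega\to\mathbb{R}$ be smooth. For $p,q\in\Omega$ let $$d(p,q)=\inf_{c}\int_0^1\varphi\bigl(\|c'(t)\|_2,\,|(f\circ c)'(t)|\bigr)\,dt,$$ where $c$ runs over all regular $C^1$ curves $c:[0,1]\to\Omega$ with $c(0)=p$, $c(1)=q$, and let $\mathcal A_\varrho(x)=\{y\in\Omega: d(x,y)\le\varrho\}$ be the amoeba of radius $\varrho$. One step of amoeba median filtering replaces $u(x)$ by a median $m$ of $u$ over $\mathcal A_\varrho(x)$ with respect to area, i.e. a number $m$ such that each of the sets $\{u<m\}$ and $\{u>m\}$ occupies at most half of the area of $\mathcal A_\varrho(x)$. Let $x$ be an interior point of $\Omega$ with $\nabla f(x)\ne0$ and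 $\nabla u(x)\neq0$. Put $\eta=\nabla u/|\nabla u|$ and $\chi=\nabla f/|\nabla f|$ at $x$, let $\xi\perp\eta$ and $\zeta\perp\chi$ be unit vectors, and let $\alpha$ be the angle between the gradient directions, so that $\eta=\cos\alpha\,\chi+\sin\alpha\,\zeta$. Set $$G=\frac1{\nu(|\nabla f|\sin\alpha)^2},\qquad \begin{pmatrix}H_1&H_2\\H_2&H_3\end{pmatrix} =\frac32\,\nu(|\nabla f|\sin\alpha)\int_{\alpha-\pi/2}^{\alpha+\pi/2}\frac{\nu'(|\nabla f|\cos\vartheta)}{\nu(|\nabla f|\cos\vartheta)^4} \begin{pmatrix}\cos^2\vartheta&\sin\vartheta\cos\vartheta\\ \sin\vartheta\cos\vartheta&\sin^2\vartheta\end{pmatrix}d\vartheta,$$ $$R=G\,u_{\xi\xi}-|\nabla u|\,\bigl(H_1 f_{\chi\chi}+2H_2 f_{\chi\zeta}+H_3 f_{\zeta\zeta}\bigr),$$ all evaluated at $x$. **Theorem.** The integrals exist, and: 1. For all sufficiently small $\varrho>0$ there is exactly one median $m_\varrho$ of $u$ over $\mathcal A_\varrho(x)$, and $$\lim_{\varrho\to0^+}\frac{m_\varrho-u(x)}{\varrho^2/6}=R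 .$$ That is, one step of amoeba median filtering approximates, for $\varrho\to0$, a time step of size $\tau=\varrho^2/6$ of an explicit time discretisation of $$u_t=G\,u_{\xi\xi}-|\nabla u|\,\bigl(H_1 f_{\chi\chi}+2H_2 f_{\chi\zeta}+H_3 f_{\zeta\zeta}\bigr).$$ 2. If at $x$ one has $\alpha=0$, $u_{\xi\eta}=f_{\xi\eta}=0$ and $u_{\xi\xi}/|\nabla u|=f_{\xi\xi}/|\nabla f|$, then the vector field $g(|\nabla f|)\,\nabla u/|\nabla u|$ is differentiable at $x$ and $$R=|\nabla u|\,\operatorname{div}\Bigl(g(|\nabla f|)\,\frac{\nabla u}{|\nabla u|}\Bigr)\quad\text{at }x,$$ so that the equation reduces to the geodesic active contour equation. Here $g$ is the edge-stopping function of the amoeba metric: with $\mu(w)=\varphi(w,1)$ and $\mu^{-1}(y)=\sup\{w\ge0:\mu(w)\le y\}$, $$g(z)=\frac{3}{z^2\mu(1/z)^3}\int_0^1 r^2\sqrt{\mu^{-1}\bigl(\mu(1/z)/r\bigr)^2-\frac1{z^2}}\;dr\qquad(z>0).$$ -/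

import Mathlib

open Set Filter Topology MeasureTheory
open scoped ContDiff ENNReal

noncomputable section

namespace Amoeba

/-- The image plane `ℝ²` with its Euclidean norm. -/
abbrev Plane := EuclideanSpace ℝ (Fin 2)

/-- The norm `φ` on `ℝ²` (first slot: spatial component, second slot: tonal component)
is represented by the increasing function `ν : [0,∞) → (0,∞)`, `ν 0 = 1`, through
`φ (s, t) = |s| ν(|t / s|)`. Only the values of `ν` on `[0,∞)` matter. -/
structure IsAmoebaNorm (φ : Seminorm ℝ (ℝ × ℝ)) (ν : ℝ → ℝ) : Prop where
  eq_zero_of_apply_eq_zero : ∀ p, φ p = 0 → p = 0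
  monotoneOn : MonotoneOn ν (Ici 0)
  apply_zero : ν 0 = 1
  apply_eq : ∀ s t : ℝ, s ≠ 0 → φ (s, t) = |s| * ν |t / s|

/-- `c` restricts to a regular (continuously differentiable, nowhere vanishing velocity)
curve `[0,1] → Ω` from `p` to `q`. -/
structure IsRegularCurve (Ω : Set Plane) (p q : Plane) (c : ℝ → Plane) : Prop where
  contDiffOn : ContDiffOn ℝ 1 c (Icc 0 1)
  velocity_ne_zero : ∀ t ∈ Icc (0 : ℝ) 1, derivWithin c (Icc 0 1) t ≠ 0
  mapsTo : MapsTo c (Icc 0 1) Ω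
  source : c 0 = p
  target : c 1 = q

/-- `∫₀¹ φ(‖c'(t)‖, |(f ∘ c)'(t)|) dt` (contrast scale `β = 1`). -/
def curveLength (φ : Seminorm ℝ (ℝ × ℝ)) (f : Plane → ℝ) (c : ℝ → Plane) : ℝ≥0∞ :=
  ∫⁻ t in Icc (0 : ℝ) 1,
    ENNReal.ofReal (φ (‖derivWithin c (Icc 0 1) t‖, |derivWithin (f ∘ c) (Icc 0 1) t|))

/-- The amoeba distance: infimum of the lengths of all regular curves in `Ω` from `p` to `q`. -/
def amoebaDist (Ω : Set Plane) (φ : Seminorm ℝ (ℝ × ℝ)) (f : Plane → ℝ) (p q : Plane) : ℝ≥0∞ :=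
  ⨅ (c : ℝ → Plane) (_ : IsRegularCurve Ω p q c), curveLength φ f c

/-- The amoeba of radius `ρ` around `x`, generated from the image `f` on `Ω`. -/
def amoeba (Ω : Set Plane) (φ : Seminorm ℝ (ℝ × ℝ)) (f : Plane → ℝ) (ρ : ℝ) (x : Plane) :
    Set Plane :=
  {y ∈ Ω | amoebaDist Ω φ f x y ≤ ENNReal.ofReal ρ}

/-- `m` is a median, with respect to area, of the values of `u` in the set `A`. -/
def IsMedianOn (u : Plane → ℝ) (A : Set Plane) (m : ℝ) : Prop :=
  volume {y ∈ A | u y < m} ≤ volume A / 2 ∧ volume {y ∈ A | m < u y} ≤ volume A / 2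

/-- The second directional derivative `h_{vw}(x)`. -/
def hess (h : Plane → ℝ) (x v w : Plane) : ℝ :=
  fderiv ℝ (fderiv ℝ h) x v w

/-- The divergence of a plane vector field. -/
def divergence (F : Plane → Plane) (x : Plane) : ℝ :=
  ∑ i : Fin 2, fderiv ℝ F x (EuclideanSpace.single i 1) i

/-- The even extension of `ν` to the real line. -/
def evenExt (ν : ℝ → ℝ) (z : ℝ) : ℝ := ν |z|

/-- The coefficient `G(z, α)`, where `z` stands for `|∇f|`. -/
def coeffG (ν : ℝ → ℝ) (z α : ℝ) : ℝ :=
  1 / evenExt ν (z * Real.sin α) ^ 2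

/-- The weight `ν'(z cos ϑ) / ν(z cos ϑ)⁴` in the integrals for `H₁`, `H₂`, `H₃`. -/
def weightH (ν : ℝ → ℝ) (z ϑ : ℝ) : ℝ :=
  deriv (evenExt ν) (z * Real.cos ϑ) / evenExt ν (z * Real.cos ϑ) ^ 4

def coeffH₁ (ν : ℝ → ℝ) (z α : ℝ) : ℝ :=
  3 / 2 * evenExt ν (z * Real.sin α) *
    ∫ ϑ in (α - Real.pi / 2)..(α + Real.pi / 2), weightH ν z ϑ * Real.cos ϑ ^ 2

def coeffH₂ (ν : ℝ → ℝ) (z α : ℝ) : ℝ :=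
  3 / 2 * evenExt ν (z * Real.sin α) *
    ∫ ϑ in (α - Real.pi / 2)..(α + Real.pi / 2), weightH ν z ϑ * (Real.sin ϑ * Real.cos ϑ)

def coeffH₃ (ν : ℝ → ℝ) (z α : ℝ) : ℝ :=
  3 / 2 * evenExt ν (z * Real.sin α) *
    ∫ ϑ in (α - Real.pi / 2)..(α + Real.pi / 2), weightH ν z ϑ * Real.sin ϑ ^ 2

/-- The right-hand side
`G u_ξξ - |∇u| (H₁ f_χχ + 2 H₂ f_χζ + H₃ f_ζζ)` of the amoeba active contour equation at `x`. -/
def aacRhs (ν : ℝ → ℝ) (u f : Plane → ℝ) (ξ χ ζ : Plane) (α : ℝ) (x : Plane) : ℝ :=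
  coeffG ν ‖gradient f x‖ α * hess u x ξ ξ -
    ‖gradient u x‖ *
      (coeffH₁ ν ‖gradient f x‖ α * hess f x χ χ
        + 2 * coeffH₂ ν ‖gradient f x‖ α * hess f x χ ζ
        + coeffH₃ ν ‖gradient f x‖ α * hess f x ζ ζ)

/-- The (generalised) inverse of the increasing function `w ↦ φ (w, 1)` on `[0,∞)`. -/
def profileInv (φ : Seminorm ℝ (ℝ × ℝ)) (y : ℝ) : ℝ :=
  sSup {w : ℝ | 0 ≤ w ∧ φ (w, 1) ≤ y}

/-- The edge-stopping function of the amoeba metric: with `μ(w) = φ(w, 1)`,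
`g(z) = 3 / (z² μ(1/z)³) ∫₀¹ r² √(μ⁻¹(μ(1/z)/r)² - 1/z²) dr` for `z > 0`. -/
def edgeStop (φ : Seminorm ℝ (ℝ × ℝ)) (z : ℝ) : ℝ :=
  3 / (z ^ 2 * φ (1 / z, 1) ^ 3) *
    ∫ r in (0 : ℝ)..1,
      r ^ 2 * Real.sqrt (profileInv φ (φ (1 / z, 1) / r) ^ 2 - 1 / z ^ 2)

/-- The vector field `g(|∇f|) ∇u / |∇u|` of the geodesic active contour equation. -/
def gacFlux (φ : Seminorm ℝ (ℝ × ℝ)) (u f : Plane → ℝ) (y : Plane) : Plane :=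
  (edgeStop φ ‖gradient f y‖ / ‖gradient u y‖) • gradient u y

end Amoeba

end

/-! Take the orthonormal frame at `x` whose first vector is `∇u / |∇u|` and rescale by `ρ`. The
graph distance is squeezed between two explicit expressions. From below, Jensen's inequality for the
convex `φ` gives the chordal distance `φ(‖y - x‖, f y - f x)` (`ofReal_apply_le_amoebaDist`). From
above, the straight segment is a competitor; along it the derivative of `f` stays within `B‖y - x‖²`
of its mean, so convexity bounds its length by the average of `φ` at the two tonal values `f y - f x
± B‖y - x‖²` (`amoebaDist_le`). Up to the origin, the rescaled amoeba thus lies between two secant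
balls, with `κ = B` (inner) and `κ = 0` (outer).

The two perturbations `±κ` cancel to first order in every direction where `ν` is differentiable,
hence in almost every direction. Both balls are therefore the same first-order deformation of the
unit ball of the tangent norm, and their areas differ by `o(ρ)` (`tendsto_area_diff`). This holds
although `ν` is only Lipschitz.

The median is found from the signed area of the two sides of the level `u(x) + kρ²`. Divided by `ρ`,
it has two contributions. The thin strip between that level line and the axis gives the `G` term and
the shift `k` (`tendsto_integral_strip`). The boundary layer between secant and tangent ball,
weighted with the sign of the first coordinate, gives the `H` terms (`tendsto_integral_ballDiff`).
The tangent ball itself is centrally symmetric and gives nothing. The limit is a positive multiple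
of `balance - k`, and six times `balance` is `R` (`six_mul_balance`), so every median is `u(x) +
(balance + o(1)) ρ²`. Uniqueness holds because `u` takes all values in such a window on sets of
positive area.

For the reduction, the layer-cake formula and the substitution `t = tan ϑ / z` turn `g(z)` into half
the integral of `cos ϑ / ν(z cos ϑ)³` over the half circle (`edgeStop_eq_arcMean`). Differentiation
under the integral gives `g' = -H₁`, integration by parts gives `g = 1 - z H₃`, both at `α = 0`; the
equality of curvatures then exchanges `z H₃ u_ξξ` for `|∇u| H₃ f_ζζ`. -/

namespace Amoeba

/-! ### The norm `φ` and its profile `ν` -/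

section Norm

variable {φ : Seminorm ℝ (ℝ × ℝ)} {ν : ℝ → ℝ}

theorem evenExt_neg (ν : ℝ → ℝ) (z : ℝ) : evenExt ν (-z) = evenExt ν z := by
  simp [evenExt]

theorem IsAmoebaNorm.apply_eq_evenExt (hφ : IsAmoebaNorm φ ν) {s : ℝ} (hs : s ≠ 0) (t : ℝ) :
    φ (s, t) = |s| * evenExt ν (t / s) :=
  hφ.apply_eq s t hs

theorem IsAmoebaNorm.apply_one (hφ : IsAmoebaNorm φ ν) (t : ℝ) : φ (1, t) = evenExt ν t := by
  simp [hφ.apply_eq_evenExt one_ne_zero]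

theorem IsAmoebaNorm.evenExt_le_evenExt (hφ : IsAmoebaNorm φ ν) {a b : ℝ} (h : |a| ≤ |b|) :
    evenExt ν a ≤ evenExt ν b :=
  hφ.monotoneOn (abs_nonneg a) (abs_nonneg b) h

theorem IsAmoebaNorm.one_le_evenExt (hφ : IsAmoebaNorm φ ν) (z : ℝ) : 1 ≤ evenExt ν z := by
  have := hφ.evenExt_le_evenExt (a := 0) (b := z) (by simp)
  simpa [evenExt, hφ.apply_zero] using this

theorem IsAmoebaNorm.evenExt_pos (hφ : IsAmoebaNorm φ ν) (z : ℝ) : 0 < evenExt ν z :=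
  one_pos.trans_le (hφ.one_le_evenExt z)

theorem IsAmoebaNorm.abs_le_apply (hφ : IsAmoebaNorm φ ν) (s t : ℝ) : |s| ≤ φ (s, t) := by
  rcases eq_or_ne s 0 with rfl | hs
  · simp
  · rw [hφ.apply_eq_evenExt hs]
    exact le_mul_of_one_le_right (abs_nonneg s) (hφ.one_le_evenExt _)

theorem IsAmoebaNorm.apply_neg_fst (hφ : IsAmoebaNorm φ ν) (s t : ℝ) : φ (-s, t) = φ (s, t) := by
  rcases eq_or_ne s 0 with rfl | hs
  · simp
  · rw [hφ.apply_eq_evenExt hs, hφ.apply_eq_evenExt (neg_ne_zero.2 hs), div_neg, evenExt_neg,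
      abs_neg]

theorem IsAmoebaNorm.apply_neg_snd (hφ : IsAmoebaNorm φ ν) (s t : ℝ) : φ (s, -t) = φ (s, t) := by
  rw [← hφ.apply_neg_fst, ← map_neg_eq_map φ]
  simp

theorem IsAmoebaNorm.apply_abs_snd (hφ : IsAmoebaNorm φ ν) (s t : ℝ) : φ (s, |t|) = φ (s, t) := by
  rcases abs_choice t with h | h <;> simp [h, hφ.apply_neg_snd]

/-- The point `(s, t)` is a convex combination of `(s', t)` and `(-s', t)`, which have equal norm.
-/
theorem IsAmoebaNorm.apply_mono_fst (hφ : IsAmoebaNorm φ ν) {s s' : ℝ} (hs : 0 ≤ s) (h : s ≤ s')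
    (t : ℝ) : φ (s, t) ≤ φ (s', t) := by
  rcases (hs.trans h).eq_or_lt with h0 | h0
  · rw [show s = s' by linarith]
  have key : ((s, t) : ℝ × ℝ) = ((1 + s / s') / 2) • (s', t) + ((1 - s / s') / 2) • (-s', t) := by
    ext
    · simp only [Prod.smul_mk, smul_eq_mul, Prod.mk_add_mk]; field_simp; ring
    · simp only [Prod.smul_mk, smul_eq_mul, Prod.mk_add_mk]; ring
  have h1 : s / s' ≤ 1 := (div_le_one h0).2 h
  have h2 : 0 ≤ s / s' := by positivity
  rw [key]
  refine (map_add_le_add φ _ _).trans ?_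
  rw [map_smul_eq_mul, map_smul_eq_mul, hφ.apply_neg_fst, Real.norm_of_nonneg (by linarith),
    Real.norm_of_nonneg (by linarith)]
  linarith

theorem abs_apply_sub_apply_le (φ : Seminorm ℝ (ℝ × ℝ)) (s t t' : ℝ) :
    |φ (s, t) - φ (s, t')| ≤ φ (0, 1) * |t - t'| := by
  refine (abs_sub_map_le_sub φ _ _).trans_eq ?_
  rw [show ((s, t) - (s, t') : ℝ × ℝ) = (t - t') • (0, 1) by simp, map_smul_eq_mul, Real.norm_eq_abs,
    mul_comm]

theorem continuous_seminorm_prod (φ : Seminorm ℝ (ℝ × ℝ)) : Continuous φ :=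
  continuousOn_univ.1 (φ.convexOn.continuousOn isOpen_univ)

theorem IsAmoebaNorm.lipschitzWith_evenExt (hφ : IsAmoebaNorm φ ν) :
    LipschitzWith (φ (0, 1)).toNNReal (evenExt ν) := by
  refine LipschitzWith.of_dist_le_mul fun a b => ?_
  rw [← hφ.apply_one, ← hφ.apply_one, Real.coe_toNNReal _ (apply_nonneg φ _)]
  exact abs_apply_sub_apply_le φ 1 a b

theorem IsAmoebaNorm.continuous_evenExt (hφ : IsAmoebaNorm φ ν) : Continuous (evenExt ν) :=
  hφ.lipschitzWith_evenExt.continuous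

theorem IsAmoebaNorm.abs_deriv_evenExt_le (hφ : IsAmoebaNorm φ ν) (z : ℝ) :
    |deriv (evenExt ν) z| ≤ φ (0, 1) :=
  (norm_deriv_le_of_lipschitz hφ.lipschitzWith_evenExt).trans_eq
    (Real.coe_toNNReal _ (apply_nonneg φ _))

theorem deriv_evenExt_neg (ν : ℝ → ℝ) (z : ℝ) :
    deriv (evenExt ν) (-z) = -deriv (evenExt ν) z := by
  have h := deriv_comp_neg (evenExt ν) z
  simp only [evenExt_neg] at h
  rw [h, neg_neg]

/-- For almost every angle, `ν` is differentiable at `z cos ϑ`. -/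
theorem IsAmoebaNorm.ae_differentiableAt_cos (hφ : IsAmoebaNorm φ ν) {z : ℝ} (hz : z ≠ 0) :
    ∀ᵐ ϑ : ℝ, DifferentiableAt ℝ (evenExt ν) (z * Real.cos ϑ) := by
  -- The composition with the cosine is Lipschitz, hence differentiable almost everywhere. Where
  -- `sin ϑ ≠ 0`, a local inverse of `z cos` carries differentiability back to `ν`.
  have hlip : LipschitzWith ((φ (0, 1)).toNNReal * (‖z‖₊ * 1))
      (fun ϑ => evenExt ν (z * Real.cos ϑ)) := by
    refine hφ.lipschitzWith_evenExt.comp ?_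
    refine LipschitzWith.comp (lipschitzWith_smul z) ?_
    exact lipschitzWith_of_nnnorm_deriv_le Real.differentiable_cos fun x => by
      rw [Real.deriv_cos]; simpa [← NNReal.coe_le_coe] using Real.abs_sin_le_one x
  have hnull : ∀ᵐ ϑ : ℝ, Real.sin ϑ ≠ 0 := by
    have hc : {ϑ : ℝ | Real.sin ϑ = 0}.Countable := by
      have : {ϑ : ℝ | Real.sin ϑ = 0} = range fun n : ℤ => (n : ℝ) * Real.pi := by
        ext ϑ; simp [Real.sin_eq_zero_iff]
      rw [this]; exact countable_range _
    filter_upwards [hc.ae_notMem volume] with ϑ h using h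
  filter_upwards [hlip.ae_differentiableAt_real, hnull] with ϑ hd hs
  have hstrict : HasStrictDerivAt (fun ϑ => z * Real.cos ϑ) (z * -Real.sin ϑ) ϑ :=
    (Real.hasStrictDerivAt_cos ϑ).const_mul z
  have hne : z * -Real.sin ϑ ≠ 0 := mul_ne_zero hz (neg_ne_zero.2 hs)
  have hinv := hstrict.to_localInverse hne
  have hright := (hstrict.hasStrictFDerivAt_equiv hne).eventually_right_inverse
  have hself : hstrict.localInverse _ _ _ hne (z * Real.cos ϑ) = ϑ :=
    (hstrict.hasStrictFDerivAt_equiv hne).localInverse_apply_image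
  have hcomp : DifferentiableAt ℝ ((fun ϑ => evenExt ν (z * Real.cos ϑ)) ∘
      hstrict.localInverse _ _ _ hne) (z * Real.cos ϑ) := by
    refine DifferentiableAt.comp _ ?_ hinv.hasDerivAt.differentiableAt
    rw [hself]; exact hd
  refine hcomp.congr_of_eventuallyEq ?_
  filter_upwards [hright] with y hy
  exact (congrArg (evenExt ν) hy).symm

theorem measurable_weightH (hφ : IsAmoebaNorm φ ν) (z : ℝ) : Measurable (weightH ν z) :=
  ((measurable_deriv _).comp (by fun_prop)).div
    ((hφ.continuous_evenExt.measurable.comp (by fun_prop)).pow_const 4)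

theorem IsAmoebaNorm.abs_weightH_le (hφ : IsAmoebaNorm φ ν) (z ϑ : ℝ) :
    |weightH ν z ϑ| ≤ φ (0, 1) := by
  rw [weightH, abs_div, abs_of_pos (pow_pos (hφ.evenExt_pos _) 4)]
  exact (div_le_self (abs_nonneg _) (one_le_pow₀ (hφ.one_le_evenExt _))).trans
    (hφ.abs_deriv_evenExt_le _)

theorem IsAmoebaNorm.intervalIntegrable_weightH_mul (hφ : IsAmoebaNorm φ ν) (z a b : ℝ)
    {h : ℝ → ℝ} (hh : Continuous h) :
    IntervalIntegrable (fun ϑ => weightH ν z ϑ * h ϑ) volume a b := by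
  have h1 : IntervalIntegrable (weightH ν z) volume a b := by
    rw [intervalIntegrable_iff]
    exact Measure.integrableOn_of_bounded (M := φ (0, 1)) (by simp)
      (measurable_weightH hφ z).aestronglyMeasurable (ae_of_all _ fun ϑ => hφ.abs_weightH_le z ϑ)
  exact h1.mul_continuousOn hh.continuousOn

/-- The derivative of an even function is odd. This later folds an integral over the full circle,
weighted with a sign, onto a half circle. -/
theorem weightH_add_pi (ν : ℝ → ℝ) (z ϑ : ℝ) : weightH ν z (ϑ + Real.pi) = -weightH ν z ϑ := by
  simp only [weightH, Real.cos_add_pi, mul_neg, deriv_evenExt_neg, evenExt_neg, neg_div]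

end Norm

/-! ### Tangent and secant gauges, and their first-order comparison -/

section Gauge

/-- The Euclidean norm in coordinates. -/
noncomputable def euclid (w : ℝ × ℝ) : ℝ := Real.sqrt (w.1 ^ 2 + w.2 ^ 2)

/-- The linear form with gradient of length `z` at angle `-α`. -/
noncomputable def linForm (z α : ℝ) (w : ℝ × ℝ) : ℝ := z * (w.1 * Real.cos α - w.2 * Real.sin α)

/-- A binary quadratic form. -/
def quadForm (A B C : ℝ) (w : ℝ × ℝ) : ℝ := A * w.1 ^ 2 + 2 * B * (w.1 * w.2) + C * w.2 ^ 2

/-- The unit vector at angle `ψ`. -/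
noncomputable def unitVec (ψ : ℝ) : ℝ × ℝ := (Real.cos ψ, Real.sin ψ)

/-- The gauge of the tangent norm. -/
noncomputable def tangentGauge (φ : Seminorm ℝ (ℝ × ℝ)) (z α : ℝ) (w : ℝ × ℝ) : ℝ := φ (euclid w, linForm z α w)

/-- The rescaled secant norm of the graph of `D`, averaged over a symmetric perturbation of the
tonal component of size `κ ρ |w|²`. -/
noncomputable def secantGauge (φ : Seminorm ℝ (ℝ × ℝ)) (D : ℝ × ℝ → ℝ) (κ ρ : ℝ) (w : ℝ × ℝ) : ℝ :=
  (φ (euclid w, D (ρ • w) / ρ - κ * ρ * euclid w ^ 2) +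
    φ (euclid w, D (ρ • w) / ρ + κ * ρ * euclid w ^ 2)) / 2

/-- The unit ball of the tangent norm. -/
def tangentBall (φ : Seminorm ℝ (ℝ × ℝ)) (z α : ℝ) : Set (ℝ × ℝ) := {w | tangentGauge φ z α w ≤ 1}

/-- The unit ball of the secant gauge. -/
def secantBall (φ : Seminorm ℝ (ℝ × ℝ)) (D : ℝ × ℝ → ℝ) (κ ρ : ℝ) : Set (ℝ × ℝ) :=
  {w | secantGauge φ D κ ρ w ≤ 1}

theorem euclid_nonneg (w : ℝ × ℝ) : 0 ≤ euclid w := Real.sqrt_nonneg _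

theorem continuous_euclid : Continuous euclid := by unfold euclid; fun_prop

theorem continuous_linForm (z α : ℝ) : Continuous (linForm z α) := by unfold linForm; fun_prop

theorem continuous_quadForm (A B C : ℝ) : Continuous (quadForm A B C) := by
  unfold quadForm; fun_prop

theorem euclid_smul_unitVec {s : ℝ} (hs : 0 ≤ s) (ψ : ℝ) : euclid (s • unitVec ψ) = s := by
  rw [euclid, show (s • unitVec ψ).1 ^ 2 + (s • unitVec ψ).2 ^ 2 = s ^ 2 by
    simp only [unitVec, Prod.smul_mk, smul_eq_mul]
    linear_combination s ^ 2 * Real.sin_sq_add_cos_sq ψ, Real.sqrt_sq hs]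

theorem linForm_smul (z α s : ℝ) (w : ℝ × ℝ) : linForm z α (s • w) = s * linForm z α w := by
  simp only [linForm, Prod.smul_fst, Prod.smul_snd, smul_eq_mul]; ring

theorem quadForm_smul (A B C s : ℝ) (w : ℝ × ℝ) :
    quadForm A B C (s • w) = s ^ 2 * quadForm A B C w := by
  simp only [quadForm, Prod.smul_fst, Prod.smul_snd, smul_eq_mul]; ring

theorem linForm_unitVec (z α ψ : ℝ) : linForm z α (unitVec ψ) = z * Real.cos (ψ + α) := by
  simp only [linForm, unitVec, Real.cos_add]

theorem abs_fst_le_euclid (w : ℝ × ℝ) : |w.1| ≤ euclid w :=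
  Real.abs_le_sqrt (by nlinarith [sq_nonneg w.2])

theorem abs_snd_le_euclid (w : ℝ × ℝ) : |w.2| ≤ euclid w :=
  Real.abs_le_sqrt (by nlinarith [sq_nonneg w.1])

theorem norm_le_euclid (w : ℝ × ℝ) : ‖w‖ ≤ euclid w := by
  rw [Prod.norm_def]; exact max_le (abs_fst_le_euclid w) (abs_snd_le_euclid w)

theorem abs_quadForm_le (A B C : ℝ) {w : ℝ × ℝ} (hw : euclid w ≤ 1) :
    |quadForm A B C w| ≤ |A| + 2 * |B| + |C| := by
  have h1 := (abs_fst_le_euclid w).trans hw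
  have h2 := (abs_snd_le_euclid w).trans hw
  have e1 : |w.1| ^ 2 ≤ 1 := pow_le_one₀ (abs_nonneg _) h1
  have e2 : |w.2| ^ 2 ≤ 1 := pow_le_one₀ (abs_nonneg _) h2
  have e3 : |w.1| * |w.2| ≤ 1 := mul_le_one₀ h1 (abs_nonneg _) h2
  refine (abs_add_three _ _ _).trans ?_
  simp only [abs_mul, abs_pow, abs_two]
  have := mul_le_mul_of_nonneg_left e1 (abs_nonneg A)
  have := mul_le_mul_of_nonneg_left e2 (abs_nonneg C)
  have := mul_le_mul_of_nonneg_left e3 (mul_nonneg zero_le_two (abs_nonneg B))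
  linarith

variable {φ : Seminorm ℝ (ℝ × ℝ)} {ν : ℝ → ℝ} {D : ℝ × ℝ → ℝ} {z α A B C : ℝ}

theorem IsAmoebaNorm.euclid_le_tangentGauge (hφ : IsAmoebaNorm φ ν) (z α : ℝ) (w : ℝ × ℝ) :
    euclid w ≤ tangentGauge φ z α w :=
  (le_abs_self _).trans (hφ.abs_le_apply _ _)

theorem IsAmoebaNorm.euclid_le_secantGauge (hφ : IsAmoebaNorm φ ν) (D : ℝ × ℝ → ℝ) (κ ρ : ℝ)
    (w : ℝ × ℝ) : euclid w ≤ secantGauge φ D κ ρ w := by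
  have h (t : ℝ) : euclid w ≤ φ (euclid w, t) := (le_abs_self _).trans (hφ.abs_le_apply _ _)
  rw [secantGauge, le_div_iff₀ two_pos]
  linarith [h (D (ρ • w) / ρ - κ * ρ * euclid w ^ 2), h (D (ρ • w) / ρ + κ * ρ * euclid w ^ 2)]

theorem IsAmoebaNorm.euclid_le_one_of_mem_tangentBall (hφ : IsAmoebaNorm φ ν) {w : ℝ × ℝ}
    (hw : w ∈ tangentBall φ z α) : euclid w ≤ 1 :=
  (hφ.euclid_le_tangentGauge z α w).trans hw

theorem IsAmoebaNorm.euclid_le_one_of_mem_secantBall (hφ : IsAmoebaNorm φ ν) {κ ρ : ℝ}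
    {w : ℝ × ℝ} (hw : w ∈ secantBall φ D κ ρ) : euclid w ≤ 1 :=
  (hφ.euclid_le_secantGauge D κ ρ w).trans hw

theorem continuous_tangentGauge (φ : Seminorm ℝ (ℝ × ℝ)) (z α : ℝ) :
    Continuous (tangentGauge φ z α) :=
  (continuous_seminorm_prod φ).comp (continuous_euclid.prodMk (continuous_linForm z α))

theorem measurableSet_tangentBall (φ : Seminorm ℝ (ℝ × ℝ)) (z α : ℝ) :
    MeasurableSet (tangentBall φ z α) :=
  (isClosed_le (continuous_tangentGauge φ z α) continuous_const).measurableSet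

theorem measurableSet_secantBall (φ : Seminorm ℝ (ℝ × ℝ)) (hD : Measurable D) (κ ρ : ℝ) :
    MeasurableSet (secantBall φ D κ ρ) := by
  have hφ := (continuous_seminorm_prod φ).measurable
  have he := continuous_euclid.measurable
  have hD' : Measurable fun w => D (ρ • w) / ρ := (hD.comp (measurable_const_smul ρ)).div_const ρ
  have hk : Measurable fun w => κ * ρ * euclid w ^ 2 := (he.pow_const 2).const_mul _
  exact measurableSet_le (((hφ.comp (he.prodMk (hD'.sub hk))).add
    (hφ.comp (he.prodMk (hD'.add hk)))).div_const 2) measurable_const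

/-- By convexity, the average of `φ` at two symmetric points is at least its value at their
midpoint. -/
theorem secantBall_subset_secantBall_zero (φ : Seminorm ℝ (ℝ × ℝ)) (D : ℝ × ℝ → ℝ) (κ ρ : ℝ) :
    secantBall φ D κ ρ ⊆ secantBall φ D 0 ρ := by
  intro w hw
  have hw' : secantGauge φ D κ ρ w ≤ 1 := hw
  change secantGauge φ D 0 ρ w ≤ 1
  refine le_trans ?_ hw'
  set t := D (ρ • w) / ρ
  set k := κ * ρ * euclid w ^ 2
  have h : ((euclid w, t) : ℝ × ℝ) =
      (1 / 2 : ℝ) • (euclid w, t - k) + (1 / 2 : ℝ) • (euclid w, t + k) := by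
    ext <;> simp <;> ring
  have h2 : φ (euclid w, t) ≤ (φ (euclid w, t - k) + φ (euclid w, t + k)) / 2 := by
    rw [h]
    refine (map_add_le_add φ _ _).trans_eq ?_
    rw [map_smul_eq_mul, map_smul_eq_mul]; norm_num; ring
  simpa [secantGauge] using h2

/-- `D` has the second-order expansion `l + q` at the origin. -/
def HasExpansion (D l q : ℝ × ℝ → ℝ) : Prop :=
  (fun v => D v - l v - q v) =o[𝓝 0] fun v => ‖v‖ ^ 2

/-- The point is allowed to move with `ρ`, as do the points of the boundary layer at radius `1/n +
ρσ` and the points `(ρt, q)` of the strip. -/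
theorem HasExpansion.tendsto_div_sq
    (hD : HasExpansion D (linForm z α) (quadForm A B C)) {w : ℝ → ℝ × ℝ}
    {w₀ : ℝ × ℝ} (hw : Tendsto w (𝓝[>] 0) (𝓝 w₀)) :
    Tendsto (fun ρ => (D (ρ • w ρ) - ρ * linForm z α (w ρ)) / ρ ^ 2) (𝓝[>] 0)
      (𝓝 (quadForm A B C w₀)) := by
  have h0 : Tendsto (fun ρ : ℝ => ρ • w ρ) (𝓝[>] 0) (𝓝 0) := by
    have := (tendsto_id.mono_left nhdsWithin_le_nhds : Tendsto id (𝓝[>] (0 : ℝ)) (𝓝 0)).smul hw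
    simpa using this
  have h1 := hD.comp_tendsto h0
  have h2 : (fun ρ : ℝ => ‖ρ • w ρ‖ ^ 2) =O[𝓝[>] 0] fun ρ => ρ ^ 2 := by
    have hb : w =O[𝓝[>] 0] fun _ => (1 : ℝ) := hw.isBigO_one ℝ
    have := (((Asymptotics.isBigO_refl (fun ρ : ℝ => ρ) (𝓝[>] 0)).smul hb).norm_left).pow 2
    simpa using this
  have h3 := (h1.trans_isBigO h2).tendsto_div_nhds_zero
  have h4 := h3.add (((continuous_quadForm A B C).tendsto w₀).comp hw)
  rw [zero_add] at h4
  refine h4.congr' ?_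
  filter_upwards [self_mem_nhdsWithin] with ρ (hρ : 0 < ρ)
  simp only [Function.comp, linForm_smul, quadForm_smul]
  field_simp
  ring

theorem HasExpansion.eventually_bound
    (hD : HasExpansion D (linForm z α) (quadForm A B C)) :
    ∃ K, 0 ≤ K ∧ ∀ᶠ ρ in 𝓝[>] (0 : ℝ), ∀ w, euclid w ≤ 1 →
      |D (ρ • w) / ρ - linForm z α w| ≤ K * ρ := by
  -- The summand `1` pays for the `o(‖v‖²)` remainder, the rest for the quadratic form on the unit
  -- disc.
  refine ⟨1 + (|A| + 2 * |B| + |C|), by positivity, ?_⟩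
  have h := hD.bound (one_pos : (0 : ℝ) < 1)
  obtain ⟨r, hr, hball⟩ := Metric.eventually_nhds_iff_ball.1 h
  filter_upwards [Ioo_mem_nhdsGT hr] with ρ hρ w hw
  have hw1 : ‖w‖ ≤ 1 := (norm_le_euclid w).trans hw
  have hmem : ρ • w ∈ Metric.ball (0 : ℝ × ℝ) r := by
    rw [mem_ball_zero_iff, norm_smul, Real.norm_of_nonneg hρ.1.le]
    nlinarith [hρ.1, hρ.2]
  have h1 := hball _ hmem
  rw [one_mul, Real.norm_eq_abs, Real.norm_eq_abs, abs_of_nonneg (sq_nonneg ‖ρ • w‖), norm_smul,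
    Real.norm_of_nonneg hρ.1.le, linForm_smul, quadForm_smul] at h1
  have h2 : |D (ρ • w) - ρ * linForm z α w| ≤ (1 + (|A| + 2 * |B| + |C|)) * ρ ^ 2 := by
    have h3 := abs_quadForm_le A B C hw
    have h4 : |ρ ^ 2 * quadForm A B C w| ≤ ρ ^ 2 * (|A| + 2 * |B| + |C|) := by
      rw [abs_mul, abs_of_nonneg (sq_nonneg ρ)]
      exact mul_le_mul_of_nonneg_left h3 (sq_nonneg ρ)
    have h5 : (ρ * ‖w‖) ^ 2 ≤ ρ ^ 2 := by
      rw [mul_pow]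
      exact mul_le_of_le_one_right (sq_nonneg ρ) (pow_le_one₀ (norm_nonneg _) hw1)
    have h6 := abs_add_le (D (ρ • w) - ρ * linForm z α w - ρ ^ 2 * quadForm A B C w)
      (ρ ^ 2 * quadForm A B C w)
    rw [sub_add_cancel] at h6
    linarith
  rw [show D (ρ • w) / ρ - linForm z α w = (D (ρ • w) - ρ * linForm z α w) / ρ by
    field_simp [hρ.1.ne'], abs_div, abs_of_pos hρ.1, div_le_iff₀ hρ.1]
  linarith

/-- `φ` is Lipschitz in its second slot. The uniformity in `w` confines the difference of the two
balls to a layer of width `O(ρ)` and supplies the dominating function for the limit. -/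
theorem HasExpansion.eventually_abs_secantGauge_sub_le
    (hD : HasExpansion D (linForm z α) (quadForm A B C)) (φ : Seminorm ℝ (ℝ × ℝ)) (κ : ℝ) :
    ∃ K, 0 ≤ K ∧ ∀ᶠ ρ in 𝓝[>] (0 : ℝ), ∀ w, euclid w ≤ 1 →
      |secantGauge φ D κ ρ w - tangentGauge φ z α w| ≤ K * ρ := by
  obtain ⟨K, hK, h⟩ := hD.eventually_bound
  refine ⟨φ (0, 1) * (K + |κ|), by positivity, ?_⟩
  filter_upwards [h, self_mem_nhdsWithin] with ρ hρ (hρ0 : 0 < ρ) w hw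
  have hk : |κ * ρ * euclid w ^ 2| ≤ |κ| * ρ := by
    rw [abs_mul, abs_mul, abs_of_pos hρ0, abs_of_nonneg (sq_nonneg (euclid w))]
    exact mul_le_of_le_one_right (by positivity) (pow_le_one₀ (euclid_nonneg _) hw)
  have key (k : ℝ) (hk : |k| ≤ |κ| * ρ) :
      |φ (euclid w, D (ρ • w) / ρ + k) - tangentGauge φ z α w| ≤ φ (0, 1) * (K + |κ|) * ρ := by
    refine (abs_apply_sub_apply_le φ _ _ _).trans ?_
    rw [mul_assoc]
    refine mul_le_mul_of_nonneg_left ?_ (apply_nonneg φ _)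
    rw [add_sub_right_comm]
    refine (abs_add_le _ _).trans ?_
    linarith [hρ w hw]
  have h1 := abs_le.1 (key _ hk)
  have h2 := abs_le.1 (key (-(κ * ρ * euclid w ^ 2)) (by rwa [abs_neg]))
  rw [← sub_eq_add_neg] at h2
  rw [secantGauge, abs_le]
  constructor <;> linarith

/-- A one-sided chain rule in which the inner increment needs only a limiting quotient. -/
theorem tendsto_comp_slope {g δ : ℝ → ℝ} {g' a c : ℝ} (hg : HasDerivAt g g' a)
    (hδ : Tendsto (fun ρ => δ ρ / ρ) (𝓝[>] 0) (𝓝 c)) :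
    Tendsto (fun ρ => (g (a + δ ρ) - g a) / ρ) (𝓝[>] 0) (𝓝 (g' * c)) := by
  have hρ : Tendsto (fun ρ : ℝ => ρ) (𝓝[>] 0) (𝓝 0) := tendsto_id.mono_left nhdsWithin_le_nhds
  have hne : ∀ᶠ ρ : ℝ in 𝓝[>] 0, ρ ≠ 0 := by
    filter_upwards [self_mem_nhdsWithin] with ρ (h : 0 < ρ) using h.ne'
  have hδ0 : Tendsto δ (𝓝[>] 0) (𝓝 0) := by
    have := hδ.mul hρ
    rw [mul_zero] at this
    exact this.congr' (hne.mono fun ρ h => div_mul_cancel₀ _ h)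
  have hO : δ =O[𝓝[>] 0] fun ρ => ρ :=
    Asymptotics.isBigO_of_div_tendsto_nhds (hne.mono fun ρ h h' => absurd h' h) c hδ
  have h1 := (hasDerivAt_iff_isLittleO_nhds_zero.1 hg).comp_tendsto hδ0
  have h2 := (h1.trans_isBigO hO).tendsto_div_nhds_zero
  have h3 := h2.add (hδ.const_mul g')
  rw [zero_add] at h3
  refine h3.congr fun ρ => ?_
  simp only [Function.comp, smul_eq_mul]
  ring

/-- First-order behaviour of the secant gauge along the ray at angle `ψ`, near the boundary of
the tangent ball. -/
theorem HasExpansion.tendsto_secantGauge_sub_one (hφ : IsAmoebaNorm φ ν)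
    (hD : HasExpansion D (linForm z α) (quadForm A B C)) (κ σ : ℝ) {ψ : ℝ}
    (hψ : DifferentiableAt ℝ (evenExt ν) (z * Real.cos (ψ + α))) :
    Tendsto (fun ρ => (secantGauge φ D κ ρ
        ((1 / evenExt ν (z * Real.cos (ψ + α)) + ρ * σ) • unitVec ψ) - 1) / ρ) (𝓝[>] 0)
      (𝓝 (evenExt ν (z * Real.cos (ψ + α)) * σ +
        deriv (evenExt ν) (z * Real.cos (ψ + α)) * quadForm A B C (unitVec ψ) /
          evenExt ν (z * Real.cos (ψ + α)) ^ 2)) := by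
  set a := z * Real.cos (ψ + α) with ha
  set n := evenExt ν a with hn
  have hn0 : 0 < n := hφ.evenExt_pos a
  set q := quadForm A B C (unitVec ψ)
  set s : ℝ → ℝ := fun ρ => 1 / n + ρ * σ with hs
  have hρ : Tendsto (fun ρ : ℝ => ρ) (𝓝[>] 0) (𝓝 0) := tendsto_id.mono_left nhdsWithin_le_nhds
  have hs0 : Tendsto s (𝓝[>] 0) (𝓝 (1 / n)) := by
    simpa [hs] using (hρ.mul_const σ).const_add (1 / n)
  have hspos : ∀ᶠ ρ in 𝓝[>] 0, 0 < s ρ := hs0.eventually_const_lt (by positivity)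
  have hw : Tendsto (fun ρ => s ρ • unitVec ψ) (𝓝[>] 0) (𝓝 ((1 / n) • unitVec ψ)) :=
    hs0.smul_const _
  have hexp := hD.tendsto_div_sq hw
  have hside (k : ℝ) : Tendsto (fun ρ => (φ (euclid (s ρ • unitVec ψ),
      D (ρ • s ρ • unitVec ψ) / ρ + k * ρ * euclid (s ρ • unitVec ψ) ^ 2) - 1) / ρ) (𝓝[>] 0)
      (𝓝 (1 / n * (deriv (evenExt ν) a * (q / n + k / n)) + n * σ)) := by
    -- Since `φ(s, t) = s ν(t/s)`, only the deviation `δ` of the slope `t/s` from its tangent value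
    -- `a` matters.
    set δ : ℝ → ℝ := fun ρ => D (ρ • s ρ • unitVec ψ) / ρ / s ρ + k * ρ * s ρ - a
    have hδ : Tendsto (fun ρ => δ ρ / ρ) (𝓝[>] 0) (𝓝 (q / n + k / n)) := by
      have h1 := (hexp.div hs0 (by positivity)).add (hs0.const_mul k)
      rw [quadForm_smul] at h1
      convert h1.congr' ?_ using 2
      · field_simp; rfl
      · filter_upwards [hspos, self_mem_nhdsWithin] with ρ h0 (hρ0 : 0 < ρ)
        simp only [δ, Pi.div_apply, linForm_smul, linForm_unitVec, ← ha]
        field_simp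
        ring
    have hslope := hs0.mul (tendsto_comp_slope hψ.hasDerivAt hδ)
    have h2 := hslope.add_const (n * σ)
    refine h2.congr' ?_
    filter_upwards [hspos, self_mem_nhdsWithin] with ρ h0 (hρ0 : 0 < ρ)
    rw [euclid_smul_unitVec h0.le, hφ.apply_eq_evenExt h0.ne', abs_of_pos h0]
    have : (D (ρ • s ρ • unitVec ψ) / ρ + k * ρ * s ρ ^ 2) / s ρ = a + δ ρ := by
      simp only [δ]; field_simp; ring
    rw [this, ← hn]
    have hsn : s ρ * n = 1 + ρ * σ * n := by simp only [hs]; field_simp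
    field_simp
    linear_combination -hsn
  -- The terms `±κ/n` enter linearly through the derivative of `ν` and cancel in the average: `κ`
  -- leaves no trace at first order.
  have h3 := ((hside (-κ)).add (hside κ)).div_const 2
  convert h3.congr' ?_ using 2
  · field_simp; ring
  · filter_upwards [self_mem_nhdsWithin] with ρ (hρ0 : 0 < ρ)
    simp only [secantGauge, neg_mul, ← sub_eq_add_neg, hs]
    ring

end Gauge

/-! ### The boundary layer in polar coordinates -/

section Polar

/-- This is the signed length of the interval from `0` to `d`. It integrates the radial limit of the
layer, whose boundary moves from `0` to `d`. -/
theorem integral_indicator_Iio_sub_Iic (d : ℝ) :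
    ∫ σ : ℝ, ((Iio d).indicator (fun _ => (1 : ℝ)) σ - (Iic 0).indicator (fun _ => (1 : ℝ)) σ) = d := by
  rcases le_or_gt d 0 with hd | hd
  · have : ∀ σ : ℝ, (Iio d).indicator (fun _ => (1 : ℝ)) σ - (Iic 0).indicator (fun _ => (1 : ℝ)) σ
        = (Icc d 0).indicator (fun _ => (-1 : ℝ)) σ := by
      intro σ
      by_cases h1 : σ < d
      · simp [h1, (h1.trans_le hd).le, h1.not_ge]
      · by_cases h2 : σ ≤ 0
        · simp [h1, h2, not_lt.1 h1]
        · simp [h1, h2]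
    simp_rw [this]
    rw [integral_indicator measurableSet_Icc]
    simp [hd]
  · have : ∀ σ : ℝ, (Iio d).indicator (fun _ => (1 : ℝ)) σ - (Iic 0).indicator (fun _ => (1 : ℝ)) σ
        = (Ioo 0 d).indicator (fun _ => (1 : ℝ)) σ := by
      intro σ
      by_cases h1 : σ < d
      · by_cases h2 : σ ≤ 0
        · simp [h1, h2, h2.not_gt]
        · simp [h1, h2, not_le.1 h2]
      · simp [h1, (hd.trans_le (not_lt.1 h1)).not_ge]
    simp_rw [this]
    rw [integral_indicator measurableSet_Ioo]
    simp [hd.le]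

/-- Boundedness and support in the unit disc provide the integrability that Fubini's theorem
requires. -/
theorem integral_eq_integral_polar {h : ℝ × ℝ → ℝ} (hm : Measurable h) (h1 : ∀ w, |h w| ≤ 1)
    (h0 : ∀ w, ¬ euclid w ≤ 1 → h w = 0) :
    ∫ w, h w = ∫ ψ in Ioo (-Real.pi) Real.pi, ∫ s in Ioi (0 : ℝ), s * h (s • unitVec ψ) := by
  rw [← integral_comp_polarCoord_symm, polarCoord_target, Measure.volume_eq_prod,
    ← setIntegral_prod_swap, setIntegral_prod]
  · rfl
  · have hsub : ∀ p : ℝ × ℝ, p ∈ Ioo (-Real.pi) Real.pi ×ˢ Ioi (0 : ℝ) →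
        ‖p.2 * h (p.2 • unitVec p.1)‖ ≤
          (univ ×ˢ Icc (0 : ℝ) 1).indicator (fun _ => (1 : ℝ)) p := by
      rintro ⟨ψ, s⟩ ⟨-, hs : 0 < s⟩
      by_cases h2 : s ≤ 1
      · rw [indicator_of_mem (by simp [h2, hs.le])]
        simp only [norm_mul, Real.norm_eq_abs, abs_of_pos hs]
        exact mul_le_one₀ h2 (abs_nonneg _) (h1 _)
      · have := h0 (s • unitVec ψ) (by rwa [euclid_smul_unitVec hs.le])
        simp [this, h2]
    refine Integrable.mono' (g := (univ ×ˢ Icc (0 : ℝ) 1).indicator (fun _ => (1 : ℝ))) ?_ ?_ ?_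
    · rw [integrable_indicator_iff (MeasurableSet.univ.prod measurableSet_Icc)]
      refine integrableOn_const ?_
      rw [← Measure.prod_restrict, Measure.prod_prod, Measure.restrict_apply_univ,
        Measure.restrict_apply measurableSet_Icc]
      refine ENNReal.mul_ne_top (by simp) (ne_top_of_le_ne_top ?_ (measure_mono inter_subset_left))
      simp
    · refine Measurable.aestronglyMeasurable ?_
      have : Measurable fun p : ℝ × ℝ => p.2 • unitVec p.1 := by
        unfold unitVec; fun_prop
      exact measurable_snd.mul (hm.comp this)
    · exact (ae_restrict_iff' (measurableSet_Ioo.prod measurableSet_Ioi)).2 (ae_of_all _ hsub)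

/-- The layer variable `σ` magnifies the neighbourhood of the radius `s₀` by `1/ρ`; the indicator
discards negative radii. -/
theorem setIntegral_Ioi_comp_affine (F : ℝ → ℝ) (s₀ : ℝ) {ρ : ℝ} (hρ : 0 < ρ) :
    ∫ s in Ioi (0 : ℝ), F s = ρ * ∫ σ, (Ioi (0 : ℝ)).indicator F (s₀ + ρ * σ) := by
  rw [← integral_indicator measurableSet_Ioi]
  have h1 := Measure.integral_comp_mul_left (fun x => (Ioi (0 : ℝ)).indicator F (s₀ + x)) ρ
  rw [h1, integral_add_left_eq_self (μ := volume) ((Ioi (0 : ℝ)).indicator F) s₀,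
    abs_of_pos (inv_pos.2 hρ), smul_eq_mul, mul_inv_cancel_left₀ hρ.ne']

variable {φ : Seminorm ℝ (ℝ × ℝ)} {ν : ℝ → ℝ} {D : ℝ × ℝ → ℝ} {z α A B C : ℝ}

theorem IsAmoebaNorm.tangentGauge_smul_unitVec (hφ : IsAmoebaNorm φ ν) {s : ℝ} (hs : 0 < s)
    (ψ : ℝ) :
    tangentGauge φ z α (s • unitVec ψ) = s * evenExt ν (z * Real.cos (ψ + α)) := by
  rw [tangentGauge, euclid_smul_unitVec hs.le, linForm_smul, linForm_unitVec,
    hφ.apply_eq_evenExt hs.ne', abs_of_pos hs, mul_div_cancel_left₀ _ hs.ne']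

/-- The difference of the indicator functions of the secant ball and of the tangent ball. -/
noncomputable def ballDiff (φ : Seminorm ℝ (ℝ × ℝ)) (D : ℝ × ℝ → ℝ) (z α κ ρ : ℝ) (w : ℝ × ℝ) : ℝ :=
  (secantBall φ D κ ρ).indicator (fun _ => (1 : ℝ)) w -
    (tangentBall φ z α).indicator (fun _ => (1 : ℝ)) w

theorem measurable_ballDiff (φ : Seminorm ℝ (ℝ × ℝ)) (hD : Measurable D) (z α κ ρ : ℝ) :
    Measurable (ballDiff φ D z α κ ρ) :=
  (measurable_const.indicator (measurableSet_secantBall φ hD κ ρ)).sub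
    (measurable_const.indicator (measurableSet_tangentBall φ z α))

theorem abs_ballDiff_le (φ : Seminorm ℝ (ℝ × ℝ)) (D : ℝ × ℝ → ℝ) (z α κ ρ : ℝ) (w : ℝ × ℝ) :
    |ballDiff φ D z α κ ρ w| ≤ 1 := by
  by_cases h1 : w ∈ secantBall φ D κ ρ <;> by_cases h2 : w ∈ tangentBall φ z α <;>
    simp [ballDiff, h1, h2]

theorem IsAmoebaNorm.ballDiff_eq_zero (hφ : IsAmoebaNorm φ ν) {κ ρ : ℝ} {w : ℝ × ℝ}
    (hw : ¬ euclid w ≤ 1) : ballDiff φ D z α κ ρ w = 0 := by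
  have h1 : w ∉ secantBall φ D κ ρ := fun h => hw (hφ.euclid_le_one_of_mem_secantBall h)
  have h2 : w ∉ tangentBall φ z α := fun h => hw (hφ.euclid_le_one_of_mem_tangentBall h)
  simp [ballDiff, h1, h2]

/-- Off a boundary layer of width `O(ρ)`, the secant ball and the tangent ball agree. -/
theorem HasExpansion.eventually_ballDiff_eq_zero (hφ : IsAmoebaNorm φ ν)
    (hD : HasExpansion D (linForm z α) (quadForm A B C)) (κ : ℝ) :
    ∃ K, 0 ≤ K ∧ ∀ᶠ ρ in 𝓝[>] (0 : ℝ), ∀ ψ σ : ℝ, K < |σ| →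
      0 < 1 / evenExt ν (z * Real.cos (ψ + α)) + ρ * σ →
      ballDiff φ D z α κ ρ ((1 / evenExt ν (z * Real.cos (ψ + α)) + ρ * σ) • unitVec ψ) = 0 := by
  obtain ⟨K, hK, h⟩ := hD.eventually_abs_secantGauge_sub_le φ κ
  refine ⟨K, hK, ?_⟩
  filter_upwards [h, self_mem_nhdsWithin] with ρ hρ (hρ0 : 0 < ρ) ψ σ hσ hs
  set n := evenExt ν (z * Real.cos (ψ + α))
  set w := (1 / n + ρ * σ) • unitVec ψ
  have hn : 1 ≤ n := hφ.one_le_evenExt _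
  have ht : tangentGauge φ z α w = 1 + ρ * σ * n := by
    rw [hφ.tangentGauge_smul_unitVec hs]
    change (1 / n + ρ * σ) * n = _
    field_simp
  by_cases hw : euclid w ≤ 1
  swap
  · exact hφ.ballDiff_eq_zero hw
  have h1 := abs_le.1 (hρ w hw)
  rw [ht] at h1
  rcases le_total 0 σ with h0 | h0
  · rw [abs_of_nonneg h0] at hσ
    have h2 : K * ρ < ρ * σ * n := by
      nlinarith [mul_lt_mul_of_pos_left hσ hρ0, mul_nonneg (mul_nonneg hρ0.le h0) (sub_nonneg.2 hn)]
    have e1 : w ∉ secantBall φ D κ ρ := fun (h : secantGauge φ D κ ρ w ≤ 1) => by linarith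
    have e2 : w ∉ tangentBall φ z α := fun (h : tangentGauge φ z α w ≤ 1) => by
      rw [ht] at h; nlinarith [mul_nonneg hK hρ0.le]
    simp [ballDiff, e1, e2]
  · rw [abs_of_nonpos h0] at hσ
    have h2 : K * ρ < -(ρ * σ * n) := by
      nlinarith [mul_lt_mul_of_pos_left hσ hρ0,
        mul_nonneg (mul_nonneg hρ0.le (neg_nonneg.2 h0)) (sub_nonneg.2 hn)]
    have e1 : w ∈ secantBall φ D κ ρ := by
      change secantGauge φ D κ ρ w ≤ 1; linarith
    have e2 : w ∈ tangentBall φ z α := by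
      change tangentGauge φ z α w ≤ 1; rw [ht]; nlinarith [mul_nonneg hK hρ0.le]
    simp [ballDiff, e1, e2]

/-- Radial limit of the boundary layer. -/
theorem HasExpansion.tendsto_ballDiff (hφ : IsAmoebaNorm φ ν)
    (hD : HasExpansion D (linForm z α) (quadForm A B C)) (κ : ℝ) {ψ σ : ℝ}
    (hψ : DifferentiableAt ℝ (evenExt ν) (z * Real.cos (ψ + α)))
    (hσ : σ ≠ -(deriv (evenExt ν) (z * Real.cos (ψ + α)) * quadForm A B C (unitVec ψ) /
          evenExt ν (z * Real.cos (ψ + α)) ^ 3)) :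
    Tendsto (fun ρ => ballDiff φ D z α κ ρ
        ((1 / evenExt ν (z * Real.cos (ψ + α)) + ρ * σ) • unitVec ψ)) (𝓝[>] 0)
      (𝓝 ((Iio (-(deriv (evenExt ν) (z * Real.cos (ψ + α)) * quadForm A B C (unitVec ψ) /
          evenExt ν (z * Real.cos (ψ + α)) ^ 3))).indicator (fun _ => (1 : ℝ)) σ -
        (Iic 0).indicator (fun _ => (1 : ℝ)) σ)) := by
  have key := hD.tendsto_secantGauge_sub_one hφ κ σ hψ
  set n := evenExt ν (z * Real.cos (ψ + α))
  set β := deriv (evenExt ν) (z * Real.cos (ψ + α)) * quadForm A B C (unitVec ψ)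
  have hn : 0 < n := hφ.evenExt_pos _
  have hρ : Tendsto (fun ρ : ℝ => ρ) (𝓝[>] 0) (𝓝 0) := tendsto_id.mono_left nhdsWithin_le_nhds
  have hs0 : Tendsto (fun ρ : ℝ => 1 / n + ρ * σ) (𝓝[>] 0) (𝓝 (1 / n)) := by
    simpa using (hρ.mul_const σ).const_add (1 / n)
  have hspos : ∀ᶠ ρ : ℝ in 𝓝[>] 0, 0 < 1 / n + ρ * σ := hs0.eventually_const_lt (by positivity)
  have heq : n * (σ - -(β / n ^ 3)) = n * σ + β / n ^ 2 := by field_simp; ring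
  refine Tendsto.congr' (f₁ := fun _ => (Iio (-(β / n ^ 3))).indicator (fun _ => (1 : ℝ)) σ -
        (Iic 0).indicator (fun _ => (1 : ℝ)) σ) ?_ tendsto_const_nhds
  have hT : ∀ᶠ ρ : ℝ in 𝓝[>] 0, (tangentBall φ z α).indicator (fun _ => (1 : ℝ))
      ((1 / n + ρ * σ) • unitVec ψ) = (Iic 0).indicator (fun _ => (1 : ℝ)) σ := by
    filter_upwards [hspos, self_mem_nhdsWithin] with ρ hs (hρ0 : 0 < ρ)
    have : (1 / n + ρ * σ) • unitVec ψ ∈ tangentBall φ z α ↔ σ ∈ Iic (0 : ℝ) := by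
      change tangentGauge φ z α _ ≤ 1 ↔ σ ≤ 0
      rw [hφ.tangentGauge_smul_unitVec hs]
      change (1 / n + ρ * σ) * n ≤ 1 ↔ _
      rw [show (1 / n + ρ * σ) * n = 1 + (ρ * n) * σ by field_simp]
      have : 0 < ρ * n := by positivity
      constructor
      · intro h; by_contra! h'; nlinarith [mul_pos this h']
      · intro h; nlinarith
    by_cases h : σ ∈ Iic (0 : ℝ)
    · rw [indicator_of_mem h, indicator_of_mem (this.2 h)]
    · rw [indicator_of_notMem h, indicator_of_notMem (fun h' => h (this.1 h'))]
  have hS : ∀ᶠ ρ : ℝ in 𝓝[>] 0, (secantBall φ D κ ρ).indicator (fun _ => (1 : ℝ))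
      ((1 / n + ρ * σ) • unitVec ψ) = (Iio (-(β / n ^ 3))).indicator (fun _ => (1 : ℝ)) σ := by
    rcases lt_or_gt_of_ne hσ with h | h
    · have hneg : n * σ + β / n ^ 2 < 0 := by rw [← heq]; exact mul_neg_of_pos_of_neg hn (by linarith)
      filter_upwards [key.eventually_lt_const hneg, self_mem_nhdsWithin] with ρ h1 (hρ0 : 0 < ρ)
      rw [div_neg_iff] at h1
      have h2 : secantGauge φ D κ ρ ((1 / n + ρ * σ) • unitVec ψ) ≤ 1 := by
        rcases h1 with h1 | h1 <;> linarith
      rw [indicator_of_mem (show σ ∈ Iio _ from h), indicator_of_mem (show _ ∈ secantBall φ D κ ρ from h2)]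
    · have hpos : 0 < n * σ + β / n ^ 2 := by rw [← heq]; exact mul_pos hn (by linarith)
      filter_upwards [key.eventually_const_lt hpos, self_mem_nhdsWithin] with ρ h1 (hρ0 : 0 < ρ)
      have h2 := (div_pos_iff_of_pos_right hρ0).1 h1
      rw [indicator_of_notMem (show σ ∉ Iio _ from not_lt.2 h.le), indicator_of_notMem]
      exact fun (h3 : secantGauge φ D κ ρ _ ≤ 1) => by linarith
  filter_upwards [hT, hS] with ρ h1 h2
  rw [ballDiff, h1, h2]

/-- With `n = ν(z cos(ψ + α))`, the tangent ball ends at radius `1/n` in direction `ψ`, and the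
secant ball to first order at `1/n + ρd`, where `d = -ν' q / n³` and `q` is the quadratic form at
`unitVec ψ`. The Jacobian `1/n` completes the weight `ν'/n⁴`. Two dominated convergences, first in
the layer variable `σ` and then in the angle, make this rigorous. As `g` is constant along rays, it
can be evaluated at `unitVec ψ`. -/
theorem HasExpansion.tendsto_integral_ballDiff (hφ : IsAmoebaNorm φ ν) (hDm : Measurable D)
    (hD : HasExpansion D (linForm z α) (quadForm A B C)) (hz : z ≠ 0) (κ : ℝ) {g : ℝ × ℝ → ℝ}
    (hg : Measurable g) (hg1 : ∀ w, |g w| ≤ 1) (hgs : ∀ s : ℝ, 0 < s → ∀ w, g (s • w) = g w) :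
    Tendsto (fun ρ => (∫ w, ballDiff φ D z α κ ρ w * g w) / ρ) (𝓝[>] 0)
      (𝓝 (∫ ψ in Ioo (-Real.pi) Real.pi,
        -(weightH ν z (ψ + α) * quadForm A B C (unitVec ψ) * g (unitVec ψ)))) := by
  obtain ⟨K, hK, hlayer⟩ := hD.eventually_ballDiff_eq_zero hφ κ
  set n : ℝ → ℝ := fun ψ => evenExt ν (z * Real.cos (ψ + α)) with hn
  have hn1 (ψ : ℝ) : 1 ≤ n ψ := hφ.one_le_evenExt _
  have hncont : Continuous n := hφ.continuous_evenExt.comp (by fun_prop)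
  set F : ℝ → ℝ → ℝ → ℝ := fun ρ ψ σ => (Ioi (0 : ℝ)).indicator
    (fun s => s * (ballDiff φ D z α κ ρ (s • unitVec ψ) * g (s • unitVec ψ))) (1 / n ψ + ρ * σ)
    with hF
  have hFm (ρ : ℝ) : Measurable (Function.uncurry (F ρ)) := by
    have hker : Measurable fun p : ℝ × ℝ => (Ioi (0 : ℝ)).indicator (fun s =>
        s * (ballDiff φ D z α κ ρ (s • unitVec p.1) * g (s • unitVec p.1))) p.2 := by
      have hv : Measurable fun p : ℝ × ℝ => p.2 • unitVec p.1 := by unfold unitVec; fun_prop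
      have := (measurable_snd.mul (((measurable_ballDiff φ hDm z α κ ρ).comp hv).mul
        (hg.comp hv))).indicator (measurableSet_Ioi.preimage measurable_snd : MeasurableSet
          ((Prod.snd : ℝ × ℝ → ℝ) ⁻¹' Ioi 0))
      exact this
    have hs : Measurable fun p : ℝ × ℝ => (p.1, 1 / n p.1 + ρ * p.2) := by
      have := hncont.measurable
      fun_prop
    exact hker.comp hs
  have hrep : ∀ᶠ ρ in 𝓝[>] (0 : ℝ), ∫ ψ in Ioo (-Real.pi) Real.pi, ∫ σ, F ρ ψ σ =
      (∫ w, ballDiff φ D z α κ ρ w * g w) / ρ := by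
    filter_upwards [self_mem_nhdsWithin] with ρ (hρ : 0 < ρ)
    rw [integral_eq_integral_polar
      (h := fun w => ballDiff φ D z α κ ρ w * g w) ((measurable_ballDiff φ hDm z α κ ρ).mul hg), eq_div_iff hρ.ne',
      mul_comm, ← integral_const_mul]
    · refine integral_congr_ae (ae_of_all _ fun ψ => ?_)
      exact (setIntegral_Ioi_comp_affine _ (1 / n ψ) hρ).symm
    · intro w
      rw [abs_mul]
      exact mul_le_one₀ (abs_ballDiff_le ..) (abs_nonneg _) (hg1 w)
    · intro w hw
      rw [hφ.ballDiff_eq_zero hw, zero_mul]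
  refine Tendsto.congr' hrep ?_
  -- The integrand vanishes for `|σ| > K`, and elsewhere it is at most the radius, which is at most
  -- `1` on its support.
  have hbound : ∀ᶠ ρ in 𝓝[>] (0 : ℝ), ∀ ψ σ,
      ‖F ρ ψ σ‖ ≤ (Icc (-K) K).indicator (fun _ => (1 : ℝ)) σ := by
    filter_upwards [hlayer] with ρ hρ ψ σ
    by_cases hs : 0 < 1 / n ψ + ρ * σ
    swap
    · simp only [hF, indicator_of_notMem (show 1 / n ψ + ρ * σ ∉ Ioi (0 : ℝ) from hs), norm_zero]
      exact indicator_nonneg (fun _ _ => zero_le_one) _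
    simp only [hF, indicator_of_mem (show 1 / n ψ + ρ * σ ∈ Ioi (0 : ℝ) from hs)]
    by_cases hσ : K < |σ|
    · rw [hρ ψ σ hσ hs, zero_mul, mul_zero, norm_zero]
      exact indicator_nonneg (fun _ _ => zero_le_one) _
    · rw [indicator_of_mem (show σ ∈ Icc (-K) K from abs_le.1 (not_lt.1 hσ))]
      by_cases hw : euclid ((1 / n ψ + ρ * σ) • unitVec ψ) ≤ 1
      · rw [euclid_smul_unitVec hs.le] at hw
        rw [norm_mul, Real.norm_of_nonneg hs.le, norm_mul]
        exact mul_le_one₀ hw (by positivity)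
          (mul_le_one₀ (abs_ballDiff_le ..) (abs_nonneg _) (hg1 _))
      · rw [hφ.ballDiff_eq_zero hw]; simp
  have hKint : Integrable ((Icc (-K) K).indicator (fun _ => (1 : ℝ))) volume := by
    rw [integrable_indicator_iff measurableSet_Icc]
    exact integrableOn_const (by simp)
  have hinner : ∀ᵐ ψ : ℝ, Tendsto (fun ρ => ∫ σ, F ρ ψ σ) (𝓝[>] 0)
      (𝓝 (-(weightH ν z (ψ + α) * quadForm A B C (unitVec ψ) * g (unitVec ψ)))) := by
    have hae : ∀ᵐ ψ : ℝ, DifferentiableAt ℝ (evenExt ν) (z * Real.cos (ψ + α)) :=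
      (measurePreserving_add_right volume α).quasiMeasurePreserving.ae
        (hφ.ae_differentiableAt_cos hz)
    filter_upwards [hae] with ψ hψ
    set d := -(deriv (evenExt ν) (z * Real.cos (ψ + α)) * quadForm A B C (unitVec ψ) /
          evenExt ν (z * Real.cos (ψ + α)) ^ 3) with hd
    have hlim : ∫ σ, 1 / n ψ * (((Iio d).indicator (fun _ => (1 : ℝ)) σ -
        (Iic 0).indicator (fun _ => (1 : ℝ)) σ) * g (unitVec ψ)) =
        -(weightH ν z (ψ + α) * quadForm A B C (unitVec ψ) * g (unitVec ψ)) := by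
      rw [integral_const_mul, integral_mul_const, integral_indicator_Iio_sub_Iic, hd, weightH]
      have := (hn1 ψ).trans_lt' one_pos
      simp only [hn] at this ⊢
      field_simp
    rw [← hlim]
    refine tendsto_integral_filter_of_dominated_convergence
      ((Icc (-K) K).indicator (fun _ => (1 : ℝ))) ?_ ?_ hKint ?_
    · exact Eventually.of_forall fun ρ =>
        ((hFm ρ).comp measurable_prodMk_left).aestronglyMeasurable
    · filter_upwards [hbound] with ρ hρ using ae_of_all _ (hρ ψ)
    · have hdne : ∀ᵐ σ : ℝ, σ ≠ d := by simp [ae_iff]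
      filter_upwards [hdne] with σ hσ
      have h1 := hD.tendsto_ballDiff hφ κ hψ hσ
      have hρ : Tendsto (fun ρ : ℝ => ρ) (𝓝[>] 0) (𝓝 0) :=
        tendsto_id.mono_left nhdsWithin_le_nhds
      have hs0 : Tendsto (fun ρ : ℝ => 1 / n ψ + ρ * σ) (𝓝[>] 0) (𝓝 (1 / n ψ)) := by
        simpa using (hρ.mul_const σ).const_add (1 / n ψ)
      have hpos : 0 < 1 / n ψ := one_div_pos.2 (one_pos.trans_le (hn1 ψ))
      refine (hs0.mul (h1.mul_const (g (unitVec ψ)))).congr' ?_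
      filter_upwards [hs0.eventually_const_lt hpos] with ρ hs
      simp only [hF, indicator_of_mem (show 1 / n ψ + ρ * σ ∈ Ioi (0 : ℝ) from hs), hgs _ hs]
      rfl
  refine tendsto_integral_filter_of_dominated_convergence (fun _ => 2 * K) ?_ ?_ ?_ ?_
  · exact Eventually.of_forall fun ρ =>
      ((hFm ρ).stronglyMeasurable.integral_prod_right).aestronglyMeasurable
  · filter_upwards [hbound] with ρ hρ
    refine ae_of_all _ fun ψ => ?_
    refine (norm_integral_le_of_norm_le hKint (ae_of_all _ (hρ ψ))).trans_eq ?_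
    rw [integral_indicator measurableSet_Icc]
    simp [two_mul, hK]
  · exact integrableOn_const (by simp)
  · exact ae_restrict_of_ae hinner

end Polar

/-! ### The strip between a level line of `u` and its tangent -/

section Strip

theorem measurable_sign : Measurable Real.sign := by
  have : Real.sign = fun r => if r < 0 then (-1 : ℝ) else if 0 < r then 1 else 0 := by
    ext r; rfl
  rw [this]
  exact Measurable.ite measurableSet_Iio measurable_const
    (Measurable.ite measurableSet_Ioi measurable_const measurable_const)

theorem abs_sign_le (r : ℝ) : |Real.sign r| ≤ 1 := by
  rcases Real.sign_apply_eq r with h | h | h <;> simp [h]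

theorem sign_mul_of_pos {s : ℝ} (hs : 0 < s) (r : ℝ) : Real.sign (s * r) = Real.sign r := by
  rcases lt_trichotomy r 0 with h | rfl | h
  · rw [Real.sign_of_neg h, Real.sign_of_neg (mul_neg_of_pos_of_neg hs h)]
  · simp
  · rw [Real.sign_of_pos h, Real.sign_of_pos (mul_pos hs h)]

theorem sign_add_eq {r e : ℝ} (h : |e| < |r|) : Real.sign (r + e) = Real.sign r := by
  rcases lt_trichotomy r 0 with h' | rfl | h'
  · rw [abs_of_neg h'] at h
    rw [Real.sign_of_neg h', Real.sign_of_neg (by linarith [(abs_lt.1 h).2])]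
  · simp [(abs_nonneg e).not_gt] at h
  · rw [abs_of_pos h'] at h
    rw [Real.sign_of_pos h', Real.sign_of_pos (by linarith [(abs_lt.1 h).1])]

theorem tendsto_sign {ι : Type*} {l : Filter ι} {g : ι → ℝ} {r : ℝ} (hg : Tendsto g l (𝓝 r))
    (hr : r ≠ 0) : Tendsto (fun i => Real.sign (g i)) l (𝓝 (Real.sign r)) := by
  refine tendsto_const_nhds.congr' ?_
  rcases hr.lt_or_gt with h | h
  · filter_upwards [hg.eventually_lt_const h] with i hi
    rw [Real.sign_of_neg hi, Real.sign_of_neg h]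
  · filter_upwards [hg.eventually_const_lt h] with i hi
    rw [Real.sign_of_pos hi, Real.sign_of_pos h]

/-- Up to endpoints, the integrand is `±2` on the interval between `0` and `-c/U`, and zero
elsewhere. -/
theorem integral_sign_sub_sign {U : ℝ} (hU : 0 < U) (c : ℝ) :
    ∫ t : ℝ, (Real.sign (U * t + c) - Real.sign t) = 2 * c / U := by
  have h : ∀ᵐ t : ℝ, Real.sign (U * t + c) - Real.sign t =
      -2 * ((Iio (-(c / U))).indicator (fun _ => (1 : ℝ)) t -
        (Iic 0).indicator (fun _ => (1 : ℝ)) t) := by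
    have h0 : ∀ᵐ t : ℝ, t ≠ 0 := by simp [ae_iff]
    have h1 : ∀ᵐ t : ℝ, t ≠ -(c / U) := by simp [ae_iff]
    filter_upwards [h0, h1] with t h0 h1
    have e : U * t + c = U * (t - -(c / U)) := by field_simp; ring
    rw [e, sign_mul_of_pos hU]
    rcases h0.lt_or_gt with h0 | h0 <;> rcases h1.lt_or_gt with h1 | h1
    · rw [Real.sign_of_neg h0, Real.sign_of_neg (by linarith)]; simp [h0.le, h1]
    · rw [Real.sign_of_neg h0, Real.sign_of_pos (by linarith)]
      simp only [indicator, mem_Iio, h1.not_gt, mem_Iic, h0.le, if_true, if_false]; norm_num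
    · rw [Real.sign_of_pos h0, Real.sign_of_neg (by linarith)]
      simp only [indicator, mem_Iio, h1, mem_Iic, h0.not_ge, if_true, if_false]; norm_num
    · rw [Real.sign_of_pos h0, Real.sign_of_pos (by linarith)]; simp [h0.not_ge, h1.not_gt]
  rw [integral_congr_ae h, integral_const_mul, integral_indicator_Iio_sub_Iic]
  ring

variable {φ : Seminorm ℝ (ℝ × ℝ)} {ν : ℝ → ℝ} {D E : ℝ × ℝ → ℝ} {z α A B C U A' B' C' : ℝ}

/-- The second axis is the tangent of the level line of `u`, along which `f` has slope `-z sin α`.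
Hence the tangent ball cuts out the segment `|q| ≤ 1/ν(z sin α)`, over which the strip extends in
the limit. -/
theorem IsAmoebaNorm.tangentGauge_zero_fst (hφ : IsAmoebaNorm φ ν) (z α q : ℝ) :
    tangentGauge φ z α (0, q) = |q| * evenExt ν (z * Real.sin α) := by
  have h1 : euclid (0, q) = |q| := by simp [euclid, Real.sqrt_sq_eq_abs]
  have h2 : linForm z α (0, q) = q * -(z * Real.sin α) := by simp only [linForm]; ring
  have h3 : φ (|q|, q * -(z * Real.sin α)) = φ (q, q * -(z * Real.sin α)) := by
    rcases abs_choice q with h | h <;> rw [h]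
    rw [hφ.apply_neg_fst]
  rw [tangentGauge, h1, h2, h3, show ((q, q * -(z * Real.sin α)) : ℝ × ℝ) =
    q • (1, -(z * Real.sin α)) by simp, map_smul_eq_mul, hφ.apply_one, evenExt_neg,
    Real.norm_eq_abs]

theorem HasExpansion.tendsto_indicator_secantBall (hφ : IsAmoebaNorm φ ν)
    (hD : HasExpansion D (linForm z α) (quadForm A B C)) (κ t : ℝ) {q : ℝ}
    (hq : |q| ≠ 1 / evenExt ν (z * Real.sin α)) :
    Tendsto (fun ρ => (secantBall φ D κ ρ).indicator (fun _ => (1 : ℝ)) (ρ * t, q)) (𝓝[>] 0)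
      (𝓝 ((Ioo (-(1 / evenExt ν (z * Real.sin α))) (1 / evenExt ν (z * Real.sin α))).indicator
        (fun _ => (1 : ℝ)) q)) := by
  obtain ⟨K, hK, hb⟩ := hD.eventually_abs_secantGauge_sub_le φ κ
  set n := evenExt ν (z * Real.sin α) with hn
  have hn1 : 1 ≤ n := hφ.one_le_evenExt _
  have hn0 : 0 < n := one_pos.trans_le hn1
  have hρ : Tendsto (fun ρ : ℝ => ρ) (𝓝[>] 0) (𝓝 0) := tendsto_id.mono_left nhdsWithin_le_nhds
  have hpt : Tendsto (fun ρ : ℝ => ((ρ * t, q) : ℝ × ℝ)) (𝓝[>] 0) (𝓝 (0, q)) := by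
    have := hρ.mul_const t
    rw [zero_mul] at this
    exact this.prodMk_nhds tendsto_const_nhds
  have htan : Tendsto (fun ρ : ℝ => tangentGauge φ z α (ρ * t, q)) (𝓝[>] 0) (𝓝 (|q| * n)) := by
    rw [hn, ← hφ.tangentGauge_zero_fst]
    exact ((continuous_tangentGauge φ z α).tendsto _).comp hpt
  have heu : Tendsto (fun ρ : ℝ => euclid (ρ * t, q)) (𝓝[>] 0) (𝓝 |q|) := by
    have := (continuous_euclid.tendsto (0, q)).comp hpt
    rwa [show euclid (0, q) = |q| by simp [euclid, Real.sqrt_sq_eq_abs]] at this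
  have hKρ : Tendsto (fun ρ : ℝ => K * ρ) (𝓝[>] 0) (𝓝 0) := by simpa using hρ.const_mul K
  refine tendsto_const_nhds.congr' ?_
  rcases hq.lt_or_gt with h | h
  · have h1 : |q| * n < 1 := (lt_div_iff₀ hn0).1 h
    have h2 : |q| < 1 := h.trans_le ((div_le_one hn0).2 hn1)
    have hsum := htan.add hKρ
    rw [add_zero] at hsum
    filter_upwards [hb, heu.eventually_lt_const h2, hsum.eventually_lt_const h1] with ρ hρ he hs
    rw [indicator_of_mem (show q ∈ Ioo _ _ from abs_lt.1 h), indicator_of_mem]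
    change secantGauge φ D κ ρ _ ≤ 1
    linarith [(abs_le.1 (hρ _ he.le)).2]
  · have h1 : 1 < |q| * n := (div_lt_iff₀ hn0).1 h
    have hsum := htan.sub hKρ
    rw [sub_zero] at hsum
    filter_upwards [hb, hsum.eventually_const_lt h1] with ρ hρ hs
    rw [indicator_of_notMem (fun h' : q ∈ Ioo _ _ => h.not_gt (abs_lt.2 h')), indicator_of_notMem]
    intro h'
    have h3 : secantGauge φ D κ ρ (ρ * t, q) ≤ 1 := h'
    linarith [(abs_le.1 (hρ _ (hφ.euclid_le_one_of_mem_secantBall h'))).1]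

/-- At distance more than `Kρ` from the axis, the linear part `U w₁` outweighs all other terms,
which are `O(ρ)`. This localises the strip uniformly. -/
theorem HasExpansion.eventually_sign_eq (hU : 0 < U)
    (hE : HasExpansion E (linForm U 0) (quadForm A' B' C')) (k : ℝ) :
    ∃ K, 0 ≤ K ∧ ∀ᶠ ρ in 𝓝[>] (0 : ℝ), ∀ w, euclid w ≤ 1 → K * ρ < |w.1| →
      Real.sign (E (ρ • w) - k * ρ ^ 2) = Real.sign w.1 := by
  obtain ⟨K, hK, hb⟩ := hE.eventually_bound
  refine ⟨(K + |k|) / U, by positivity, ?_⟩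
  filter_upwards [hb, self_mem_nhdsWithin] with ρ hρ (hρ0 : 0 < ρ) w hw h
  have h1 := hρ w hw
  have h2 : E (ρ • w) - k * ρ ^ 2 =
      ρ * (U * w.1 + ((E (ρ • w) / ρ - linForm U 0 w) - k * ρ)) := by
    simp only [linForm, Real.cos_zero, Real.sin_zero]
    field_simp
    ring
  rw [h2, sign_mul_of_pos hρ0, sign_add_eq, sign_mul_of_pos hU]
  have h3 : |k * ρ| = |k| * ρ := by rw [abs_mul, abs_of_pos hρ0]
  have h4 := abs_sub (E (ρ • w) / ρ - linForm U 0 w) (k * ρ)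
  rw [abs_mul, abs_of_pos hU]
  rw [div_mul_eq_mul_div, div_lt_iff₀ hU] at h
  nlinarith

theorem HasExpansion.tendsto_sign_sub (hE : HasExpansion E (linForm U 0) (quadForm A' B' C'))
    (k q : ℝ) {t : ℝ} (ht : U * t + (C' * q ^ 2 - k) ≠ 0) :
    Tendsto (fun ρ : ℝ => Real.sign (E (ρ • ((ρ * t, q) : ℝ × ℝ)) - k * ρ ^ 2) -
      Real.sign (ρ * t)) (𝓝[>] 0)
      (𝓝 (Real.sign (U * t + (C' * q ^ 2 - k)) - Real.sign t)) := by
  have hρ : Tendsto (fun ρ : ℝ => ρ) (𝓝[>] 0) (𝓝 0) := tendsto_id.mono_left nhdsWithin_le_nhds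
  have hpt : Tendsto (fun ρ : ℝ => ((ρ * t, q) : ℝ × ℝ)) (𝓝[>] 0) (𝓝 (0, q)) := by
    have := hρ.mul_const t
    rw [zero_mul] at this
    exact this.prodMk_nhds tendsto_const_nhds
  have h1 : Tendsto (fun ρ : ℝ => (E (ρ • ((ρ * t, q) : ℝ × ℝ)) - k * ρ ^ 2) / ρ ^ 2) (𝓝[>] 0)
      (𝓝 (U * t + (C' * q ^ 2 - k))) := by
    have := (hE.tendsto_div_sq hpt).add_const (U * t - k)
    rw [show quadForm A' B' C' (0, q) + (U * t - k) = U * t + (C' * q ^ 2 - k) by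
      simp only [quadForm]; ring] at this
    refine this.congr' ?_
    filter_upwards [self_mem_nhdsWithin] with ρ (hρ0 : 0 < ρ)
    simp only [linForm, Real.cos_zero, Real.sin_zero]
    field_simp
    ring
  refine ((tendsto_sign h1 ht).sub_const _).congr' ?_
  filter_upwards [self_mem_nhdsWithin] with ρ (hρ0 : 0 < ρ)
  rw [sign_mul_of_pos hρ0, div_eq_inv_mul, sign_mul_of_pos (by positivity)]

/-- In the variable `t = w₁/ρ`, the rescaled level line converges to the parabola `U t + C' q² - k =
0`. The integral over `t` tends to `2(C' q² - k)/U`, and integration over `|q| < 1/n`, where `n =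
ν(z sin α)`, gives the stated limit. The exceptional values of `q` and `t` form null sets. -/
theorem HasExpansion.tendsto_integral_strip (hφ : IsAmoebaNorm φ ν) (hDm : Measurable D)
    (hD : HasExpansion D (linForm z α) (quadForm A B C)) (hEm : Measurable E) (hU : 0 < U)
    (hE : HasExpansion E (linForm U 0) (quadForm A' B' C')) (κ k : ℝ) :
    Tendsto (fun ρ => (∫ w, (secantBall φ D κ ρ).indicator (fun _ => (1 : ℝ)) w *
        (Real.sign (E (ρ • w) - k * ρ ^ 2) - Real.sign w.1)) / ρ) (𝓝[>] 0)
      (𝓝 (4 / (U * evenExt ν (z * Real.sin α)) *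
        (C' / (3 * evenExt ν (z * Real.sin α) ^ 2) - k))) := by
  obtain ⟨K, hK, hlayer⟩ := hE.eventually_sign_eq hU k
  set n := evenExt ν (z * Real.sin α) with hn
  have hn1 : 1 ≤ n := hφ.one_le_evenExt _
  have hn0 : 0 < n := one_pos.trans_le hn1
  set H : ℝ → ℝ × ℝ → ℝ := fun ρ w => (secantBall φ D κ ρ).indicator (fun _ => (1 : ℝ)) w *
        (Real.sign (E (ρ • w) - k * ρ ^ 2) - Real.sign w.1) with hH
  have hHm (ρ : ℝ) : Measurable (H ρ) := by
    refine (measurable_const.indicator (measurableSet_secantBall φ hDm κ ρ)).mul ?_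
    exact (measurable_sign.comp ((hEm.comp (measurable_const_smul ρ)).sub_const _)).sub
      (measurable_sign.comp measurable_fst)
  have hH2 (ρ : ℝ) (w : ℝ × ℝ) : |H ρ w| ≤ 2 := by
    simp only [hH, abs_mul]
    have h1 : |(secantBall φ D κ ρ).indicator (fun _ => (1 : ℝ)) w| ≤ 1 := by
      by_cases h : w ∈ secantBall φ D κ ρ <;> simp [h]
    have h2 := (abs_sub (Real.sign (E (ρ • w) - k * ρ ^ 2)) (Real.sign w.1)).trans
      (add_le_add (abs_sign_le _) (abs_sign_le _))
    nlinarith [abs_nonneg (Real.sign (E (ρ • w) - k * ρ ^ 2) - Real.sign w.1)]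
  have hH0 (ρ : ℝ) (w : ℝ × ℝ) (hw : ¬ euclid w ≤ 1) : H ρ w = 0 := by
    have h1 : w ∉ secantBall φ D κ ρ := fun h => hw (hφ.euclid_le_one_of_mem_secantBall h)
    simp [hH, h1]
  have hHint (ρ : ℝ) : Integrable (H ρ) := by
    refine Integrable.mono' (g := (Icc (-1) 1 ×ˢ Icc (-1) 1).indicator fun _ => (2 : ℝ)) ?_
      (hHm ρ).aestronglyMeasurable (ae_of_all _ fun w => ?_)
    · rw [integrable_indicator_iff (measurableSet_Icc.prod measurableSet_Icc)]
      refine integrableOn_const ?_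
      rw [Measure.volume_eq_prod, Measure.prod_prod]
      exact ENNReal.mul_ne_top (by simp) (by simp)
    · by_cases hw : euclid w ≤ 1
      · rw [indicator_of_mem (show w ∈ Icc (-1 : ℝ) 1 ×ˢ Icc (-1 : ℝ) 1 from
          ⟨abs_le.1 ((abs_fst_le_euclid w).trans hw), abs_le.1 ((abs_snd_le_euclid w).trans hw)⟩)]
        exact hH2 ρ w
      · rw [hH0 ρ w hw, norm_zero]
        exact indicator_nonneg (fun _ _ => zero_le_two) _
  have hrep : ∀ᶠ ρ in 𝓝[>] (0 : ℝ), ∫ q, ∫ t, H ρ (ρ * t, q) = (∫ w, H ρ w) / ρ := by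
    filter_upwards [self_mem_nhdsWithin] with ρ (hρ : 0 < ρ)
    rw [Measure.volume_eq_prod, integral_prod_symm _ (hHint ρ), ← integral_div]
    refine integral_congr_ae (ae_of_all _ fun q => ?_)
    simp only
    rw [Measure.integral_comp_mul_left (fun p => H ρ (p, q)), abs_of_pos (inv_pos.2 hρ),
      smul_eq_mul, div_eq_inv_mul]
  refine Tendsto.congr' hrep ?_
  have hb : ∀ᶠ ρ in 𝓝[>] (0 : ℝ), ∀ q t, ‖H ρ (ρ * t, q)‖ ≤
      (Icc (-K) K).indicator (fun _ => (2 : ℝ)) t * (Icc (-1) 1).indicator (fun _ => (1 : ℝ)) q := by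
    filter_upwards [hlayer, self_mem_nhdsWithin] with ρ hρ (hρ0 : 0 < ρ) q t
    have hnn : 0 ≤ (Icc (-K) K).indicator (fun _ => (2 : ℝ)) t *
        (Icc (-1) 1).indicator (fun _ => (1 : ℝ)) q :=
      mul_nonneg (indicator_nonneg (fun _ _ => zero_le_two) _)
        (indicator_nonneg (fun _ _ => zero_le_one) _)
    by_cases hw : euclid (ρ * t, q) ≤ 1
    swap
    · rwa [hH0 _ _ hw, norm_zero]
    by_cases ht : K < |t|
    · have : Real.sign (E (ρ • ((ρ * t, q) : ℝ × ℝ)) - k * ρ ^ 2) = Real.sign (ρ * t) := by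
        refine hρ _ hw ?_
        simp only [abs_mul, abs_of_pos hρ0]
        nlinarith
      have h0 : H ρ (ρ * t, q) = 0 := by simp only [hH, this, sub_self, mul_zero]
      rwa [h0, norm_zero]
    · rw [indicator_of_mem (show t ∈ Icc (-K) K from abs_le.1 (not_lt.1 ht)),
        indicator_of_mem (show q ∈ Icc (-1 : ℝ) 1 from
          abs_le.1 ((abs_snd_le_euclid (ρ * t, q)).trans hw)), mul_one]
      exact hH2 _ _
  have hKint (q : ℝ) : Integrable (fun t => (Icc (-K) K).indicator (fun _ => (2 : ℝ)) t *
      (Icc (-1) 1).indicator (fun _ => (1 : ℝ)) q) := by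
    refine Integrable.mul_const ?_ _
    rw [integrable_indicator_iff measurableSet_Icc]
    exact integrableOn_const (by simp)
  have hlim : ∫ q, (Ioo (-(1 / n)) (1 / n)).indicator (fun q => 2 * (C' * q ^ 2 - k) / U) q =
      4 / (U * n) * (C' / (3 * n ^ 2) - k) := by
    rw [integral_indicator measurableSet_Ioo, ← integral_Ioc_eq_integral_Ioo,
      ← intervalIntegral.integral_of_le (by linarith [one_div_pos.2 hn0])]
    have : ∀ q : ℝ, 2 * (C' * q ^ 2 - k) / U = 2 / U * (C' * q ^ 2 - k) := fun q => by ring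
    simp_rw [this]
    rw [intervalIntegral.integral_const_mul, intervalIntegral.integral_sub
      ((by fun_prop : Continuous fun q : ℝ => C' * q ^ 2).intervalIntegrable _ _)
      (by simp), intervalIntegral.integral_const_mul, integral_pow, intervalIntegral.integral_const]
    have h3 : (-(1 / n)) ^ (2 + 1) = -(1 / n) ^ 3 := by ring
    rw [h3]
    simp only [smul_eq_mul, Nat.reduceAdd]
    field_simp
    ring
  rw [← hlim]
  refine tendsto_integral_filter_of_dominated_convergence
    (fun q => 4 * K * (Icc (-1) 1).indicator (fun _ => (1 : ℝ)) q) ?_ ?_ ?_ ?_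
  · refine Eventually.of_forall fun ρ => ?_
    have hm : Measurable fun p : ℝ × ℝ => H ρ (ρ * p.2, p.1) := (hHm ρ).comp (by fun_prop)
    exact hm.stronglyMeasurable.integral_prod_right'.aestronglyMeasurable
  · filter_upwards [hb] with ρ hρ
    refine ae_of_all _ fun q => ?_
    refine (norm_integral_le_of_norm_le (hKint q) (ae_of_all _ (hρ q))).trans_eq ?_
    rw [integral_mul_const, integral_indicator measurableSet_Icc]
    simp only [integral_const, smul_eq_mul, measureReal_restrict_apply MeasurableSet.univ,
      univ_inter, Real.volume_real_Icc_of_le (neg_le_self hK)]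
    ring
  · refine Integrable.const_mul ?_ _
    rw [integrable_indicator_iff measurableSet_Icc]
    exact integrableOn_const (by simp)
  · have hq : ∀ᵐ q : ℝ, |q| ≠ 1 / n := by
      have h1 : ∀ᵐ q : ℝ, q ≠ 1 / n := by simp [ae_iff]
      have h2 : ∀ᵐ q : ℝ, q ≠ -(1 / n) := by simp [ae_iff]
      filter_upwards [h1, h2] with q h1 h2 h3
      rcases abs_choice q with h | h
      · exact h1 (h ▸ h3)
      · exact h2 (by linarith)
    filter_upwards [hq] with q hq
    have hval : ∫ t, (Ioo (-(1 / n)) (1 / n)).indicator (fun _ => (1 : ℝ)) q *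
        (Real.sign (U * t + (C' * q ^ 2 - k)) - Real.sign t) =
        (Ioo (-(1 / n)) (1 / n)).indicator (fun q => 2 * (C' * q ^ 2 - k) / U) q := by
      rw [integral_const_mul, integral_sign_sub_sign hU]
      by_cases h : q ∈ Ioo (-(1 / n)) (1 / n) <;> simp only [indicator, h, if_true, if_false] <;> simp
    rw [← hval]
    refine tendsto_integral_filter_of_dominated_convergence _ ?_ ?_ (hKint q) ?_
    · exact Eventually.of_forall fun ρ => ((hHm ρ).comp (by fun_prop)).aestronglyMeasurable
    · filter_upwards [hb] with ρ hρ using ae_of_all _ (hρ q)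
    · have ht : ∀ᵐ t : ℝ, t ≠ -(C' * q ^ 2 - k) / U := by simp [ae_iff]
      filter_upwards [ht] with t ht
      refine (hD.tendsto_indicator_secantBall hφ κ t hq).mul (hE.tendsto_sign_sub k q ?_)
      intro h
      exact ht (by rw [eq_div_iff hU.ne']; linarith)

end Strip

/-! ### The signed area of the secant ball and the balancing level -/

section SignedArea

theorem volume_lt_top_of_euclid_le_one {W : Set (ℝ × ℝ)} (hW : ∀ w ∈ W, euclid w ≤ 1) :
    volume W < ⊤ := by
  have hsub : W ⊆ Icc (-1) 1 ×ˢ Icc (-1) 1 := fun w hw =>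
    ⟨abs_le.1 ((abs_fst_le_euclid w).trans (hW w hw)),
      abs_le.1 ((abs_snd_le_euclid w).trans (hW w hw))⟩
  refine (measure_mono hsub).trans_lt ?_
  rw [Measure.volume_eq_prod, Measure.prod_prod]
  exact ENNReal.mul_lt_top (by simp) (by simp)

theorem setIntegral_sign {W : Set (ℝ × ℝ)} (hW : ∀ w ∈ W, euclid w ≤ 1)
    {g : ℝ × ℝ → ℝ} (hg : Measurable g) :
    ∫ w in W, Real.sign (g w) =
      volume.real (W ∩ {w | 0 < g w}) - volume.real (W ∩ {w | g w < 0}) := by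
  have h (w : ℝ × ℝ) : Real.sign (g w) = {w | 0 < g w}.indicator (fun _ => (1 : ℝ)) w -
      {w | g w < 0}.indicator (fun _ => (1 : ℝ)) w := by
    rcases lt_trichotomy (g w) 0 with h | h | h
    · simp [Real.sign_of_neg h, h, h.le]
    · simp [h]
    · simp [Real.sign_of_pos h, h, h.le]
  have hfin := volume_lt_top_of_euclid_le_one hW
  have hp : MeasurableSet {w | 0 < g w} := measurableSet_lt measurable_const hg
  have hn : MeasurableSet {w | g w < 0} := measurableSet_lt hg measurable_const
  have hi : IntegrableOn (fun _ => (1 : ℝ)) W := integrableOn_const hfin.ne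
  simp_rw [h]
  rw [integral_sub (hi.indicator hp) (hi.indicator hn), setIntegral_indicator hp,
    setIntegral_indicator hn]
  simp

/-- Both factors change sign under a half turn, so the product has period `π`; on the right half
circle the sign is `1`. -/
theorem intervalIntegral_sign_cos {h : ℝ → ℝ} (hh : ∀ ψ, h (ψ + Real.pi) = -h ψ)
    (hi : ∀ a b, IntervalIntegrable h volume a b) :
    ∫ ψ in (-Real.pi)..Real.pi, h ψ * Real.sign (Real.cos ψ) =
      2 * ∫ ψ in (-(Real.pi / 2))..(Real.pi / 2), h ψ := by
  have hper : Function.Periodic (fun ψ => h ψ * Real.sign (Real.cos ψ)) Real.pi := fun ψ => by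
    simp only [hh, Real.cos_add_pi, Real.sign_neg, neg_mul_neg]
  have hint (a b : ℝ) :
      IntervalIntegrable (fun ψ => h ψ * Real.sign (Real.cos ψ)) volume a b := by
    rw [intervalIntegrable_iff]
    refine (intervalIntegrable_iff.1 (hi a b)).mul_bdd (c := 1) ?_ (ae_of_all _ fun ψ => abs_sign_le _)
    exact (measurable_sign.comp Real.measurable_cos).aestronglyMeasurable
  have hhalf : ∫ ψ in (-(Real.pi / 2))..(Real.pi / 2), h ψ * Real.sign (Real.cos ψ) =
      ∫ ψ in (-(Real.pi / 2))..(Real.pi / 2), h ψ := by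
    have hle : -(Real.pi / 2) ≤ Real.pi / 2 := by linarith [Real.pi_pos]
    rw [intervalIntegral.integral_of_le hle, intervalIntegral.integral_of_le hle,
      integral_Ioc_eq_integral_Ioo, integral_Ioc_eq_integral_Ioo]
    refine setIntegral_congr_fun measurableSet_Ioo fun ψ hψ => ?_
    simp only [Real.sign_of_pos (Real.cos_pos_of_mem_Ioo hψ), mul_one]
  have h1 := hper.intervalIntegral_add_eq (-Real.pi) (-(Real.pi / 2))
  have h2 := hper.intervalIntegral_add_eq 0 (-(Real.pi / 2))
  rw [show -Real.pi + Real.pi = 0 by ring, show -(Real.pi / 2) + Real.pi = Real.pi / 2 by ring] at h1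
  rw [zero_add, show -(Real.pi / 2) + Real.pi = Real.pi / 2 by ring] at h2
  rw [← intervalIntegral.integral_add_adjacent_intervals (hint (-Real.pi) 0) (hint 0 Real.pi), h1,
    h2, hhalf]
  ring

variable {φ : Seminorm ℝ (ℝ × ℝ)} {ν : ℝ → ℝ} {D E : ℝ × ℝ → ℝ} {z α A B C U A' B' C' : ℝ}

theorem tangentGauge_neg (φ : Seminorm ℝ (ℝ × ℝ)) {ν : ℝ → ℝ} (hφ : IsAmoebaNorm φ ν) (z α : ℝ)
    (w : ℝ × ℝ) : tangentGauge φ z α (-w) = tangentGauge φ z α w := by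
  have h1 : euclid (-w) = euclid w := by simp [euclid]
  have h2 : linForm z α (-w) = -linForm z α w := by
    simp only [linForm, Prod.fst_neg, Prod.snd_neg]; ring
  rw [tangentGauge, h1, h2, hφ.apply_neg_snd, tangentGauge]

theorem IsAmoebaNorm.integral_tangentBall_sign (hφ : IsAmoebaNorm φ ν) (z α : ℝ) :
    ∫ w, (tangentBall φ z α).indicator (fun _ => (1 : ℝ)) w * Real.sign w.1 = 0 := by
  have h := integral_neg_eq_self (μ := (volume : Measure (ℝ × ℝ)))
    (fun w => (tangentBall φ z α).indicator (fun _ => (1 : ℝ)) w * Real.sign w.1)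
  have h2 (w : ℝ × ℝ) : (tangentBall φ z α).indicator (fun _ => (1 : ℝ)) (-w) * Real.sign (-w).1 =
      -((tangentBall φ z α).indicator (fun _ => (1 : ℝ)) w * Real.sign w.1) := by
    have h3 : -w ∈ tangentBall φ z α ↔ w ∈ tangentBall φ z α := by
      simp only [tangentBall, mem_ofPred_eq, tangentGauge_neg φ hφ]
    by_cases h4 : w ∈ tangentBall φ z α
    · rw [indicator_of_mem h4, indicator_of_mem (h3.2 h4), Prod.fst_neg, Real.sign_neg]; ring
    · rw [indicator_of_notMem h4, indicator_of_notMem (fun h => h4 (h3.1 h))]; simp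
  simp_rw [h2] at h
  rw [integral_neg] at h
  linarith

/-- With `S` the secant and `T` the tangent ball, and `e` the sign of `E(ρw) - kρ²`, one splits `1_S
e = 1_S (e - sign w₁) + (1_S - 1_T) sign w₁ + 1_T sign w₁`: the strip, the boundary layer, and a
term that vanishes by central symmetry. The shift `ϑ = ψ + α` measures angles from the gradient of
the linear part of `D`. -/
theorem HasExpansion.tendsto_signedArea (hφ : IsAmoebaNorm φ ν) (hDm : Measurable D)
    (hD : HasExpansion D (linForm z α) (quadForm A B C)) (hz : z ≠ 0) (hEm : Measurable E)
    (hU : 0 < U) (hE : HasExpansion E (linForm U 0) (quadForm A' B' C')) (κ k : ℝ) :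
    Tendsto (fun ρ => (∫ w in secantBall φ D κ ρ, Real.sign (E (ρ • w) - k * ρ ^ 2)) / ρ) (𝓝[>] 0)
      (𝓝 (4 / (U * evenExt ν (z * Real.sin α)) * (C' / (3 * evenExt ν (z * Real.sin α) ^ 2) -
        U * evenExt ν (z * Real.sin α) / 2 *
          (∫ ϑ in (α - Real.pi / 2)..(α + Real.pi / 2),
            weightH ν z ϑ * quadForm A B C (unitVec (ϑ - α))) - k))) := by
  have h1 := hD.tendsto_integral_strip hφ hDm hEm hU hE κ k
  have h2 := hD.tendsto_integral_ballDiff hφ hDm hz κ (g := fun w => Real.sign w.1)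
    (measurable_sign.comp measurable_fst) (fun w => abs_sign_le _) (fun s hs w => by
      simp only [Prod.smul_fst, smul_eq_mul, sign_mul_of_pos hs])
  have hn : 0 < evenExt ν (z * Real.sin α) := hφ.evenExt_pos _
  have hint : ∫ ψ in Ioo (-Real.pi) Real.pi, -(weightH ν z (ψ + α) *
      quadForm A B C (unitVec ψ) * Real.sign (unitVec ψ).1) =
      -(2 * ∫ ϑ in (α - Real.pi / 2)..(α + Real.pi / 2),
            weightH ν z ϑ * quadForm A B C (unitVec (ϑ - α))) := by
    rw [integral_neg, ← integral_Ioc_eq_integral_Ioo,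
      ← intervalIntegral.integral_of_le (by linarith [Real.pi_pos])]
    have hcont : Continuous fun ϑ => quadForm A B C (unitVec (ϑ - α)) := by
      refine (continuous_quadForm A B C).comp ?_
      unfold unitVec; fun_prop
    have := intervalIntegral_sign_cos
      (h := fun ψ => weightH ν z (ψ + α) * quadForm A B C (unitVec ψ)) ?_ ?_
    · rw [show (fun ψ => weightH ν z (ψ + α) * quadForm A B C (unitVec ψ) *
        Real.sign (unitVec ψ).1) = fun ψ => weightH ν z (ψ + α) * quadForm A B C (unitVec ψ) *
        Real.sign (Real.cos ψ) from rfl, this]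
      have hsub := intervalIntegral.integral_comp_add_right (a := -(Real.pi / 2)) (b := Real.pi / 2)
        (fun ϑ => weightH ν z ϑ * quadForm A B C (unitVec (ϑ - α))) α
      simp only [add_sub_cancel_right] at hsub
      rw [hsub, show -(Real.pi / 2) + α = α - Real.pi / 2 by ring,
        show Real.pi / 2 + α = α + Real.pi / 2 by ring]
    · intro ψ
      have : unitVec (ψ + Real.pi) = (-1 : ℝ) • unitVec ψ := by simp [unitVec]
      rw [show ψ + Real.pi + α = ψ + α + Real.pi by ring, weightH_add_pi, this, quadForm_smul]
      ring
    · intro a b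
      have := (hφ.intervalIntegrable_weightH_mul z (a + α) (b + α) hcont).comp_add_right (c := α)
      simpa only [add_sub_cancel_right] using this
  rw [hint] at h2
  have h3 := h1.add h2
  convert h3.congr fun ρ => ?_ using 2
  · field_simp
    ring
  · have hfin (W : Set (ℝ × ℝ)) (hWm : MeasurableSet W) (hW : ∀ w ∈ W, euclid w ≤ 1)
        {g : ℝ × ℝ → ℝ} (hg : Measurable g) :
        Integrable fun w => W.indicator (fun _ => (1 : ℝ)) w * Real.sign (g w) := by
      have hi : Integrable (W.indicator fun _ => (1 : ℝ)) := by
        rw [integrable_indicator_iff hWm]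
        exact integrableOn_const (volume_lt_top_of_euclid_le_one hW).ne
      exact hi.mul_bdd (c := 1) (measurable_sign.comp hg).aestronglyMeasurable
        (ae_of_all _ fun w => abs_sign_le _)
    have i1 := hfin (secantBall φ D κ ρ) (measurableSet_secantBall φ hDm κ ρ)
      (fun w hw => hφ.euclid_le_one_of_mem_secantBall hw)
      (g := fun w => E (ρ • w) - k * ρ ^ 2) ((hEm.comp (measurable_const_smul ρ)).sub_const _)
    have i2 := hfin (secantBall φ D κ ρ) (measurableSet_secantBall φ hDm κ ρ)
      (fun w hw => hφ.euclid_le_one_of_mem_secantBall hw) measurable_fst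
    have i3 := hfin (tangentBall φ z α) (measurableSet_tangentBall φ z α)
      (fun w hw => hφ.euclid_le_one_of_mem_tangentBall hw) measurable_fst
    rw [← add_div]
    congr 1
    simp only [ballDiff, mul_sub, sub_mul]
    rw [integral_sub i1 i2, integral_sub i2 i3, hφ.integral_tangentBall_sign, sub_zero,
      sub_add_cancel, ← integral_indicator (measurableSet_secantBall φ hDm κ ρ)]
    refine integral_congr_ae (ae_of_all _ fun w => ?_)
    by_cases h : w ∈ secantBall φ D κ ρ <;> simp [h]

/-- The first-order area of the boundary layer does not depend on `κ`, and the balls are nested. -/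
theorem HasExpansion.tendsto_area_diff (hφ : IsAmoebaNorm φ ν) (hDm : Measurable D)
    (hD : HasExpansion D (linForm z α) (quadForm A B C)) (hz : z ≠ 0) (κ : ℝ) :
    Tendsto (fun ρ => volume.real (secantBall φ D 0 ρ \ secantBall φ D κ ρ) / ρ) (𝓝[>] 0)
      (𝓝 0) := by
  have h (κ : ℝ) := hD.tendsto_integral_ballDiff hφ hDm hz κ (g := fun _ => 1) measurable_const
    (by simp) (by simp)
  have h1 := (h 0).sub (h κ)
  rw [sub_self] at h1
  refine h1.congr fun ρ => ?_
  have hi (W : Set (ℝ × ℝ)) (hWm : MeasurableSet W) (hW : ∀ w ∈ W, euclid w ≤ 1) :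
      Integrable (W.indicator fun _ => (1 : ℝ)) := by
    rw [integrable_indicator_iff hWm]
    exact integrableOn_const (volume_lt_top_of_euclid_le_one hW).ne
  have i1 (κ : ℝ) := hi (secantBall φ D κ ρ) (measurableSet_secantBall φ hDm κ ρ)
      (fun w hw => hφ.euclid_le_one_of_mem_secantBall hw)
  have i3 := hi (tangentBall φ z α) (measurableSet_tangentBall φ z α)
      (fun w hw => hφ.euclid_le_one_of_mem_tangentBall hw)
  rw [← sub_div]
  congr 1
  simp only [ballDiff, mul_one]
  rw [integral_sub (i1 0) i3, integral_sub (i1 κ) i3, sub_sub_sub_cancel_right,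
    integral_indicator (measurableSet_secantBall φ hDm 0 ρ),
    integral_indicator (measurableSet_secantBall φ hDm κ ρ)]
  rw [measureReal_sdiff (secantBall_subset_secantBall_zero φ D κ ρ)
    (measurableSet_secantBall φ hDm κ ρ) (volume_lt_top_of_euclid_le_one
      (fun w hw => hφ.euclid_le_one_of_mem_secantBall hw)).ne]
  simp

/-- The threshold that balances the areas of the two level sides of the secant ball. -/
noncomputable def balance (ν : ℝ → ℝ) (z α A B C U C' : ℝ) : ℝ :=
  C' / (3 * evenExt ν (z * Real.sin α) ^ 2) - U * evenExt ν (z * Real.sin α) / 2 *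
    ∫ ϑ in (α - Real.pi / 2)..(α + Real.pi / 2), weightH ν z ϑ * quadForm A B C (unitVec (ϑ - α))

/-- One side of the outer ball is compared with the other side of the inner ball, so that the
inequality passes to any set squeezed between them. The price is the area of the difference, which
is `o(ρ)` against a signed area of exact order `ρ`. -/
theorem HasExpansion.eventually_area_lt (hφ : IsAmoebaNorm φ ν) (hDm : Measurable D)
    (hD : HasExpansion D (linForm z α) (quadForm A B C)) (hz : z ≠ 0) (hEm : Measurable E)
    (hU : 0 < U) (hE : HasExpansion E (linForm U 0) (quadForm A' B' C')) (κ : ℝ) {k : ℝ} :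
    (balance ν z α A B C U C' < k → ∀ᶠ ρ in 𝓝[>] (0 : ℝ),
      volume (secantBall φ D 0 ρ ∩ {w | k * ρ ^ 2 < E (ρ • w)}) <
        volume (secantBall φ D κ ρ ∩ {w | E (ρ • w) < k * ρ ^ 2})) ∧
    (k < balance ν z α A B C U C' → ∀ᶠ ρ in 𝓝[>] (0 : ℝ),
      volume (secantBall φ D 0 ρ ∩ {w | E (ρ • w) < k * ρ ^ 2}) <
        volume (secantBall φ D κ ρ ∩ {w | k * ρ ^ 2 < E (ρ • w)})) := by
  have h1 := hD.tendsto_signedArea hφ hDm hz hEm hU hE κ k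
  have h2 := hD.tendsto_area_diff hφ hDm hz κ
  have hn : 0 < evenExt ν (z * Real.sin α) := hφ.evenExt_pos _
  rw [show (4 / (U * evenExt ν (z * Real.sin α)) * (C' / (3 * evenExt ν (z * Real.sin α) ^ 2) -
        U * evenExt ν (z * Real.sin α) / 2 *
          (∫ ϑ in (α - Real.pi / 2)..(α + Real.pi / 2),
            weightH ν z ϑ * quadForm A B C (unitVec (ϑ - α))) - k)) =
    4 / (U * evenExt ν (z * Real.sin α)) * (balance ν z α A B C U C' - k) from rfl] at h1
  have hc : 0 < 4 / (U * evenExt ν (z * Real.sin α)) := by positivity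
  have hfin (κ ρ : ℝ) : volume (secantBall φ D κ ρ) < ⊤ :=
    volume_lt_top_of_euclid_le_one fun w hw => hφ.euclid_le_one_of_mem_secantBall hw
  have hfin' (κ ρ : ℝ) (S : Set (ℝ × ℝ)) : volume (secantBall φ D κ ρ ∩ S) ≠ ⊤ :=
    ((measure_mono inter_subset_left).trans_lt (hfin κ ρ)).ne
  have hfind (ρ : ℝ) : volume (secantBall φ D 0 ρ \ secantBall φ D κ ρ) ≠ ⊤ :=
    ((measure_mono sdiff_subset).trans_lt (hfin 0 ρ)).ne
  have hle (ρ : ℝ) (S : Set (ℝ × ℝ)) : volume.real (secantBall φ D 0 ρ ∩ S) ≤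
      volume.real (secantBall φ D κ ρ ∩ S) +
        volume.real (secantBall φ D 0 ρ \ secantBall φ D κ ρ) := by
    refine (measureReal_mono ?_ (measure_union_lt_top (hfin' _ _ _).lt_top
      (hfind _).lt_top).ne).trans (measureReal_union_le _ _)
    intro w hw
    by_cases h : w ∈ secantBall φ D κ ρ
    · exact Or.inl ⟨h, hw.2⟩
    · exact Or.inr ⟨hw.1, h⟩
  have hsign (ρ : ℝ) := setIntegral_sign (W := secantBall φ D κ ρ)
    (fun w hw => hφ.euclid_le_one_of_mem_secantBall hw)
    (g := fun w => E (ρ • w) - k * ρ ^ 2)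
    ((hEm.comp (measurable_const_smul ρ)).sub_const _)
  simp only [sub_pos, sub_neg] at hsign
  constructor
  · intro hk
    have h3 := h1.add h2
    rw [add_zero] at h3
    filter_upwards [h3.eventually_lt_const (mul_neg_of_pos_of_neg hc (sub_neg.2 hk)),
      self_mem_nhdsWithin] with ρ h4 (hρ : 0 < ρ)
    rw [← add_div, hsign, div_neg_iff] at h4
    refine (ENNReal.toReal_lt_toReal (hfin' _ _ _) (hfin' _ _ _)).1 ?_
    change volume.real _ < volume.real _
    rcases h4 with h4 | h4 <;> linarith [hle ρ {w | k * ρ ^ 2 < E (ρ • w)}]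
  · intro hk
    have h3 := h1.sub h2
    rw [sub_zero] at h3
    filter_upwards [h3.eventually_const_lt (mul_pos hc (sub_pos.2 hk)),
      self_mem_nhdsWithin] with ρ h4 (hρ : 0 < ρ)
    rw [← sub_div, hsign, div_pos_iff_of_pos_right hρ] at h4
    refine (ENNReal.toReal_lt_toReal (hfin' _ _ _) (hfin' _ _ _)).1 ?_
    change volume.real _ < volume.real _
    linarith [hle ρ {w | E (ρ • w) < k * ρ ^ 2}]

end SignedArea

/-! ### Two-sided bounds for the amoeba distance -/

section Distance

variable {φ : Seminorm ℝ (ℝ × ℝ)} {ν : ℝ → ℝ} {Ω : Set Plane} {f : Plane → ℝ}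

theorem continuousOn_derivWithin_Icc {F : Type*} [NormedAddCommGroup F] [NormedSpace ℝ F]
    {c : ℝ → F} (hc : ContDiffOn ℝ 1 c (Icc 0 1)) :
    ContinuousOn (derivWithin c (Icc 0 1)) (Icc 0 1) :=
  hc.continuousOn_derivWithin (uniqueDiffOn_Icc one_pos) le_rfl

theorem setIntegral_derivWithin_Icc {F : Type*} [NormedAddCommGroup F] [NormedSpace ℝ F]
    [CompleteSpace F] {c : ℝ → F} (hc : ContDiffOn ℝ 1 c (Icc 0 1)) :
    ∫ t in Icc (0 : ℝ) 1, derivWithin c (Icc 0 1) t = c 1 - c 0 := by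
  rw [integral_Icc_eq_integral_Ioc, ← intervalIntegral.integral_of_le zero_le_one,
    intervalIntegral.integral_derivWithin_Icc_of_contDiffOn_Icc hc zero_le_one]

theorem IsAmoebaNorm.curveLength_eq_ofReal (hφ : IsAmoebaNorm φ ν) {c : ℝ → Plane}
    (hc : ContDiffOn ℝ 1 c (Icc 0 1)) (hfc : ContDiffOn ℝ 1 (f ∘ c) (Icc 0 1)) :
    curveLength φ f c = ENNReal.ofReal (∫ t in Icc (0 : ℝ) 1,
      φ (‖derivWithin c (Icc 0 1) t‖, derivWithin (f ∘ c) (Icc 0 1) t)) := by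
  rw [ofReal_integral_eq_lintegral_ofReal]
  · simp only [curveLength, hφ.apply_abs_snd]
  · refine ContinuousOn.integrableOn_Icc ?_
    exact (continuous_seminorm_prod φ).comp_continuousOn
      ((continuousOn_derivWithin_Icc hc).norm.prodMk (continuousOn_derivWithin_Icc hfc))
  · exact ae_of_all _ fun t => apply_nonneg φ _

/-- The amoeba distance is bounded from below by the chordal distance on the graph of `f`. -/
theorem IsAmoebaNorm.ofReal_apply_le_amoebaDist (hφ : IsAmoebaNorm φ ν)
    (hf : ContDiffOn ℝ ∞ f Ω) (p q : Plane) :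
    ENNReal.ofReal (φ (‖q - p‖, f q - f p)) ≤ amoebaDist Ω φ f p q := by
  refine le_iInf₂ fun c hc => ?_
  have hc1 := hc.contDiffOn
  have hfc : ContDiffOn ℝ 1 (f ∘ c) (Icc 0 1) :=
    (hf.of_le (by exact_mod_cast le_top)).comp hc1 hc.mapsTo
  rw [hφ.curveLength_eq_ofReal hc1 hfc]
  refine ENNReal.ofReal_le_ofReal ?_
  have : IsProbabilityMeasure (volume.restrict (Icc (0 : ℝ) 1)) := ⟨by simp⟩
  have hcont := (continuousOn_derivWithin_Icc hc1).norm.prodMk (continuousOn_derivWithin_Icc hfc)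
  -- Jensen's inequality for the mean of `(‖c'‖, (f ∘ c)')`. Its second entry is the increment of
  -- `f`; its first is at least the chord length, so monotonicity of `φ` in the first slot finishes.
  have hJ := φ.convexOn.map_integral_le (μ := volume.restrict (Icc (0 : ℝ) 1))
    (continuous_seminorm_prod φ).continuousOn isClosed_univ (ae_of_all _ fun _ => mem_univ _)
    hcont.integrableOn_Icc
    ((continuous_seminorm_prod φ).comp_continuousOn hcont).integrableOn_Icc
  refine le_trans ?_ hJ
  rw [integral_pair (continuousOn_derivWithin_Icc hc1).norm.integrableOn_Icc
    (continuousOn_derivWithin_Icc hfc).integrableOn_Icc, setIntegral_derivWithin_Icc hfc]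
  simp only [Function.comp, hc.source, hc.target]
  refine hφ.apply_mono_fst (norm_nonneg _) ?_ _
  rw [← hc.source, ← hc.target, ← setIntegral_derivWithin_Icc hc1]
  exact norm_integral_le_integral_norm _

/-- A convex function lies below its chord over `[H - K, H + K]`. The part linear in `δ` integrates
to zero when `δ` has mean zero, which is what makes the upper bound symmetric in `±K`. -/
theorem seminorm_add_le_chord (φ : Seminorm ℝ (ℝ × ℝ)) (s H : ℝ) {δ K : ℝ} (hδ : |δ| ≤ K) :
    φ (s, H + δ) ≤ (φ (s, H - K) + φ (s, H + K)) / 2 +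
      δ * ((φ (s, H + K) - φ (s, H - K)) / (2 * K)) := by
  rcases ((abs_nonneg δ).trans hδ).eq_or_lt with h | h
  -- For `K = 0` the slope is a division by zero, hence `0`, and the claim is an equality.
  · have : δ = 0 := abs_nonpos_iff.1 (h ▸ hδ)
    simp [← h, this]
  · have h1 := abs_le.1 hδ
    have key : ((s, H + δ) : ℝ × ℝ) = ((1 - δ / K) / 2) • (s, H - K) +
        ((1 + δ / K) / 2) • (s, H + K) := by
      ext
      · simp only [Prod.smul_mk, smul_eq_mul, Prod.mk_add_mk]; ring
      · simp only [Prod.smul_mk, smul_eq_mul, Prod.mk_add_mk]; field_simp; ring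
    have h2 : δ / K ≤ 1 := (div_le_one h).2 h1.2
    have h3 : -1 ≤ δ / K := by rw [le_div_iff₀ h]; linarith
    rw [key]
    refine (map_add_le_add φ _ _).trans ?_
    rw [map_smul_eq_mul, map_smul_eq_mul, Real.norm_of_nonneg (by linarith),
      Real.norm_of_nonneg (by linarith)]
    refine le_of_eq ?_
    field_simp
    ring

/-- Near an interior point, the amoeba distance is bounded from above by the symmetrically
perturbed chordal distance on the graph of `f`. -/
theorem IsAmoebaNorm.amoebaDist_le (hφ : IsAmoebaNorm φ ν) {x y : Plane} {r : ℝ} {B : NNReal}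
    (hball : Metric.ball x r ⊆ Ω) (hf : ContDiffOn ℝ ∞ f (Metric.ball x r))
    (hB : LipschitzOnWith B (fderiv ℝ f) (Metric.ball x r)) (hy : y ∈ Metric.ball x r)
    (hxy : y ≠ x) :
    amoebaDist Ω φ f x y ≤ ENNReal.ofReal
      ((φ (‖y - x‖, f y - f x - B * ‖y - x‖ ^ 2) + φ (‖y - x‖, f y - f x + B * ‖y - x‖ ^ 2)) / 2) := by
  set v := y - x with hv
  have hv0 : v ≠ 0 := sub_ne_zero.2 hxy
  set c : ℝ → Plane := fun t => x + t • v with hc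
  have hcd (t : ℝ) : HasDerivAt c v t := by
    simpa [hc] using ((hasDerivAt_id t).smul_const v).const_add x
  have hcw (t : ℝ) (ht : t ∈ Icc (0 : ℝ) 1) : derivWithin c (Icc 0 1) t = v :=
    (hcd t).hasDerivWithinAt.derivWithin (uniqueDiffOn_Icc one_pos t ht)
  have hcb (t : ℝ) (ht : t ∈ Icc (0 : ℝ) 1) : c t ∈ Metric.ball x r := by
    rw [mem_ball_iff_norm] at hy ⊢
    simp only [hc, add_sub_cancel_left, norm_smul, Real.norm_of_nonneg ht.1]
    exact (mul_le_of_le_one_left (norm_nonneg _) ht.2).trans_lt hy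
  have hcC : ContDiff ℝ 1 c := by fun_prop
  -- The segment is regular only because `y ≠ x`: its velocity is `y - x`.
  have hreg : IsRegularCurve Ω x y c := by
    refine ⟨hcC.contDiffOn, fun t ht => by rwa [hcw t ht], fun t ht => hball (hcb t ht), ?_, ?_⟩
    · simp [hc]
    · simp [hc, hv]
  have hfc : ContDiffOn ℝ 1 (f ∘ c) (Icc 0 1) :=
    (hf.of_le (by exact_mod_cast le_top)).comp hcC.contDiffOn hcb
  refine (iInf₂_le c hreg).trans ?_
  rw [hφ.curveLength_eq_ofReal hcC.contDiffOn hfc]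
  refine ENNReal.ofReal_le_ofReal ?_
  set g := derivWithin (f ∘ c) (Icc 0 1) with hg
  have hgc : ContinuousOn g (Icc 0 1) := continuousOn_derivWithin_Icc hfc
  have hgi : IntegrableOn g (Icc 0 1) := hgc.integrableOn_Icc
  have hci (a : ℝ) : IntegrableOn (fun _ => a) (Icc (0 : ℝ) 1) := integrableOn_const (by simp)
  have hgI : ∫ t in Icc (0 : ℝ) 1, g t = f y - f x := by
    rw [hg, setIntegral_derivWithin_Icc hfc]
    simp [hc, hv]
  have hgv (t : ℝ) (ht : t ∈ Icc (0 : ℝ) 1) : g t = fderiv ℝ f (c t) v := by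
    have h1 : DifferentiableAt ℝ f (c t) :=
      (hf.contDiffAt (Metric.isOpen_ball.mem_nhds (hcb t ht))).differentiableAt (by simp)
    exact (h1.hasFDerivAt.comp_hasDerivAt t (hcd t)).hasDerivWithinAt.derivWithin
      (uniqueDiffOn_Icc one_pos t ht)
  have hgL (s t : ℝ) (hs : s ∈ Icc (0 : ℝ) 1) (ht : t ∈ Icc (0 : ℝ) 1) :
      |g t - g s| ≤ B * ‖v‖ ^ 2 := by
    rw [hgv t ht, hgv s hs, ← sub_apply, ← Real.norm_eq_abs]
    refine (ContinuousLinearMap.le_opNorm _ _).trans ?_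
    have h1 := hB.dist_le_mul _ (hcb t ht) _ (hcb s hs)
    rw [dist_eq_norm, dist_eq_norm] at h1
    have h2 : ‖c t - c s‖ ≤ ‖v‖ := by
      simp only [hc, add_sub_add_left_eq_sub, ← sub_smul, norm_smul]
      refine mul_le_of_le_one_left (norm_nonneg _) (abs_le.2 ⟨?_, ?_⟩) <;>
        linarith [hs.1, hs.2, ht.1, ht.2]
    calc _ ≤ (B * ‖c t - c s‖) * ‖v‖ := mul_le_mul_of_nonneg_right h1 (norm_nonneg _)
      _ ≤ (B * ‖v‖) * ‖v‖ := by gcongr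
      _ = _ := by ring
  -- The increment of `f` is the mean of `g`, so the bound on the oscillation of `g` also bounds its
  -- distance from the mean.
  have hgH (t : ℝ) (ht : t ∈ Icc (0 : ℝ) 1) : |g t - (f y - f x)| ≤ B * ‖v‖ ^ 2 := by
    have h1 : ∫ s in Icc (0 : ℝ) 1, (g t - g s) = g t - (f y - f x) := by
      rw [integral_sub (hci _) hgi, hgI]
      simp
    rw [← h1]
    refine (norm_setIntegral_le_of_norm_le_const (f := fun s => g t - g s) (C := B * ‖v‖ ^ 2) (by simp)
      (fun s hs => hgL s t hs ht)).trans_eq ?_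
    simp
  set K : ℝ := B * ‖v‖ ^ 2
  set H := f y - f x
  set m := (φ (‖v‖, H + K) - φ (‖v‖, H - K)) / (2 * K)
  have hgs : IntegrableOn (fun t => (g t - H) * m) (Icc 0 1) := (hgi.sub (hci H)).mul_const m
  calc ∫ t in Icc (0 : ℝ) 1, φ (‖derivWithin c (Icc 0 1) t‖, g t)
      ≤ ∫ t in Icc (0 : ℝ) 1, ((φ (‖v‖, H - K) + φ (‖v‖, H + K)) / 2 + (g t - H) * m) := by
        refine setIntegral_mono_on ?_ ?_ measurableSet_Icc fun t ht => ?_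
        · exact ((continuous_seminorm_prod φ).comp_continuousOn
            ((continuousOn_derivWithin_Icc hcC.contDiffOn).norm.prodMk hgc)).integrableOn_Icc
        · exact (hci _).add hgs
        · rw [hcw t ht]
          have := seminorm_add_le_chord φ ‖v‖ H (hgH t ht)
          rwa [add_sub_cancel] at this
    _ = (φ (‖v‖, H - K) + φ (‖v‖, H + K)) / 2 := by
        rw [integral_add (hci _) hgs, integral_mul_const,
          integral_sub hgi (hci H), hgI]
        simp

end Distance

/-! ### Medians of finite measures on the line -/

section Median

/-- `m` is a median of the measure `μ` on the real line. -/
def IsMedian (μ : Measure ℝ) (m : ℝ) : Prop :=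
  μ (Iio m) ≤ μ univ / 2 ∧ μ (Ioi m) ≤ μ univ / 2

variable {μ : Measure ℝ} [IsFiniteMeasure μ] {m t : ℝ}

theorem le_half_compl {s : Set ℝ} (hs : MeasurableSet s) (h : μ univ / 2 ≤ μ s) :
    μ sᶜ ≤ μ univ / 2 := by
  rw [measure_compl hs (measure_ne_top μ s), tsub_le_iff_right]
  calc μ univ = μ univ / 2 + μ univ / 2 := (ENNReal.add_halves _).symm
    _ ≤ _ := by gcongr

theorem half_le_compl {s : Set ℝ} (hs : MeasurableSet s) (h : μ s ≤ μ univ / 2) :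
    μ univ / 2 ≤ μ sᶜ := by
  rw [measure_compl hs (measure_ne_top μ s)]
  refine ENNReal.le_sub_of_add_le_left (measure_ne_top μ s) ?_
  calc _ ≤ μ univ / 2 + μ univ / 2 := by gcongr
    _ = μ univ := ENNReal.add_halves _

/-- If `t < m`, then `μ (Iio t) ≤ μ (Iio m) ≤ μ univ / 2 ≤ μ (Ici m) ≤ μ (Ioi t)`, a contradiction.
-/
theorem IsMedian.le_of_lt (hm : IsMedian μ m) (h : μ (Ioi t) < μ (Iio t)) : m ≤ t := by
  by_contra! hlt
  have h1 : μ univ / 2 ≤ μ (Ici m) := by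
    rw [← compl_Iio]; exact half_le_compl measurableSet_Iio hm.1
  have h2 : μ (Ici m) ≤ μ (Ioi t) := measure_mono fun y hy => hlt.trans_le hy
  have h3 : μ (Iio t) ≤ μ (Iio m) := measure_mono (Iio_subset_Iio hlt.le)
  exact absurd h (not_lt.2 (h3.trans (hm.1.trans (h1.trans h2))))

theorem IsMedian.ge_of_lt (hm : IsMedian μ m) (h : μ (Iio t) < μ (Ioi t)) : t ≤ m := by
  by_contra! hlt
  have h1 : μ univ / 2 ≤ μ (Iic m) := by
    rw [← compl_Ioi]; exact half_le_compl measurableSet_Ioi hm.2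
  have h2 : μ (Iic m) ≤ μ (Iio t) := measure_mono fun y hy => lt_of_le_of_lt hy hlt
  have h3 : μ (Ioi t) ≤ μ (Ioi m) := measure_mono (Ioi_subset_Ioi hlt.le)
  exact absurd h (not_lt.2 (h3.trans (hm.2.trans (h1.trans h2))))

theorem IsMedian.measure_Ioo_eq_zero {m' : ℝ} (hm : IsMedian μ m) (hm' : IsMedian μ m')
    (h : m < m') : μ (Ioo m m') = 0 := by
  have h1 : μ univ / 2 ≤ μ (Ici m') := by
    rw [← compl_Iio]; exact half_le_compl measurableSet_Iio hm'.1
  have h2 : Ioi m = Ioo m m' ∪ Ici m' := (Ioo_union_Ici_eq_Ioi h).symm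
  have h3 : μ (Ioi m) = μ (Ioo m m') + μ (Ici m') := by
    rw [h2]
    exact measure_union (disjoint_left.2 fun y hy hy' => not_lt.2 hy' hy.2) measurableSet_Ici
  have h4 : μ (Ioo m m') + μ (Ici m') ≤ 0 + μ (Ici m') := by
    rw [← h3, zero_add]; exact hm.2.trans h1
  exact nonpos_iff_eq_zero.1 ((ENNReal.add_le_add_iff_right (measure_ne_top μ _)).1 h4)

theorem exists_isMedian (μ : Measure ℝ) [IsFiniteMeasure μ] : ∃ m, IsMedian μ m := by
  rcases eq_or_ne (μ univ) 0 with h0 | h0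
  · exact ⟨0, by simp [Measure.measure_univ_eq_zero.1 h0], by simp [Measure.measure_univ_eq_zero.1 h0]⟩
  have hhalf : μ univ / 2 < μ univ := ENNReal.half_lt_self h0 (measure_ne_top μ _)
  have hpos : 0 < μ univ / 2 := ENNReal.half_pos h0
  -- The supremum of `S` is a median: approximation from the left bounds the mass below it,
  -- approximation from the right the mass above it.
  set S : Set ℝ := {t | μ (Iio t) ≤ μ univ / 2}
  have hmono {s t : ℝ} (h : s ≤ t) (ht : t ∈ S) : s ∈ S :=
    (measure_mono (Iio_subset_Iio h)).trans ht
  have hne : S.Nonempty := by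
    have h1 : Tendsto (fun n : ℕ => μ (Iio (-(n : ℝ)))) atTop (𝓝 0) := by
      have h := tendsto_measure_iInter_atTop (μ := μ) (s := fun n : ℕ => Iio (-(n : ℝ)))
        (fun n => measurableSet_Iio.nullMeasurableSet)
        (fun a b hab => Iio_subset_Iio (neg_le_neg (Nat.cast_le.2 hab)))
        ⟨0, measure_ne_top μ _⟩
      have he : ⋂ n : ℕ, Iio (-(n : ℝ)) = ∅ := by
        refine eq_empty_of_forall_notMem fun y hy => ?_
        obtain ⟨n, hn⟩ := exists_nat_gt (-y)
        have := mem_iInter.1 hy n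
        simp only [mem_Iio] at this
        linarith
      rwa [he, measure_empty] at h
    obtain ⟨n, hn⟩ := (h1.eventually_lt_const hpos).exists
    exact ⟨_, hn.le⟩
  have hbdd : BddAbove S := by
    have h1 : Tendsto (fun n : ℕ => μ (Iio (n : ℝ))) atTop (𝓝 (μ univ)) := by
      have h := tendsto_measure_iUnion_atTop (μ := μ) (s := fun n : ℕ => Iio (n : ℝ))
        (fun a b hab => Iio_subset_Iio (Nat.cast_le.2 hab))
      have he : ⋃ n : ℕ, Iio (n : ℝ) = univ := by
        refine eq_univ_of_forall fun y => ?_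
        obtain ⟨n, hn⟩ := exists_nat_gt y
        exact mem_iUnion.2 ⟨n, hn⟩
      rwa [he] at h
    obtain ⟨n, hn⟩ := (h1.eventually_const_lt hhalf).exists
    refine ⟨n, fun t ht => ?_⟩
    by_contra! h
    exact not_lt.2 (hmono h.le ht) hn
  refine ⟨sSup S, ?_, ?_⟩
  · obtain ⟨a, ha, hlt, hlim⟩ := exists_seq_strictMono_tendsto (sSup S)
    have he : Iio (sSup S) = ⋃ n, Iio (a n) := by
      ext y
      simp only [mem_Iio, mem_iUnion]
      exact ⟨fun h => (hlim.eventually_const_lt h).exists, fun ⟨n, hn⟩ => hn.trans (hlt n)⟩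
    rw [he]
    refine le_of_tendsto' (tendsto_measure_iUnion_atTop (μ := μ)
      fun i j hij => Iio_subset_Iio (ha.monotone hij)) fun n => ?_
    obtain ⟨s, hs, hns⟩ := exists_lt_of_lt_csSup hne (hlt n)
    exact hmono hns.le hs
  · obtain ⟨a, ha, hlt, hlim⟩ := exists_seq_strictAnti_tendsto (sSup S)
    have he : Ioi (sSup S) = ⋃ n, Ioi (a n) := by
      ext y
      simp only [mem_Ioi, mem_iUnion]
      exact ⟨fun h => (hlim.eventually_lt_const h).exists, fun ⟨n, hn⟩ => (hlt n).trans hn⟩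
    rw [he]
    refine le_of_tendsto' (tendsto_measure_iUnion_atTop (μ := μ)
      fun i j hij => Ioi_subset_Ioi (ha.antitone hij)) fun n => ?_
    have h1 : μ univ / 2 ≤ μ (Iio (a n)) := by
      by_contra! h
      exact not_lt.2 (le_csSup hbdd h.le) (hlt n)
    refine (measure_mono ?_).trans (le_half_compl measurableSet_Iio h1)
    rw [compl_Iio]
    exact Ioi_subset_Ici_self

variable {u : Plane → ℝ} {A Ω : Set Plane}

/-- The distribution of the values of `u` in `A`. -/
noncomputable def valueDistribution (u : Plane → ℝ) (A : Set Plane) : Measure ℝ :=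
  (volume.restrict A).map u

/-- `A` need not be measurable: null-measurability of the preimage with respect to the restricted
measure is enough. Thus measurability of amoebas never has to be proved. -/
theorem valueDistribution_apply (hΩ : IsCompact Ω) (hu : ContinuousOn u Ω) (hA : A ⊆ Ω) {I : Set ℝ}
    (hI : MeasurableSet I) : valueDistribution u A I = volume {y ∈ A | u y ∈ I} := by
  have hm : AEMeasurable u (volume.restrict A) :=
    (hu.aemeasurable hΩ.measurableSet).mono_measure (Measure.restrict_mono_set _ hA)
  rw [valueDistribution, Measure.map_apply_of_aemeasurable hm hI,
    Measure.restrict_apply₀ (hm.nullMeasurableSet_preimage hI), inter_comm]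
  rfl

theorem isMedianOn_iff (hΩ : IsCompact Ω) (hu : ContinuousOn u Ω) (hA : A ⊆ Ω) (m : ℝ) :
    IsMedianOn u A m ↔ IsMedian (valueDistribution u A) m := by
  rw [IsMedian, valueDistribution_apply hΩ hu hA measurableSet_Iio,
    valueDistribution_apply hΩ hu hA measurableSet_Ioi,
    valueDistribution_apply hΩ hu hA MeasurableSet.univ]
  simp only [mem_univ, and_true]
  rfl

theorem isFiniteMeasure_valueDistribution (hΩ : IsCompact Ω) (hA : A ⊆ Ω) (u : Plane → ℝ) :
    IsFiniteMeasure (valueDistribution u A) := by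
  have : IsFiniteMeasure (volume.restrict A) :=
    isFiniteMeasure_restrict.2 ((measure_mono hA).trans_lt hΩ.measure_lt_top).ne
  unfold valueDistribution
  infer_instance

end Median

/-! ### Coordinates of an orthonormal frame -/

section Frame

variable (b : OrthonormalBasis (Fin 2) ℝ Plane)

/-- The plane in the coordinates of an orthonormal frame. -/
noncomputable def frameMap : ℝ × ℝ →L[ℝ] Plane :=
  (ContinuousLinearMap.fst ℝ ℝ ℝ).smulRight (b 0) + (ContinuousLinearMap.snd ℝ ℝ ℝ).smulRight (b 1)

theorem frameMap_apply (w : ℝ × ℝ) : frameMap b w = w.1 • b 0 + w.2 • b 1 := rfl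

theorem norm_frameMap (w : ℝ × ℝ) : ‖frameMap b w‖ = euclid w := by
  have h : ‖frameMap b w‖ ^ 2 = w.1 ^ 2 + w.2 ^ 2 := by
    have h01 : inner ℝ (b 0) (b 1) = 0 := b.orthonormal.2 (by decide)
    rw [frameMap_apply, norm_add_sq_real, inner_smul_left, inner_smul_right, h01, norm_smul,
      norm_smul, b.orthonormal.1 0, b.orthonormal.1 1]
    simp
  rw [euclid, ← h, Real.sqrt_sq (norm_nonneg _)]

theorem frameMap_eq_comp : (frameMap b : ℝ × ℝ → Plane) =
    b.repr.symm ∘ (WithLp.toLp 2) ∘ MeasurableEquiv.finTwoArrow.symm := by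
  ext1 w
  simp only [Function.comp, frameMap_apply]
  rw [← b.sum_repr_symm]
  simp

theorem measurePreserving_frameMap : MeasurePreserving (frameMap b) := by
  rw [frameMap_eq_comp]
  exact b.measurePreserving_repr_symm.comp
    ((PiLp.volume_preserving_toLp (Fin 2)).comp (volume_preserving_finTwoArrow ℝ).symm)

theorem measurableEmbedding_frameMap : MeasurableEmbedding (frameMap b) := by
  have hinj : Function.Injective (frameMap b) := by
    rw [injective_iff_map_eq_zero]
    intro w hw
    have h1 : ‖w‖ ≤ 0 := by
      have := norm_le_euclid w
      rwa [← norm_frameMap b, hw, norm_zero] at this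
    exact norm_le_zero_iff.1 h1
  exact (frameMap b).continuous.measurableEmbedding hinj

/-- Volumes in rescaled coordinates. -/
theorem volume_preimage_frameMap (x : Plane) {ρ : ℝ} (hρ : 0 < ρ) (S : Set Plane) :
    volume ((fun w : ℝ × ℝ => x + frameMap b (ρ • w)) ⁻¹' S) =
      ENNReal.ofReal (ρ ^ 2)⁻¹ * volume S := by
  have h1 : (fun w : ℝ × ℝ => x + frameMap b (ρ • w)) ⁻¹' S =
      (fun w : ℝ × ℝ => ρ • w) ⁻¹' (frameMap b ⁻¹' ((fun y => x + y) ⁻¹' S)) := rfl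
  rw [h1, Measure.addHaar_preimage_smul _ hρ.ne',
    (measurePreserving_frameMap b).measure_preimage_emb (measurableEmbedding_frameMap b),
    measure_preimage_add]
  simp only [Module.finrank_prod, Module.finrank_self, Nat.reduceAdd]
  rw [abs_of_pos (by positivity)]

end Frame

/-! ### Second-order Taylor expansion in a frame -/

section Taylor

theorem hess_comm {f : Plane → ℝ} {x : Plane} (hf : ContDiffAt ℝ 2 f x) (v w : Plane) :
    hess f x v w = hess f x w v :=
  (hf.isSymmSndFDerivAt (by simp)).eq v w

/-- Second-order Taylor expansion. -/
theorem taylor_two_isLittleO {f : Plane → ℝ} {x : Plane} (hf : ContDiffAt ℝ 2 f x) :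
    (fun v => f (x + v) - f x - fderiv ℝ f x v - hess f x v v / 2) =o[𝓝 0]
      fun v => ‖v‖ ^ 2 := by
  have hd : DifferentiableAt ℝ (fderiv ℝ f) x :=
    (hf.fderiv_right (m := 1) (by norm_num)).differentiableAt (by simp)
  have h1 := hasFDerivAt_iff_isLittleO_nhds_zero.1 hd.hasFDerivAt
  have hdiff : ∀ᶠ v in 𝓝 (0 : Plane), DifferentiableAt ℝ f (x + v) := by
    have h2 : ∀ᶠ y in 𝓝 x, DifferentiableAt ℝ f y :=
      (hf.eventually (by simp)).mono fun y hy => hy.differentiableAt (by simp)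
    have h3 : Tendsto (fun v : Plane => x + v) (𝓝 0) (𝓝 x) := by
      have : Continuous fun v : Plane => x + v := by fun_prop
      simpa using this.tendsto 0
    exact h3.eventually h2
  refine Asymptotics.isLittleO_iff.2 fun c hc => ?_
  obtain ⟨r, hr, hball⟩ := Metric.eventually_nhds_iff_ball.1
    ((Asymptotics.isLittleO_iff.1 h1 hc).and hdiff)
  filter_upwards [Metric.ball_mem_nhds (0 : Plane) hr] with v hv
  set g : Plane → ℝ := fun v => f (x + v) - f x - fderiv ℝ f x v - hess f x v v / 2 with hg
  have hder (w : Plane) (hw : w ∈ Metric.ball (0 : Plane) r) : HasFDerivAt g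
      (fderiv ℝ f (x + w) - fderiv ℝ f x - fderiv ℝ (fderiv ℝ f) x w) w := by
    have e1 : HasFDerivAt (fun v => f (x + v)) (fderiv ℝ f (x + w)) w :=
      ((hball w hw).2.hasFDerivAt.comp w ((hasFDerivAt_id w).const_add x)).congr_fderiv
        (ContinuousLinearMap.comp_id _)
    have e2 : HasFDerivAt (fun v => hess f x v v)
        ((2 : ℝ) • fderiv ℝ (fderiv ℝ f) x w) w := by
      refine ((fderiv ℝ (fderiv ℝ f) x).hasFDerivAt.clm_apply
        (hasFDerivAt_id (𝕜 := ℝ) w)).congr_fderiv ?_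
      ext v
      have := hess_comm hf v w
      simp only [hess] at this
      simp [this, two_mul]
    have hg' : g = fun v => f (x + v) - f x - fderiv ℝ f x v - 2⁻¹ * hess f x v v := by
      ext v; simp only [hg]; ring
    rw [hg']
    refine (((e1.sub_const (f x)).sub (fderiv ℝ f x).hasFDerivAt).sub
      (e2.const_mul 2⁻¹)).congr_fderiv ?_
    rw [smul_smul]
    norm_num
  have hsub : Metric.closedBall (0 : Plane) ‖v‖ ⊆ Metric.ball 0 r :=
    Metric.closedBall_subset_ball (by simpa using hv)
  -- The derivative of the remainder is the first-order remainder of `fderiv ℝ f`, at most `c‖w‖ ≤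
  -- c‖v‖` on this ball; the mean value inequality supplies the second factor `‖v‖`.
  have hmv := (convex_closedBall (0 : Plane) ‖v‖).norm_image_sub_le_of_norm_hasFDerivWithin_le
    (C := c * ‖v‖) (fun w hw => (hder w (hsub hw)).hasFDerivWithinAt) (fun w hw => ?_)
    (Metric.mem_closedBall_self (norm_nonneg v)) (show v ∈ Metric.closedBall (0 : Plane) ‖v‖ by simp)
  · have h0 : g 0 = 0 := by simp [hg, hess]
    rw [h0, sub_zero, sub_zero] at hmv
    rw [norm_pow, norm_norm]
    calc ‖g v‖ ≤ c * ‖v‖ * ‖v‖ := hmv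
      _ = c * ‖v‖ ^ 2 := by ring
  · have := (hball w (hsub hw)).1
    refine this.trans (mul_le_mul_of_nonneg_left ?_ hc.le)
    simpa using hw

theorem inner_gradient {f : Plane → ℝ} (x v : Plane) :
    inner ℝ (gradient f x) v = fderiv ℝ f x v := by
  rw [gradient, InnerProductSpace.toDual_symm_apply]

variable (b : OrthonormalBasis (Fin 2) ℝ Plane)

/-- The increment of `f` from `x`, in a frame, cut off outside the ball of radius `r`. -/
noncomputable def localDiff (f : Plane → ℝ) (x : Plane) (r : ℝ) (w : ℝ × ℝ) : ℝ :=
  (Metric.ball x r).indicator (fun y => f y - f x) (x + frameMap b w)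

variable {b} {f : Plane → ℝ} {x : Plane} {r : ℝ}

/-- The cut-off gives global measurability although nothing is assumed of `f` away from the ball. -/
theorem measurable_localDiff (hf : ContinuousOn f (Metric.ball x r)) :
    Measurable (localDiff b f x r) := by
  have h : Measurable ((Metric.ball x r).indicator fun y => f y - f x) := by
    classical
    rw [← piecewise_eq_indicator]
    exact (hf.sub continuousOn_const).measurable_piecewise continuousOn_const measurableSet_ball
  exact h.comp ((frameMap b).continuous.measurable.const_add x)

theorem localDiff_of_lt {w : ℝ × ℝ} (hw : euclid w < r) :
    localDiff b f x r w = f (x + frameMap b w) - f x := by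
  rw [localDiff, indicator_of_mem]
  rwa [mem_ball_iff_norm, add_sub_cancel_left, norm_frameMap]

theorem hasExpansion_localDiff (hr : 0 < r) (hf : ContDiffAt ℝ 2 f x) {z α : ℝ}
    (h0 : inner ℝ (gradient f x) (b 0) = z * Real.cos α)
    (h1 : inner ℝ (gradient f x) (b 1) = -(z * Real.sin α)) :
    HasExpansion (localDiff b f x r) (linForm z α) (quadForm (hess f x (b 0) (b 0) / 2)
      (hess f x (b 0) (b 1) / 2) (hess f x (b 1) (b 1) / 2)) := by
  have ht : Tendsto (frameMap b) (𝓝 0) (𝓝 0) := by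
    simpa using (frameMap b).continuous.tendsto 0
  have hO : (fun w => ‖frameMap b w‖ ^ 2) =O[𝓝 0] fun w => ‖w‖ ^ 2 :=
    (((frameMap b).isBigO_id (𝓝 0)).norm_norm).pow 2
  refine (((taylor_two_isLittleO hf).comp_tendsto ht).trans_isBigO hO).congr' ?_ EventuallyEq.rfl
  have hsmall : ∀ᶠ w in 𝓝 (0 : ℝ × ℝ), euclid w < r := by
    have := continuous_euclid.tendsto 0
    rw [show euclid 0 = 0 by simp [euclid]] at this
    exact this.eventually_lt_const hr
  filter_upwards [hsmall] with w hw
  simp only [Function.comp, localDiff_of_lt hw]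
  rw [inner_gradient] at h0 h1
  have hc := hess_comm hf (b 0) (b 1)
  have e1 : fderiv ℝ f x (frameMap b w) = linForm z α w := by
    rw [frameMap_apply, map_add, map_smul, map_smul, h0, h1, linForm, smul_eq_mul, smul_eq_mul]
    ring
  have e2 : hess f x (frameMap b w) (frameMap b w) / 2 = quadForm (hess f x (b 0) (b 0) / 2)
      (hess f x (b 0) (b 1) / 2) (hess f x (b 1) (b 1) / 2) w := by
    simp only [hess] at hc ⊢
    simp only [frameMap_apply, map_add, map_smul, add_apply, smul_apply, smul_eq_mul, quadForm]
    rw [← hc]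
    ring
  rw [e1, e2]

end Taylor

/-! ### From secant balls to amoebas and their medians -/

section Localization

variable {φ : Seminorm ℝ (ℝ × ℝ)} {ν : ℝ → ℝ} {Ω : Set Plane} {f u : Plane → ℝ} {x : Plane}
  {b : OrthonormalBasis (Fin 2) ℝ Plane} {r ρ z α U : ℝ} {B : NNReal}

/-- The Lipschitz constant of the differential is the `κ` of the inner secant ball. -/
theorem exists_ball_lipschitzOnWith_fderiv (hf : ContDiffOn ℝ ∞ f Ω) (hx : x ∈ interior Ω) :
    ∃ r > 0, ∃ B : NNReal, Metric.ball x r ⊆ Ω ∧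
      LipschitzOnWith B (fderiv ℝ f) (Metric.ball x r) := by
  have hfx : ContDiffAt ℝ ∞ f x := hf.contDiffAt (mem_interior_iff_mem_nhds.1 hx)
  have hfx2 : ContDiffAt ℝ 1 (fderiv ℝ f) x := hfx.fderiv_right (m := 1) (by norm_cast)
  obtain ⟨B, t, ht, hB⟩ := hfx2.exists_lipschitzOnWith
  obtain ⟨r, hr, hball⟩ := Metric.mem_nhds_iff.1
    (inter_mem ht (mem_interior_iff_mem_nhds.1 hx))
  exact ⟨r, hr, B, hball.trans inter_subset_right, hB.mono (hball.trans inter_subset_left)⟩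

theorem euclid_smul (hρ : 0 ≤ ρ) (w : ℝ × ℝ) : euclid (ρ • w) = ρ * euclid w := by
  have := norm_frameMap (EuclideanSpace.basisFun (Fin 2) ℝ) (ρ • w)
  rw [map_smul, norm_smul, norm_frameMap, Real.norm_of_nonneg hρ] at this
  exact this.symm

/-- Homogeneity of `φ` undoes the rescaling, so that the distance bounds become conditions on the
secant gauge. -/
theorem secantGauge_localDiff (hρ : 0 < ρ) {w : ℝ × ℝ} (hw : euclid (ρ • w) < r) (κ : ℝ) :
    ρ * secantGauge φ (localDiff b f x r) κ ρ w =
      (φ (‖frameMap b (ρ • w)‖, f (x + frameMap b (ρ • w)) - f x - κ * ‖frameMap b (ρ • w)‖ ^ 2) +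
        φ (‖frameMap b (ρ • w)‖,
          f (x + frameMap b (ρ • w)) - f x + κ * ‖frameMap b (ρ • w)‖ ^ 2)) / 2 := by
  have key (t : ℝ) : ρ * φ (euclid w, t / ρ) = φ (euclid (ρ • w), t) := by
    rw [euclid_smul hρ.le, show ((ρ * euclid w, t) : ℝ × ℝ) = ρ • (euclid w, t / ρ) by
      ext <;> simp; field_simp, map_smul_eq_mul, Real.norm_of_nonneg hρ.le]
  have hk : κ * ρ * euclid w ^ 2 = κ * euclid (ρ • w) ^ 2 / ρ := by
    rw [euclid_smul hρ.le]; field_simp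
  rw [secantGauge, localDiff_of_lt hw, hk, ← sub_div, ← add_div, mul_div_assoc', mul_add, key, key,
    norm_frameMap]

theorem IsAmoebaNorm.mem_secantBall_of_mem_amoeba (hφ : IsAmoebaNorm φ ν)
    (hf : ContDiffOn ℝ ∞ f Ω) (hρ : 0 < ρ) (hρr : ρ < r) {w : ℝ × ℝ}
    (hw : x + frameMap b (ρ • w) ∈ amoeba Ω φ f ρ x) :
    w ∈ secantBall φ (localDiff b f x r) 0 ρ := by
  have h1 := (hφ.ofReal_apply_le_amoebaDist hf x (x + frameMap b (ρ • w))).trans hw.2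
  rw [ENNReal.ofReal_le_ofReal_iff hρ.le, add_sub_cancel_left] at h1
  have h2 := (le_abs_self _).trans ((hφ.abs_le_apply _ _).trans h1)
  rw [norm_frameMap] at h2
  have h3 := secantGauge_localDiff (φ := φ) (b := b) (f := f) (x := x) hρ (h2.trans_lt hρr) 0
  rw [zero_mul, sub_zero, add_zero, add_self_div_two] at h3
  change secantGauge φ (localDiff b f x r) 0 ρ w ≤ 1
  rw [← h3] at h1
  exact (mul_le_iff_le_one_right hρ).1 h1

theorem IsAmoebaNorm.mem_amoeba_of_mem_secantBall (hφ : IsAmoebaNorm φ ν)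
    (hf : ContDiffOn ℝ ∞ f Ω) (hball : Metric.ball x r ⊆ Ω)
    (hB : LipschitzOnWith B (fderiv ℝ f) (Metric.ball x r)) (hρ : 0 < ρ) (hρr : ρ < r) {w : ℝ × ℝ}
    (hw : w ∈ secantBall φ (localDiff b f x r) B ρ) (hw0 : w ≠ 0) :
    x + frameMap b (ρ • w) ∈ amoeba Ω φ f ρ x := by
  have h1 := hφ.euclid_le_one_of_mem_secantBall hw
  have h2 : euclid (ρ • w) < r := by
    rw [euclid_smul hρ.le]
    exact (mul_le_of_le_one_right hρ.le h1).trans_lt hρr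
  have h3 := secantGauge_localDiff (φ := φ) (b := b) (f := f) (x := x) hρ h2 B
  have hmem : x + frameMap b (ρ • w) ∈ Metric.ball x r := by
    rwa [mem_ball_iff_norm, add_sub_cancel_left, norm_frameMap]
  have hne : x + frameMap b (ρ • w) ≠ x := by
    rw [Ne, add_eq_left, (frameMap b).map_smul, smul_eq_zero, not_or]
    refine ⟨hρ.ne', fun h => hw0 ?_⟩
    exact (measurableEmbedding_frameMap b).injective (h.trans (map_zero _).symm)
  refine ⟨hball hmem, (hφ.amoebaDist_le hball (hf.mono hball) hB hmem hne).trans ?_⟩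
  rw [add_sub_cancel_left, ← h3]
  exact ENNReal.ofReal_le_ofReal (mul_le_of_le_one_right hρ.le hw)

/-- The level side areas of the amoeba compare as those of the secant balls. -/
theorem volume_lt_of_secantBall (hφ : IsAmoebaNorm φ ν)
    (hf : ContDiffOn ℝ ∞ f Ω) (hball : Metric.ball x r ⊆ Ω)
    (hB : LipschitzOnWith B (fderiv ℝ f) (Metric.ball x r)) (hρ : 0 < ρ) (hρr : ρ < r)
    {P Q : ℝ → Prop}
    (h : volume (secantBall φ (localDiff b f x r) 0 ρ ∩ {w | P (localDiff b u x r (ρ • w))}) <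
      volume (secantBall φ (localDiff b f x r) B ρ ∩ {w | Q (localDiff b u x r (ρ • w))})) :
    volume {y ∈ amoeba Ω φ f ρ x | P (u y - u x)} <
      volume {y ∈ amoeba Ω φ f ρ x | Q (u y - u x)} := by
  have hdiff (κ : ℝ) {w : ℝ × ℝ} (hw : w ∈ secantBall φ (localDiff b f x r) κ ρ) :
      localDiff b u x r (ρ • w) = u (x + frameMap b (ρ • w)) - u x := by
    refine localDiff_of_lt ?_
    rw [euclid_smul hρ.le]
    exact (mul_le_of_le_one_right hρ.le (hφ.euclid_le_one_of_mem_secantBall hw)).trans_lt hρr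
  have h1 : (fun w : ℝ × ℝ => x + frameMap b (ρ • w)) ⁻¹'
      {y ∈ amoeba Ω φ f ρ x | P (u y - u x)} ⊆
      secantBall φ (localDiff b f x r) 0 ρ ∩ {w | P (localDiff b u x r (ρ • w))} := by
    rintro w ⟨hw, hp⟩
    have hw' := hφ.mem_secantBall_of_mem_amoeba hf hρ hρr hw
    exact ⟨hw', by simpa only [mem_ofPred_eq, hdiff 0 hw'] using hp⟩
  -- The origin is omitted because the constant curve is not regular; a single point has no area.
  have h2 : (secantBall φ (localDiff b f x r) B ρ ∩ {w | Q (localDiff b u x r (ρ • w))}) \ {0} ⊆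
      (fun w : ℝ × ℝ => x + frameMap b (ρ • w)) ⁻¹' {y ∈ amoeba Ω φ f ρ x | Q (u y - u x)} := by
    rintro w ⟨⟨hw, hq⟩, hw0⟩
    refine ⟨hφ.mem_amoeba_of_mem_secantBall hf hball hB hρ hρr hw hw0, ?_⟩
    simpa only [mem_ofPred_eq, hdiff B hw] using hq
  have h3 := (measure_mono h1).trans_lt (h.trans_le
    ((measure_sdiff_null (measure_singleton (0 : ℝ × ℝ))).symm.le.trans (measure_mono h2)))
  rw [volume_preimage_frameMap b x hρ, volume_preimage_frameMap b x hρ] at h3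
  exact lt_of_mul_lt_mul_left' h3

/-- Small punctured balls around the reference point lie in the amoeba. -/
theorem eventually_mem_amoeba (hφ : IsAmoebaNorm φ ν) (hf : ContDiffOn ℝ ∞ f Ω)
    (hx : x ∈ interior Ω) :
    ∃ c > 0, ∀ᶠ ρ in 𝓝[>] (0 : ℝ), ∀ y ∈ Metric.ball x (c * ρ), y ≠ x →
      y ∈ amoeba Ω φ f ρ x := by
  obtain ⟨r, hr, B, hball, hB⟩ := exists_ball_lipschitzOnWith_fderiv hf hx
  have hfx : ContDiffAt ℝ ∞ f x := hf.contDiffAt (mem_interior_iff_mem_nhds.1 hx)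
  have hLip : ∃ L : NNReal, ∃ t ∈ 𝓝 x, LipschitzOnWith L f t :=
    (hfx.of_le (by exact_mod_cast le_top) : ContDiffAt ℝ 1 f x).exists_lipschitzOnWith
  obtain ⟨L, t, ht, hL⟩ := hLip
  obtain ⟨s, hs, hst⟩ := Metric.mem_nhds_iff.1 ht
  -- By the triangle inequality in the two slots, the upper bound for the distance is at most `M‖y -
  -- x‖`; the summand `1` makes `M` positive.
  set M : ℝ := φ (1, 0) + φ (0, 1) * (L + B) + 1
  have hM : 0 < M := by positivity
  refine ⟨1 / M, by positivity, ?_⟩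
  have hlim : Tendsto (fun ρ : ℝ => 1 / M * ρ) (𝓝[>] 0) (𝓝 0) := by
    have : Tendsto (fun ρ : ℝ => ρ) (𝓝[>] 0) (𝓝 0) := tendsto_id.mono_left nhdsWithin_le_nhds
    simpa using this.const_mul (1 / M)
  filter_upwards [hlim.eventually_lt_const hr, hlim.eventually_lt_const hs,
    hlim.eventually_lt_const one_pos, self_mem_nhdsWithin] with ρ h1 h2 h3 (hρ : 0 < ρ) y hy hyx
  have hyr := Metric.ball_subset_ball h1.le hy
  refine ⟨hball hyr, (hφ.amoebaDist_le hball (hf.mono hball) hB hyr hyx).trans ?_⟩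
  refine ENNReal.ofReal_le_ofReal ?_
  rw [mem_ball_iff_norm] at hy
  set v := ‖y - x‖
  have hv : 0 ≤ v := norm_nonneg _
  have hfy : |f y - f x| ≤ L * v :=
    hL.norm_sub_le (hst (Metric.ball_subset_ball h2.le (by rwa [mem_ball_iff_norm])))
      (hst (Metric.mem_ball_self hs))
  have hk (k : ℝ) (hk : |k| ≤ B * v) : φ (v, f y - f x + k) ≤ ρ := by
    have e1 : φ (v, f y - f x + k) ≤ φ (v, 0) + φ (0, f y - f x + k) := by
      have := map_add_le_add φ (v, 0) (0, f y - f x + k)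
      simpa using this
    have e2 : φ (v, 0) = v * φ (1, 0) := by
      rw [show ((v, 0) : ℝ × ℝ) = v • (1, 0) by simp, map_smul_eq_mul, Real.norm_of_nonneg hv]
    have e3 : φ (0, f y - f x + k) = |f y - f x + k| * φ (0, 1) := by
      rw [show ((0, f y - f x + k) : ℝ × ℝ) = (f y - f x + k) • (0, 1) by simp, map_smul_eq_mul,
        Real.norm_eq_abs]
    have e4 : |f y - f x + k| ≤ (L + B) * v := by
      refine (abs_add_le _ _).trans ?_
      linarith
    have e5 := mul_le_mul_of_nonneg_right e4 (apply_nonneg φ (0, 1))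
    have e6 : v * M ≤ ρ := by
      have := mul_le_mul_of_nonneg_right hy.le hM.le
      rwa [one_div, mul_right_comm, inv_mul_cancel₀ hM.ne', one_mul] at this
    have e7 : v * M = v * φ (1, 0) + (L + B) * v * φ (0, 1) + v := by simp only [M]; ring
    linarith
  have hBv : |(B : ℝ) * v ^ 2| ≤ B * v := by
    rw [abs_of_nonneg (by positivity)]
    exact mul_le_mul_of_nonneg_left (by nlinarith) B.2
  have k1 := hk _ hBv
  have k2 := hk (-(B * v ^ 2)) (by rwa [abs_neg])
  rw [← sub_eq_add_neg] at k2
  linarith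

/-- The values of `u` near a regular point cover an interval on the scale `ρ²`, on sets of
positive area. -/
theorem eventually_volume_pos (hφ : IsAmoebaNorm φ ν) (hf : ContDiffOn ℝ ∞ f Ω)
    (hu : ContDiffOn ℝ ∞ u Ω) (hx : x ∈ interior Ω) (hux : gradient u x ≠ 0) (T : ℝ) :
    ∀ᶠ ρ in 𝓝[>] (0 : ℝ), ∀ m₁ m₂ : ℝ, m₁ < m₂ → u x - T * ρ ^ 2 ≤ m₁ → m₂ ≤ u x + T * ρ ^ 2 →
      0 < volume {y ∈ amoeba Ω φ f ρ x | u y ∈ Ioo m₁ m₂} := by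
  obtain ⟨c, hc, hamoeba⟩ := eventually_mem_amoeba hφ hf hx
  have hxn := mem_interior_iff_mem_nhds.1 hx
  obtain ⟨r, hr, hball⟩ := Metric.mem_nhds_iff.1 hxn
  have hd : HasDerivAt (fun s : ℝ => u (x + s • gradient u x)) (‖gradient u x‖ ^ 2) 0 := by
    have h1 : HasFDerivAt u (fderiv ℝ u x) x :=
      ((hu.contDiffAt hxn).differentiableAt (by simp)).hasFDerivAt
    have h2 : HasDerivAt (fun s : ℝ => x + s • gradient u x) (gradient u x) 0 := by
      simpa using ((hasDerivAt_id (0 : ℝ)).smul_const (gradient u x)).const_add x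
    have h3 := (show HasFDerivAt u (fderiv ℝ u x) (x + (0 : ℝ) • gradient u x) by
      simpa using h1).comp_hasDerivAt (0 : ℝ) h2
    rwa [← inner_gradient, real_inner_self_eq_norm_sq] at h3
  set g := ‖gradient u x‖ with hg
  have hgpos : 0 < g := norm_pos_iff.2 hux
  -- The points `x ± eρ ∇u` are at distance `cρ/2` from `x`, and there `u` has changed by at least
  -- `eρg²/2`, which exceeds `Tρ²` for small `ρ`. The intermediate value theorem on the ball then
  -- reaches every value in the window, and openness gives positive area.
  set e : ℝ := c / (2 * g)
  have he : 0 < e := by positivity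
  have hlim (a : ℝ) : Tendsto (fun ρ : ℝ => a * ρ) (𝓝[>] 0) (𝓝 0) := by
    have : Tendsto (fun ρ : ℝ => ρ) (𝓝[>] 0) (𝓝 0) := tendsto_id.mono_left nhdsWithin_le_nhds
    simpa using this.const_mul a
  have hbound := Asymptotics.isLittleO_iff.1 (hasDerivAt_iff_isLittleO_nhds_zero.1 hd)
    (show 0 < g ^ 2 / 2 by positivity)
  filter_upwards [hamoeba, (hlim c).eventually_lt_const hr, (hlim e).eventually hbound,
    (hlim (-e)).eventually hbound, (hlim T).eventually_lt_const (show 0 < e * g ^ 2 / 2 by positivity),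
    self_mem_nhdsWithin] with ρ hA hcr hp hn hT (hρ : 0 < ρ) m₁ m₂ hm h1 h2
  simp only [zero_add, zero_smul, add_zero, Real.norm_eq_abs, smul_eq_mul, abs_mul, abs_of_pos hρ,
    abs_neg, abs_of_pos he] at hp hn
  have hp' := (abs_le.1 hp).1
  have hn' := (abs_le.1 hn).2
  have hT2 : T * ρ ^ 2 < ρ * (e * g ^ 2 / 2) := by nlinarith
  have hmem (s : ℝ) (hs : |s| = e * ρ) : x + s • gradient u x ∈ Metric.ball x (c * ρ) := by
    rw [mem_ball_iff_norm, add_sub_cancel_left, norm_smul, Real.norm_eq_abs, hs, ← hg]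
    have : e * ρ * g = c * ρ / 2 := by simp only [e]; field_simp
    rw [this]
    have : 0 < c * ρ := by positivity
    linarith
  have hsub : Metric.ball x (c * ρ) ⊆ Metric.ball x r := Metric.ball_subset_ball hcr.le
  have hcont : ContinuousOn u (Metric.ball x (c * ρ)) :=
    hu.continuousOn.mono (hsub.trans hball)
  have hivt := ((convex_ball x (c * ρ)).isPreconnected).intermediate_value
    (hmem (-e * ρ) (by simp [abs_mul, abs_of_pos hρ, abs_of_pos he]))
    (hmem (e * ρ) (by simp [abs_mul, abs_of_pos hρ, abs_of_pos he])) hcont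
  obtain ⟨y, hy, hyu⟩ := hivt (show (m₁ + m₂) / 2 ∈ Icc _ _ by constructor <;> nlinarith)
  have hopen : IsOpen (Metric.ball x (c * ρ) ∩ u ⁻¹' Ioo m₁ m₂) :=
    hcont.isOpen_inter_preimage Metric.isOpen_ball isOpen_Ioo
  have hpos : 0 < volume (Metric.ball x (c * ρ) ∩ u ⁻¹' Ioo m₁ m₂) :=
    hopen.measure_pos _ ⟨y, hy, by rw [mem_preimage, hyu]; constructor <;> linarith⟩
  rw [← measure_sdiff_null (measure_singleton x)] at hpos
  exact hpos.trans_le (measure_mono fun y hy => ⟨hA y hy.1.1 hy.2, hy.1.2⟩)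

theorem amoeba_subset (Ω : Set Plane) (φ : Seminorm ℝ (ℝ × ℝ)) (f : Plane → ℝ) (ρ : ℝ)
    (x : Plane) : amoeba Ω φ f ρ x ⊆ Ω := fun _ h => h.1

/-- Medians of `u` over small amoebas, up to `o(ρ²)`. -/
theorem eventually_median_mem_Icc (hφ : IsAmoebaNorm φ ν) (hΩ : IsCompact Ω)
    (hf : ContDiffOn ℝ ∞ f Ω) (hu : ContDiffOn ℝ ∞ u Ω) (hx : x ∈ interior Ω)
    (hz : z ≠ 0) (hU : 0 < U)
    (hf0 : inner ℝ (gradient f x) (b 0) = z * Real.cos α)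
    (hf1 : inner ℝ (gradient f x) (b 1) = -(z * Real.sin α))
    (hu0 : inner ℝ (gradient u x) (b 0) = U) (hu1 : inner ℝ (gradient u x) (b 1) = 0)
    {k₁ k₂ k₀ : ℝ} (hk₀ : k₀ = balance ν z α (hess f x (b 0) (b 0) / 2) (hess f x (b 0) (b 1) / 2)
      (hess f x (b 1) (b 1) / 2) U (hess u x (b 1) (b 1) / 2)) (hk₁ : k₁ < k₀) (hk₂ : k₀ < k₂) :
    ∀ᶠ ρ in 𝓝[>] (0 : ℝ), ∀ m, IsMedianOn u (amoeba Ω φ f ρ x) m →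
      u x + k₁ * ρ ^ 2 ≤ m ∧ m ≤ u x + k₂ * ρ ^ 2 := by
  obtain ⟨r, hr, B, hball, hB⟩ := exists_ball_lipschitzOnWith_fderiv hf hx
  have hxn := mem_interior_iff_mem_nhds.1 hx
  have hf2 : ContDiffAt ℝ 2 f x := by exact_mod_cast contDiffAt_infty.1 (hf.contDiffAt hxn) 2
  have hu2 : ContDiffAt ℝ 2 u x := by exact_mod_cast contDiffAt_infty.1 (hu.contDiffAt hxn) 2
  have hD := hasExpansion_localDiff (b := b) hr hf2 hf0 hf1
  have hE := hasExpansion_localDiff (b := b) (z := U) (α := 0) hr hu2 (by simp [hu0]) (by simp [hu1])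
  have hDm := measurable_localDiff (b := b) (hf.continuousOn.mono hball)
  have hEm := measurable_localDiff (b := b) (hu.continuousOn.mono hball)
  have hup := (hD.eventually_area_lt hφ hDm hz hEm hU hE B (k := k₂)).1 (hk₀ ▸ hk₂)
  have hlo := (hD.eventually_area_lt hφ hDm hz hEm hU hE B (k := k₁)).2 (hk₀ ▸ hk₁)
  filter_upwards [hup, hlo, Ioo_mem_nhdsGT hr] with ρ hup hlo hρ m hm
  have hA := amoeba_subset Ω φ f ρ x
  rw [isMedianOn_iff hΩ hu.continuousOn hA] at hm
  have := isFiniteMeasure_valueDistribution hΩ hA u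
  have h1 := volume_lt_of_secantBall (P := fun t => k₂ * ρ ^ 2 < t) (Q := fun t => t < k₂ * ρ ^ 2)
    hφ hf hball hB hρ.1 hρ.2 hup
  have h2 := volume_lt_of_secantBall (P := fun t => t < k₁ * ρ ^ 2) (Q := fun t => k₁ * ρ ^ 2 < t)
    hφ hf hball hB hρ.1 hρ.2 hlo
  simp only [lt_sub_iff_add_lt', sub_lt_iff_lt_add'] at h1 h2
  constructor
  · refine hm.ge_of_lt ?_
    rw [valueDistribution_apply hΩ hu.continuousOn hA measurableSet_Iio,
      valueDistribution_apply hΩ hu.continuousOn hA measurableSet_Ioi]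
    exact h2
  · refine hm.le_of_lt ?_
    rw [valueDistribution_apply hΩ hu.continuousOn hA measurableSet_Iio,
      valueDistribution_apply hΩ hu.continuousOn hA measurableSet_Ioi]
    exact h1

/-- Two distinct medians would bound an interval of values taken only on a null set. Both lie within
`(|k₀| + 1)ρ²` of `u x`, where every interval of values has positive area. -/
theorem eventually_existsUnique_median (hφ : IsAmoebaNorm φ ν) (hΩ : IsCompact Ω)
    (hf : ContDiffOn ℝ ∞ f Ω) (hu : ContDiffOn ℝ ∞ u Ω) (hx : x ∈ interior Ω)
    (hz : z ≠ 0) (hU : 0 < U)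
    (hf0 : inner ℝ (gradient f x) (b 0) = z * Real.cos α)
    (hf1 : inner ℝ (gradient f x) (b 1) = -(z * Real.sin α))
    (hu0 : inner ℝ (gradient u x) (b 0) = U) (hu1 : inner ℝ (gradient u x) (b 1) = 0) :
    ∀ᶠ ρ in 𝓝[>] (0 : ℝ), ∃! m : ℝ, IsMedianOn u (amoeba Ω φ f ρ x) m := by
  set k₀ := balance ν z α (hess f x (b 0) (b 0) / 2) (hess f x (b 0) (b 1) / 2)
      (hess f x (b 1) (b 1) / 2) U (hess u x (b 1) (b 1) / 2) with hk₀
  have hux : gradient u x ≠ 0 := fun h => by simp [h] at hu0; exact hU.ne hu0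
  have hloc := eventually_median_mem_Icc hφ hΩ hf hu hx hz hU hf0 hf1 hu0 hu1 hk₀
    (sub_one_lt k₀) (lt_add_one k₀)
  filter_upwards [hloc, eventually_volume_pos hφ hf hu hx hux (|k₀| + 1)] with ρ hloc hpos
  have hA := amoeba_subset Ω φ f ρ x
  have := isFiniteMeasure_valueDistribution hΩ hA u
  have hunique : ∀ m m' : ℝ, IsMedianOn u (amoeba Ω φ f ρ x) m →
      IsMedianOn u (amoeba Ω φ f ρ x) m' → m' ≤ m := by
    intro m m' hm hm'
    by_contra! hlt
    have h1 : u x - (|k₀| + 1) * ρ ^ 2 ≤ m := by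
      have := (hloc m hm).1
      nlinarith [neg_abs_le k₀, sq_nonneg ρ]
    have h2 : m' ≤ u x + (|k₀| + 1) * ρ ^ 2 := by
      have := (hloc m' hm').2
      nlinarith [le_abs_self k₀, sq_nonneg ρ]
    rw [isMedianOn_iff hΩ hu.continuousOn hA] at hm hm'
    have h3 := hm.measure_Ioo_eq_zero hm' hlt
    rw [valueDistribution_apply hΩ hu.continuousOn hA measurableSet_Ioo] at h3
    exact (hpos m m' hlt h1 h2).ne' h3
  obtain ⟨m, hm⟩ := exists_isMedian (valueDistribution u (amoeba Ω φ f ρ x))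
  rw [← isMedianOn_iff hΩ hu.continuousOn hA] at hm
  exact ⟨m, hm, fun m' hm' => le_antisymm (hunique _ _ hm hm') (hunique _ _ hm' hm)⟩

theorem tendsto_median (hφ : IsAmoebaNorm φ ν) (hΩ : IsCompact Ω)
    (hf : ContDiffOn ℝ ∞ f Ω) (hu : ContDiffOn ℝ ∞ u Ω) (hx : x ∈ interior Ω)
    (hz : z ≠ 0) (hU : 0 < U)
    (hf0 : inner ℝ (gradient f x) (b 0) = z * Real.cos α)
    (hf1 : inner ℝ (gradient f x) (b 1) = -(z * Real.sin α))
    (hu0 : inner ℝ (gradient u x) (b 0) = U) (hu1 : inner ℝ (gradient u x) (b 1) = 0) {m : ℝ → ℝ}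
    (hm : ∀ᶠ ρ in 𝓝[>] (0 : ℝ), IsMedianOn u (amoeba Ω φ f ρ x) (m ρ)) :
    Tendsto (fun ρ => (m ρ - u x) / (ρ ^ 2 / 6)) (𝓝[>] (0 : ℝ))
      (𝓝 (6 * balance ν z α (hess f x (b 0) (b 0) / 2) (hess f x (b 0) (b 1) / 2)
      (hess f x (b 1) (b 1) / 2) U (hess u x (b 1) (b 1) / 2))) := by
  set k₀ := balance ν z α (hess f x (b 0) (b 0) / 2) (hess f x (b 0) (b 1) / 2)
      (hess f x (b 1) (b 1) / 2) U (hess u x (b 1) (b 1) / 2) with hk₀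
  refine tendsto_order.2 ⟨fun a ha => ?_, fun a ha => ?_⟩
  -- The midpoint lies strictly between `a/6` and `k₀`, which leaves room for a strict inequality.
  · have h := eventually_median_mem_Icc (k₁ := (a / 6 + k₀) / 2) hφ hΩ hf hu hx hz hU hf0 hf1 hu0
      hu1 hk₀ (by linarith) (lt_add_one k₀)
    filter_upwards [h, hm, self_mem_nhdsWithin] with ρ h hm (hρ : 0 < ρ)
    rw [lt_div_iff₀ (by positivity)]
    nlinarith [(h _ hm).1, pow_pos hρ 2]
  · have h := eventually_median_mem_Icc (k₂ := (a / 6 + k₀) / 2) hφ hΩ hf hu hx hz hU hf0 hf1 hu0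
      hu1 hk₀ (sub_one_lt k₀) (by linarith)
    filter_upwards [h, hm, self_mem_nhdsWithin] with ρ h hm (hρ : 0 < ρ)
    rw [div_lt_iff₀ (by positivity)]
    nlinarith [(h _ hm).2, pow_pos hρ 2]

end Localization

/-! ### The angular mean: its derivative and its value -/

section ArcMean

variable {φ : Seminorm ℝ (ℝ × ℝ)} {ν : ℝ → ℝ}

/-- The edge-stopping function as an angular mean. -/
noncomputable def arcMean (ν : ℝ → ℝ) (z : ℝ) : ℝ :=
  1 / 2 * ∫ ϑ in (-(Real.pi / 2))..(Real.pi / 2), Real.cos ϑ * (evenExt ν (z * Real.cos ϑ) ^ 3)⁻¹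

theorem abs_inv_cube_sub_le {a b : ℝ} (ha : 1 ≤ a) (hb : 1 ≤ b) :
    |(a ^ 3)⁻¹ - (b ^ 3)⁻¹| ≤ 3 * |a - b| := by
  have ha0 : 0 < a := by linarith
  have hb0 : 0 < b := by linarith
  have h1 : (a ^ 3)⁻¹ - (b ^ 3)⁻¹ =
      (b - a) * (1 / (a ^ 3 * b) + 1 / (a ^ 2 * b ^ 2) + 1 / (a * b ^ 3)) := by
    field_simp; ring
  have e (s t : ℕ) : 1 / (a ^ s * b ^ t) ≤ 1 := by
    rw [div_le_one (by positivity)]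
    exact one_le_mul_of_one_le_of_one_le (one_le_pow₀ ha) (one_le_pow₀ hb)
  have h2 : 1 / (a ^ 3 * b) + 1 / (a ^ 2 * b ^ 2) + 1 / (a * b ^ 3) ≤ 3 := by
    have := e 3 1; have := e 2 2; have := e 1 3
    simp only [pow_one] at *
    linarith
  rw [h1, abs_mul, abs_of_pos (show
    0 < 1 / (a ^ 3 * b) + 1 / (a ^ 2 * b ^ 2) + 1 / (a * b ^ 3) by positivity), abs_sub_comm, mul_comm]
  exact mul_le_mul_of_nonneg_right h2 (abs_nonneg _)

theorem IsAmoebaNorm.lipschitzWith_inv_cube (hφ : IsAmoebaNorm φ ν) :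
    LipschitzWith (3 * (φ (0, 1)).toNNReal) fun y => (evenExt ν y ^ 3)⁻¹ := by
  refine LipschitzWith.of_dist_le_mul fun y y' => ?_
  refine (abs_inv_cube_sub_le (hφ.one_le_evenExt _) (hφ.one_le_evenExt _)).trans ?_
  have := hφ.lipschitzWith_evenExt.dist_le_mul y y'
  rw [NNReal.coe_mul, NNReal.coe_ofNat, mul_assoc]
  exact mul_le_mul_of_nonneg_left this zero_le_three

theorem IsAmoebaNorm.hasDerivAt_inv_cube (hφ : IsAmoebaNorm φ ν) {y : ℝ}
    (hy : DifferentiableAt ℝ (evenExt ν) y) :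
    HasDerivAt (fun y => (evenExt ν y ^ 3)⁻¹) (-3 * (deriv (evenExt ν) y / evenExt ν y ^ 4)) y := by
  have h0 := (hφ.evenExt_pos y).ne'
  refine ((hy.hasDerivAt.pow 3).inv (pow_ne_zero 3 h0)).congr_deriv ?_
  simp only [Pi.pow_apply]
  field_simp
  norm_num
  ring

theorem continuous_cos_mul_inv_cube (hφ : IsAmoebaNorm φ ν) (z : ℝ) :
    Continuous fun ϑ => Real.cos ϑ * (evenExt ν (z * Real.cos ϑ) ^ 3)⁻¹ :=
  Real.continuous_cos.mul (hφ.lipschitzWith_inv_cube.continuous.comp (by fun_prop))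

theorem IsAmoebaNorm.coeffH₁_zero (hφ : IsAmoebaNorm φ ν) (z : ℝ) : coeffH₁ ν z 0 =
    3 / 2 * ∫ ϑ in (-(Real.pi / 2))..(Real.pi / 2), weightH ν z ϑ * Real.cos ϑ ^ 2 := by
  simp [coeffH₁, evenExt, hφ.apply_zero]

theorem IsAmoebaNorm.coeffH₃_zero (hφ : IsAmoebaNorm φ ν) (z : ℝ) : coeffH₃ ν z 0 =
    3 / 2 * ∫ ϑ in (-(Real.pi / 2))..(Real.pi / 2), weightH ν z ϑ * Real.sin ϑ ^ 2 := by
  simp [coeffH₃, evenExt, hφ.apply_zero]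

theorem coeffH₂_zero (ν : ℝ → ℝ) (z : ℝ) : coeffH₂ ν z 0 = 0 := by
  have h := intervalIntegral.integral_comp_neg (a := -(Real.pi / 2)) (b := Real.pi / 2)
    (fun ϑ => weightH ν z ϑ * (Real.sin ϑ * Real.cos ϑ))
  have hw (ϑ : ℝ) : weightH ν z (-ϑ) = weightH ν z ϑ := by simp [weightH]
  simp only [hw, Real.sin_neg, Real.cos_neg, neg_mul, mul_neg, intervalIntegral.integral_neg,
    neg_neg] at h
  rw [coeffH₂, zero_sub, zero_add, show ∫ ϑ in (-(Real.pi / 2))..(Real.pi / 2),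
    weightH ν z ϑ * (Real.sin ϑ * Real.cos ϑ) = 0 by linarith, mul_zero]

/-- `ν⁻³` is Lipschitz because `ν ≥ 1`, and differentiable at `z cos ϑ` for almost every `ϑ`; this
suffices to differentiate under the integral. -/
theorem IsAmoebaNorm.hasDerivAt_arcMean (hφ : IsAmoebaNorm φ ν) {z : ℝ} (hz : z ≠ 0) :
    HasDerivAt (arcMean ν) (-coeffH₁ ν z 0) z := by
  have key := intervalIntegral.hasDerivAt_integral_of_dominated_loc_of_lip (μ := volume)
    (a := -(Real.pi / 2)) (b := Real.pi / 2) (x₀ := z) (s := univ)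
    (F := fun z ϑ => Real.cos ϑ * (evenExt ν (z * Real.cos ϑ) ^ 3)⁻¹)
    (F' := fun ϑ => -3 * (weightH ν z ϑ * Real.cos ϑ ^ 2))
    (bound := fun _ => 3 * φ (0, 1)) univ_mem
    (Eventually.of_forall fun y => (continuous_cos_mul_inv_cube hφ y).aestronglyMeasurable)
    ((continuous_cos_mul_inv_cube hφ z).intervalIntegrable _ _)
    (((measurable_weightH hφ z).mul (Real.measurable_cos.pow_const 2)).const_mul
      _).aestronglyMeasurable
    (ae_of_all _ fun ϑ _ => ?_) (by simp) ?_
  · rw [coeffH₁_zero hφ]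
    refine (key.2.const_mul (1 / 2)).congr_deriv ?_
    rw [intervalIntegral.integral_const_mul]
    ring
  · refine LipschitzOnWith.of_dist_le_mul fun y _ y' _ => ?_
    have h1 := hφ.lipschitzWith_inv_cube.dist_le_mul (y * Real.cos ϑ) (y' * Real.cos ϑ)
    rw [Real.dist_eq, Real.dist_eq, ← sub_mul, abs_mul] at h1
    rw [Real.dist_eq, Real.dist_eq, ← mul_sub, abs_mul]
    have hc := Real.abs_cos_le_one ϑ
    rw [NNReal.coe_mul, NNReal.coe_ofNat, Real.coe_toNNReal _ (apply_nonneg φ _)] at h1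
    have hn : ((3 * φ (0, 1)).nnabs : ℝ) = 3 * φ (0, 1) := by
      rw [Real.coe_nnabs, abs_of_nonneg (by positivity)]
    rw [hn]
    calc _ ≤ 1 * |(evenExt ν (y * Real.cos ϑ) ^ 3)⁻¹ - (evenExt ν (y' * Real.cos ϑ) ^ 3)⁻¹| := by
          gcongr
      _ ≤ 3 * φ (0, 1) * (|y - y'| * |Real.cos ϑ|) := by rw [one_mul]; exact h1
      _ ≤ 3 * φ (0, 1) * (|y - y'| * 1) := by gcongr
      _ = _ := by rw [mul_one]
  · filter_upwards [hφ.ae_differentiableAt_cos hz] with ϑ hϑ _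
    have h1 : HasDerivAt (fun y => y * Real.cos ϑ) (Real.cos ϑ) z := by
      simpa using (hasDerivAt_id z).mul_const (Real.cos ϑ)
    refine (((hφ.hasDerivAt_inv_cube hϑ).comp z h1).const_mul (Real.cos ϑ)).congr_deriv ?_
    simp only [weightH]
    ring

/-- Integration by parts, with `cos` as the derivative of `sin` and `ν⁻³` absolutely continuous
because it is Lipschitz in the angle. At `±π/2` one has `ν(0) = 1`, so the boundary terms add up to
`2`, which the factor `1/2` turns into `1`. -/
theorem IsAmoebaNorm.arcMean_eq (hφ : IsAmoebaNorm φ ν) {z : ℝ} (hz : z ≠ 0) :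
    arcMean ν z = 1 - z * coeffH₃ ν z 0 := by
  set p : ℝ → ℝ := fun ϑ => (evenExt ν (z * Real.cos ϑ) ^ 3)⁻¹ with hp
  have hlip : LipschitzWith (3 * (φ (0, 1)).toNNReal * (‖z‖₊ * 1)) p := by
    refine hφ.lipschitzWith_inv_cube.comp (LipschitzWith.comp (lipschitzWith_smul z) ?_)
    exact lipschitzWith_of_nnnorm_deriv_le Real.differentiable_cos fun x => by
      rw [Real.deriv_cos]; simpa [← NNReal.coe_le_coe] using Real.abs_sin_le_one x
  have hsin : LipschitzWith 1 Real.sin :=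
    lipschitzWith_of_nnnorm_deriv_le Real.differentiable_sin fun x => by
      rw [Real.deriv_sin]; simpa [← NNReal.coe_le_coe] using Real.abs_cos_le_one x
  have hparts := (hsin.lipschitzOnWith (s := uIcc (-(Real.pi / 2)) (Real.pi / 2))).absolutelyContinuousOnInterval.integral_mul_deriv_eq_deriv_mul
    (hlip.lipschitzOnWith (s := uIcc (-(Real.pi / 2)) (Real.pi / 2))).absolutelyContinuousOnInterval
  have hderiv : ∫ ϑ in (-(Real.pi / 2))..(Real.pi / 2), Real.sin ϑ * deriv p ϑ =
      ∫ ϑ in (-(Real.pi / 2))..(Real.pi / 2), 3 * z * (weightH ν z ϑ * Real.sin ϑ ^ 2) := by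
    refine intervalIntegral.integral_congr_ae ?_
    filter_upwards [hφ.ae_differentiableAt_cos hz] with ϑ hϑ _
    have h1 : HasDerivAt p _ ϑ := HasDerivAt.comp (h₂ := fun y => (evenExt ν y ^ 3)⁻¹) ϑ
      (hφ.hasDerivAt_inv_cube hϑ) ((Real.hasDerivAt_cos ϑ).const_mul z)
    rw [h1.deriv]
    simp only [weightH]
    ring
  have h0 : evenExt ν 0 = 1 := by simp [evenExt, hφ.apply_zero]
  rw [hderiv, intervalIntegral.integral_const_mul] at hparts
  simp only [Real.deriv_sin, Real.sin_neg, Real.sin_pi_div_two, hp, Real.cos_neg,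
    Real.cos_pi_div_two, mul_zero, h0] at hparts
  rw [hφ.coeffH₃_zero, arcMean]
  linarith

end ArcMean

/-! ### The edge-stopping function as an angular mean -/

section EdgeStop

variable {φ : Seminorm ℝ (ℝ × ℝ)} {ν : ℝ → ℝ}

theorem IsAmoebaNorm.bddAbove_profile (hφ : IsAmoebaNorm φ ν) (y : ℝ) :
    BddAbove {w : ℝ | 0 ≤ w ∧ φ (w, 1) ≤ y} :=
  ⟨y, fun w hw => (le_abs_self w).trans ((hφ.abs_le_apply w 1).trans hw.2)⟩

theorem profileInv_nonneg (φ : Seminorm ℝ (ℝ × ℝ)) (y : ℝ) : 0 ≤ profileInv φ y :=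
  Real.sSup_nonneg fun _ h => h.1

theorem IsAmoebaNorm.monotone_profileInv (hφ : IsAmoebaNorm φ ν) : Monotone (profileInv φ) := by
  intro y y' h
  refine Real.sSup_le (fun w hw => ?_) (profileInv_nonneg φ y')
  exact le_csSup (hφ.bddAbove_profile y') ⟨hw.1, hw.2.trans h⟩

/-- `w ↦ φ(w, 1)` may be constant near `0`, so only this and the next-but-one-sided relation
`apply_le_of_lt_profileInv` are available. The gap between them concerns a single radius in the
layer-cake argument. -/
theorem IsAmoebaNorm.lt_profileInv (hφ : IsAmoebaNorm φ ν) {w y : ℝ} (hw : 0 ≤ w)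
    (h : φ (w, 1) < y) : w < profileInv φ y := by
  have hc : Continuous fun w : ℝ => φ (w, 1) := (continuous_seminorm_prod φ).comp (by fun_prop)
  have h1 : ∀ᶠ v in 𝓝[>] w, φ (v, 1) < y :=
    (hc.tendsto w).mono_left nhdsWithin_le_nhds |>.eventually_lt_const h
  obtain ⟨v, hv, hwv⟩ := (h1.and self_mem_nhdsWithin).exists
  exact hwv.trans_le (le_csSup (hφ.bddAbove_profile y) ⟨hw.trans hwv.le, hv.le⟩)

theorem IsAmoebaNorm.apply_le_of_lt_profileInv (hφ : IsAmoebaNorm φ ν) {w y : ℝ} (hw : 0 ≤ w)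
    (h : w < profileInv φ y) : φ (w, 1) ≤ y := by
  have hne : {w : ℝ | 0 ≤ w ∧ φ (w, 1) ≤ y}.Nonempty := by
    by_contra h0
    rw [profileInv, not_nonempty_iff_eq_empty.1 h0, Real.sSup_empty] at h
    exact hw.not_gt h
  obtain ⟨v, hv, hwv⟩ := exists_lt_of_lt_csSup hne h
  exact (hφ.apply_mono_fst hw hwv.le 1).trans hv.2

theorem lintegral_sq_Ioc {a : ℝ} (ha : 0 ≤ a) :
    ∫⁻ r in Ioc 0 a, ENNReal.ofReal (r ^ 2) = ENNReal.ofReal (a ^ 3 / 3) := by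
  rw [← ofReal_integral_eq_lintegral_ofReal, ← intervalIntegral.integral_of_le ha, integral_pow]
  · norm_num
  · exact ((continuous_pow 2).continuousOn.integrableOn_Icc).mono_set Ioc_subset_Icc_self
  · exact ae_of_all _ fun r => sq_nonneg r

/-- The layer-cake formula for the measure `r² dr` on `(0, 1]` removes the inverse profile. With `W
= √(t² + 1/z²)`, the square root exceeds `t` exactly when the inverse profile exceeds `W`, that is,
up to an endpoint, for `r < φ(1/z, 1)/φ(W, 1) = a`; this set has mass `a³/3`. -/
theorem IsAmoebaNorm.lintegral_profile (hφ : IsAmoebaNorm φ ν) {z : ℝ} (hz : 0 < z) :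
    ∫⁻ r in Ioc (0 : ℝ) 1, ENNReal.ofReal (r ^ 2 *
        Real.sqrt (profileInv φ (φ (1 / z, 1) / r) ^ 2 - 1 / z ^ 2)) =
      ∫⁻ t in Ioi (0 : ℝ), ENNReal.ofReal
        ((φ (1 / z, 1) / φ (Real.sqrt (t ^ 2 + 1 / z ^ 2), 1)) ^ 3 / 3) := by
  set M := φ (1 / z, 1) with hM
  have hMpos : 0 < M := (abs_pos.2 (by positivity)).trans_le (hφ.abs_le_apply (1 / z) 1)
  set h : ℝ → ℝ := fun r => Real.sqrt (profileInv φ (M / r) ^ 2 - 1 / z ^ 2) with hh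
  have hhm : Measurable h := by
    have := hφ.monotone_profileInv.measurable
    fun_prop
  set κ : Measure ℝ := (volume.restrict (Ioc (0 : ℝ) 1)).withDensity
    fun r => ENNReal.ofReal (r ^ 2) with hκ
  have hdens : Measurable fun r : ℝ => ENNReal.ofReal (r ^ 2) := by fun_prop
  have h1 : ∫⁻ r in Ioc (0 : ℝ) 1, ENNReal.ofReal (r ^ 2 * h r) = ∫⁻ r, ENNReal.ofReal (h r) ∂κ := by
    rw [hκ, lintegral_withDensity_eq_lintegral_mul _ hdens hhm.ennreal_ofReal]
    refine lintegral_congr fun r => ?_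
    rw [Pi.mul_apply, ENNReal.ofReal_mul (sq_nonneg r)]
  rw [h1, lintegral_eq_lintegral_meas_lt κ (ae_of_all _ fun r => Real.sqrt_nonneg _) hhm.aemeasurable]
  refine setLIntegral_congr_fun measurableSet_Ioi fun t (ht : 0 < t) => ?_
  set W := Real.sqrt (t ^ 2 + 1 / z ^ 2) with hW
  have hWz : 1 / z ≤ W := Real.le_sqrt_of_sq_le (by rw [div_pow, one_pow]; nlinarith)
  have hW0 : 0 < W := (by positivity : 0 < 1 / z).trans_le hWz
  have hWsq : W ^ 2 = t ^ 2 + 1 / z ^ 2 := Real.sq_sqrt (by positivity)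
  have hμW : M ≤ φ (W, 1) := hφ.apply_mono_fst (by positivity) hWz 1
  have hμW0 : 0 < φ (W, 1) := hMpos.trans_le hμW
  set a := M / φ (W, 1) with ha
  have ha0 : 0 ≤ a := by positivity
  have ha1 : a ≤ 1 := (div_le_one hμW0).2 hμW
  have hiff (r : ℝ) : t < h r ↔ W < profileInv φ (M / r) := by
    rw [hh, Real.lt_sqrt ht.le, lt_sub_iff_add_lt, ← hWsq,
      sq_lt_sq₀ hW0.le (profileInv_nonneg φ _)]
  have hlower {r : ℝ} (hr : r ∈ Ioo 0 a) : t < h r := by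
    rw [hiff]
    refine hφ.lt_profileInv hW0.le ?_
    rw [lt_div_iff₀ hr.1, mul_comm]
    exact (lt_div_iff₀ hμW0).1 hr.2
  have hupper {r : ℝ} (hr : r ∈ Ioc (0 : ℝ) 1) (htr : t < h r) : r ∈ Ioc 0 a := by
    refine ⟨hr.1, ?_⟩
    have := hφ.apply_le_of_lt_profileInv hW0.le ((hiff r).1 htr)
    rw [le_div_iff₀ hr.1] at this
    rw [ha, le_div_iff₀ hμW0, mul_comm]
    exact this
  have hset : MeasurableSet {r | t < h r} := measurableSet_lt measurable_const hhm
  change κ {r | t < h r} = ENNReal.ofReal (a ^ 3 / 3)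
  rw [hκ, withDensity_apply _ hset, Measure.restrict_restrict hset, ← lintegral_sq_Ioc ha0]
  refine le_antisymm (lintegral_mono_set fun r hr => hupper hr.2 hr.1) ?_
  rw [← restrict_Ioo_eq_restrict_Ioc]
  exact lintegral_mono_set fun r hr => ⟨hlower hr, hr.1, hr.2.le.trans ha1⟩

/-- The substitution `t = tan ϑ / z` makes the root equal to `1/(z cos ϑ)`, where `φ(·, 1)` takes
the value `ν(z cos ϑ)/(z cos ϑ)`. The Jacobian `1/(z cos² ϑ)` leaves one power of the cosine. -/
theorem IsAmoebaNorm.lintegral_tan (hφ : IsAmoebaNorm φ ν) {z : ℝ} (hz : 0 < z) :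
    ∫⁻ t in Ioi (0 : ℝ), ENNReal.ofReal
        ((φ (1 / z, 1) / φ (Real.sqrt (t ^ 2 + 1 / z ^ 2), 1)) ^ 3 / 3) =
      ∫⁻ ϑ in Ioo 0 (Real.pi / 2), ENNReal.ofReal (z ^ 2 * φ (1 / z, 1) ^ 3 / 3 *
        (Real.cos ϑ * (evenExt ν (z * Real.cos ϑ) ^ 3)⁻¹)) := by
  have hcos {ϑ : ℝ} (h : ϑ ∈ Ioo 0 (Real.pi / 2)) : 0 < Real.cos ϑ :=
    Real.cos_pos_of_mem_Ioo ⟨by linarith [h.1, Real.pi_pos], h.2⟩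
  have himg : (fun ϑ => Real.tan ϑ / z) '' Ioo 0 (Real.pi / 2) = Ioi 0 := by
    ext t
    constructor
    · rintro ⟨ϑ, hϑ, rfl⟩
      exact div_pos (Real.tan_pos_of_pos_of_lt_pi_div_two hϑ.1 hϑ.2) hz
    · intro (ht : 0 < t)
      refine ⟨Real.arctan (t * z), ⟨Real.arctan_pos.2 (by positivity), Real.arctan_lt_pi_div_two _⟩, ?_⟩
      simp only [Real.tan_arctan]
      field_simp
  have hinj : InjOn (fun ϑ => Real.tan ϑ / z) (Ioo 0 (Real.pi / 2)) := by
    intro a ha b hb hab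
    have h1 : Real.tan a = Real.tan b := by
      simp only at hab
      field_simp at hab
      exact hab
    exact Real.tan_inj_of_lt_of_lt_pi_div_two (by linarith [ha.1, Real.pi_pos]) ha.2
      (by linarith [hb.1, Real.pi_pos]) hb.2 h1
  rw [← himg, lintegral_image_eq_lintegral_abs_deriv_mul measurableSet_Ioo
    (fun ϑ hϑ => ((Real.hasDerivAt_tan (hcos hϑ).ne').div_const z).hasDerivWithinAt) hinj]
  refine setLIntegral_congr_fun measurableSet_Ioo fun ϑ hϑ => ?_
  have hc := hcos hϑ
  have hn : 0 < evenExt ν (z * Real.cos ϑ) := hφ.evenExt_pos _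
  have hsq : Real.sqrt ((Real.tan ϑ / z) ^ 2 + 1 / z ^ 2) = 1 / (z * Real.cos ϑ) := by
    rw [Real.sqrt_eq_iff_mul_self_eq_of_pos (by positivity), Real.tan_eq_sin_div_cos]
    have := Real.sin_sq_add_cos_sq ϑ
    field_simp
    linarith
  rw [hsq, hφ.apply_eq_evenExt (s := 1 / (z * Real.cos ϑ)) (by positivity),
    ← ENNReal.ofReal_mul (abs_nonneg _), abs_of_pos (by positivity), abs_of_pos (by positivity),
    one_div_one_div]
  congr 1
  field_simp

theorem IsAmoebaNorm.edgeStop_eq_arcMean (hφ : IsAmoebaNorm φ ν) {z : ℝ} (hz : 0 < z) :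
    edgeStop φ z = arcMean ν z := by
  have hMpos : 0 < φ (1 / z, 1) := (abs_pos.2 (by positivity)).trans_le (hφ.abs_le_apply (1 / z) 1)
  have h1 : ∫ r in (0 : ℝ)..1, r ^ 2 *
      Real.sqrt (profileInv φ (φ (1 / z, 1) / r) ^ 2 - 1 / z ^ 2) =
      ∫ ϑ in Ioo 0 (Real.pi / 2), z ^ 2 * φ (1 / z, 1) ^ 3 / 3 *
        (Real.cos ϑ * (evenExt ν (z * Real.cos ϑ) ^ 3)⁻¹) := by
    rw [intervalIntegral.integral_of_le zero_le_one, integral_eq_lintegral_of_nonneg_ae,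
      integral_eq_lintegral_of_nonneg_ae, hφ.lintegral_profile hz, hφ.lintegral_tan hz]
    · refine (ae_restrict_iff' measurableSet_Ioo).2 (ae_of_all _ fun ϑ hϑ => ?_)
      have : 0 < Real.cos ϑ :=
        Real.cos_pos_of_mem_Ioo ⟨by linarith [hϑ.1, Real.pi_pos], hϑ.2⟩
      have := hφ.evenExt_pos (z * Real.cos ϑ)
      simp only [Pi.zero_apply]
      positivity
    · exact ((continuous_cos_mul_inv_cube hφ z).const_mul _).aestronglyMeasurable
    · exact ae_of_all _ fun r => by simp only [Pi.zero_apply]; positivity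
    · have := hφ.monotone_profileInv.measurable
      exact (by fun_prop : Measurable fun r : ℝ => r ^ 2 *
        Real.sqrt (profileInv φ (φ (1 / z, 1) / r) ^ 2 - 1 / z ^ 2)).aestronglyMeasurable
  have hc := continuous_cos_mul_inv_cube hφ z
  have h2 := intervalIntegral.integral_comp_neg (a := 0) (b := Real.pi / 2)
    (fun ϑ => Real.cos ϑ * (evenExt ν (z * Real.cos ϑ) ^ 3)⁻¹)
  simp only [Real.cos_neg, neg_zero] at h2
  have h3 := intervalIntegral.integral_add_adjacent_intervals
    (hc.intervalIntegrable (-(Real.pi / 2)) 0) (hc.intervalIntegrable (μ := volume) 0 (Real.pi / 2))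
  rw [← h2] at h3
  rw [edgeStop, h1, integral_const_mul, ← integral_Ioc_eq_integral_Ioo,
    ← intervalIntegral.integral_of_le (by positivity), arcMean, ← h3]
  field_simp
  ring

end EdgeStop

/-! ### The geodesic active contour flux and the coefficients of the equation -/

section ActiveContour

variable {φ : Seminorm ℝ (ℝ × ℝ)} {ν : ℝ → ℝ} {f u : Plane → ℝ} {x : Plane}
  {b : OrthonormalBasis (Fin 2) ℝ Plane}

theorem exists_hasFDerivAt_gradient (hf : ContDiffAt ℝ 2 f x) :
    ∃ L : Plane →L[ℝ] Plane, HasFDerivAt (gradient f) L x ∧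
      ∀ v w, inner ℝ w (L v) = hess f x v w := by
  set e := EuclideanSpace.basisFun (Fin 2) ℝ
  have hd : HasFDerivAt (fderiv ℝ f) (fderiv ℝ (fderiv ℝ f) x) x :=
    ((hf.fderiv_right (m := 1) (by norm_num)).differentiableAt (by simp)).hasFDerivAt
  have hgrad : gradient f = fun y => ∑ i, fderiv ℝ f y (e i) • e i := by
    ext1 y
    rw [← e.sum_repr' (gradient f y)]
    simp only [real_inner_comm, inner_gradient]
  refine ⟨∑ i, ((fderiv ℝ (fderiv ℝ f) x).flip (e i)).smulRight (e i), ?_, fun v w => ?_⟩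
  · rw [hgrad]
    refine HasFDerivAt.fun_sum fun i _ => HasFDerivAt.smul_const ?_ (e i)
    refine (hd.clm_apply (hasFDerivAt_const (e i) x)).congr_fderiv ?_
    simp
  · conv_rhs => rw [hess, ← e.sum_repr' w, map_sum]
    simp only [sum_apply, ContinuousLinearMap.smulRight_apply, ContinuousLinearMap.flip_apply,
      inner_sum, inner_smul_right, map_smul, smul_eq_mul]
    refine Finset.sum_congr rfl fun i _ => ?_
    rw [mul_comm, real_inner_comm]

theorem hasFDerivAt_norm_comp {g : Plane → Plane} {L : Plane →L[ℝ] Plane} (hg : HasFDerivAt g L x)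
    (h0 : g x ≠ 0) :
    HasFDerivAt (fun y => ‖g y‖) (‖g x‖⁻¹ • (innerSL ℝ (g x)).comp L) x := by
  have hn : ‖g x‖ ≠ 0 := norm_ne_zero_iff.2 h0
  have h1 := hg.norm_sq.sqrt (pow_ne_zero 2 hn)
  simp only [Real.sqrt_sq (norm_nonneg _)] at h1
  refine h1.congr_fderiv ?_
  ext v
  simp only [smul_apply, ContinuousLinearMap.comp_apply, smul_eq_mul, nsmul_eq_mul]
  field_simp
  simp

/-- The divergence is the trace of the differential, hence computable in any orthonormal frame. -/
theorem divergence_eq_sum_inner (F : Plane → Plane) (x : Plane)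
    (b : OrthonormalBasis (Fin 2) ℝ Plane) :
    divergence F x = inner ℝ (b 0) (fderiv ℝ F x (b 0)) + inner ℝ (b 1) (fderiv ℝ F x (b 1)) := by
  have h1 := LinearMap.trace_eq_sum_inner (fderiv ℝ F x : Plane →ₗ[ℝ] Plane) b
  have h2 := LinearMap.trace_eq_sum_inner (fderiv ℝ F x : Plane →ₗ[ℝ] Plane)
    (EuclideanSpace.basisFun (Fin 2) ℝ)
  rw [h1] at h2
  rw [Fin.sum_univ_two] at h2
  simp only [ContinuousLinearMap.coe_coe] at h2
  rw [h2, divergence]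
  refine Finset.sum_congr rfl fun i _ => ?_
  simp [EuclideanSpace.basisFun_apply, EuclideanSpace.inner_single_left]

theorem IsAmoebaNorm.hasDerivAt_edgeStop (hφ : IsAmoebaNorm φ ν) {z : ℝ} (hz : 0 < z) :
    HasDerivAt (edgeStop φ) (-coeffH₁ ν z 0) z := by
  refine (hφ.hasDerivAt_arcMean hz.ne').congr_of_eventuallyEq ?_
  filter_upwards [Ioi_mem_nhds hz] with y hy using hφ.edgeStop_eq_arcMean hy

/-- The divergence of the geodesic active contour flux where the gradients are aligned. -/
theorem IsAmoebaNorm.divergence_gacFlux (hφ : IsAmoebaNorm φ ν) (hf : ContDiffAt ℝ 2 f x)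
    (hu : ContDiffAt ℝ 2 u x) (hfx : gradient f x = ‖gradient f x‖ • b 0)
    (hux : gradient u x = ‖gradient u x‖ • b 0) (hf0 : gradient f x ≠ 0)
    (hu0 : gradient u x ≠ 0) :
    DifferentiableAt ℝ (gacFlux φ u f) x ∧
      ‖gradient u x‖ * divergence (gacFlux φ u f) x =
        (1 - ‖gradient f x‖ * coeffH₃ ν ‖gradient f x‖ 0) * hess u x (b 1) (b 1) -
          ‖gradient u x‖ * (coeffH₁ ν ‖gradient f x‖ 0 * hess f x (b 0) (b 0)) := by
  obtain ⟨Lf, hLf, hessf⟩ := exists_hasFDerivAt_gradient hf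
  obtain ⟨Lu, hLu, hessu⟩ := exists_hasFDerivAt_gradient hu
  have hz : 0 < ‖gradient f x‖ := norm_pos_iff.2 hf0
  have hU : 0 < ‖gradient u x‖ := norm_pos_iff.2 hu0
  have hE := (hφ.hasDerivAt_edgeStop hz).comp_hasFDerivAt x (hasFDerivAt_norm_comp hLf hf0)
  have hN := (hasDerivAt_inv hU.ne').comp_hasFDerivAt x (hasFDerivAt_norm_comp hLu hu0)
  have hF : HasFDerivAt (gacFlux φ u f) _ x := (hE.mul hN).smul hLu
  refine ⟨hF.differentiableAt, ?_⟩
  rw [divergence_eq_sum_inner _ _ b, hF.fderiv]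
  have h01 : inner ℝ (b 1) (b 0) = 0 := b.orthonormal.2 (by decide)
  have hif (v : Plane) : inner ℝ (gradient f x) (Lf v) = ‖gradient f x‖ * hess f x v (b 0) := by
    conv_lhs => rw [hfx, inner_smul_left, hessf]
    rfl
  have hiu (v : Plane) : inner ℝ (gradient u x) (Lu v) = ‖gradient u x‖ * hess u x v (b 0) := by
    conv_lhs => rw [hux, inner_smul_left, hessu]
    rfl
  replace hiu (v : Plane) : hess u x v (gradient u x) = ‖gradient u x‖ * hess u x v (b 0) :=
    (hessu v _).symm.trans (hiu v)
  have hbu0 : inner ℝ (b 0) (gradient u x) = ‖gradient u x‖ := by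
    conv_lhs => rw [hux, inner_smul_right, real_inner_self_eq_norm_sq, b.orthonormal.1 0]
    simp
  have hbu1 : inner ℝ (b 1) (gradient u x) = 0 := by
    rw [hux, inner_smul_right, h01, mul_zero]
  simp only [add_apply, smul_apply, ContinuousLinearMap.smulRight_apply,
    ContinuousLinearMap.comp_apply, innerSL_apply_apply, inner_add_right, inner_smul_right, hessu,
    hif, hiu, hbu0, hbu1, smul_eq_mul, Function.comp, Pi.mul_apply,
    hφ.edgeStop_eq_arcMean hz, hφ.arcMean_eq hz.ne']
  field_simp
  ring

theorem exists_frame {v w : Plane} (hv : ‖v‖ = 1) (hw : ‖w‖ = 1) (hvw : inner ℝ v w = 0) :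
    ∃ b : OrthonormalBasis (Fin 2) ℝ Plane, b 0 = v ∧ b 1 = w := by
  have hon : Orthonormal ℝ ![v, w] := by
    rw [orthonormal_iff_ite]
    intro i j
    fin_cases i <;> fin_cases j <;>
      simp [hv, hw, hvw, real_inner_comm]
  have hcard : Fintype.card (Fin 2) = Module.finrank ℝ Plane := by simp
  refine ⟨(basisOfOrthonormalOfCardEqFinrank hon hcard).toOrthonormalBasis (by simpa using hon), ?_, ?_⟩ <;>
    simp

/-- The balance threshold in terms of the coefficients of the amoeba active contour equation. -/
theorem six_mul_balance (hφ : IsAmoebaNorm φ ν) (hf : ContDiffAt ℝ 2 f x) {ξ χ ζ : Plane} {α : ℝ}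
    (h0 : b 0 = Real.cos α • χ + Real.sin α • ζ) (h1 : b 1 = Real.cos α • ζ - Real.sin α • χ)
    (hξ : hess u x ξ ξ = hess u x (b 1) (b 1)) :
    6 * balance ν ‖gradient f x‖ α (hess f x (b 0) (b 0) / 2) (hess f x (b 0) (b 1) / 2)
      (hess f x (b 1) (b 1) / 2) ‖gradient u x‖ (hess u x (b 1) (b 1) / 2) =
    aacRhs ν u f ξ χ ζ α x := by
  rw [aacRhs, coeffG, coeffH₁, coeffH₂, coeffH₃, hξ]
  generalize ‖gradient f x‖ = z
  have hn : 0 < evenExt ν (z * Real.sin α) := hφ.evenExt_pos _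
  have hquad (ϑ : ℝ) : quadForm (hess f x (b 0) (b 0) / 2) (hess f x (b 0) (b 1) / 2)
      (hess f x (b 1) (b 1) / 2) (unitVec (ϑ - α)) =
      hess f x χ χ / 2 * Real.cos ϑ ^ 2 + hess f x χ ζ * (Real.sin ϑ * Real.cos ϑ) +
        hess f x ζ ζ / 2 * Real.sin ϑ ^ 2 := by
    -- The frame of `u` is that of `f` turned by `α`; the direction at angle `ϑ - α` in the former
    -- has angle `ϑ` in the latter.
    have hv : Real.cos (ϑ - α) • b 0 + Real.sin (ϑ - α) • b 1 =
        Real.cos ϑ • χ + Real.sin ϑ • ζ := by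
      have e1 := Real.cos_add (ϑ - α) α
      have e2 := Real.sin_add (ϑ - α) α
      rw [sub_add_cancel] at e1 e2
      rw [h0, h1, e1, e2]
      module
    have e1 : quadForm (hess f x (b 0) (b 0) / 2) (hess f x (b 0) (b 1) / 2)
        (hess f x (b 1) (b 1) / 2) (unitVec (ϑ - α)) =
        hess f x (Real.cos (ϑ - α) • b 0 + Real.sin (ϑ - α) • b 1)
          (Real.cos (ϑ - α) • b 0 + Real.sin (ϑ - α) • b 1) / 2 := by
      have hc := hess_comm hf (b 0) (b 1)
      simp only [hess] at hc ⊢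
      simp only [map_add, map_smul, add_apply, smul_apply, smul_eq_mul, quadForm, unitVec]
      rw [← hc]
      ring
    rw [e1, hv]
    have hc := hess_comm hf χ ζ
    simp only [hess] at hc ⊢
    simp only [map_add, map_smul, add_apply, smul_apply, smul_eq_mul]
    rw [← hc]
    ring
  have hint : ∫ ϑ in (α - Real.pi / 2)..(α + Real.pi / 2), weightH ν z ϑ *
      quadForm (hess f x (b 0) (b 0) / 2) (hess f x (b 0) (b 1) / 2)
      (hess f x (b 1) (b 1) / 2) (unitVec (ϑ - α)) =
      hess f x χ χ / 2 * (∫ ϑ in (α - Real.pi / 2)..(α + Real.pi / 2),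
        weightH ν z ϑ * Real.cos ϑ ^ 2) +
      hess f x χ ζ * (∫ ϑ in (α - Real.pi / 2)..(α + Real.pi / 2),
        weightH ν z ϑ * (Real.sin ϑ * Real.cos ϑ)) +
      hess f x ζ ζ / 2 * (∫ ϑ in (α - Real.pi / 2)..(α + Real.pi / 2),
        weightH ν z ϑ * Real.sin ϑ ^ 2) := by
    have i1 := hφ.intervalIntegrable_weightH_mul z (α - Real.pi / 2) (α + Real.pi / 2)
      (h := fun ϑ => Real.cos ϑ ^ 2) (by fun_prop)
    have i2 := hφ.intervalIntegrable_weightH_mul z (α - Real.pi / 2) (α + Real.pi / 2)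
      (h := fun ϑ => Real.sin ϑ * Real.cos ϑ) (by fun_prop)
    have i3 := hφ.intervalIntegrable_weightH_mul z (α - Real.pi / 2) (α + Real.pi / 2)
      (h := fun ϑ => Real.sin ϑ ^ 2) (by fun_prop)
    rw [← intervalIntegral.integral_const_mul, ← intervalIntegral.integral_const_mul,
      ← intervalIntegral.integral_const_mul,
      ← intervalIntegral.integral_add (i1.const_mul _) (i2.const_mul _),
      ← intervalIntegral.integral_add ((i1.const_mul _).add (i2.const_mul _)) (i3.const_mul _)]
    refine intervalIntegral.integral_congr fun ϑ _ => ?_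
    simp only [hquad]
    ring
  rw [balance, hint]
  field_simp
  ring

end ActiveContour

end Amoeba

/-! ### The main theorem -/

theorem mainTheorem3
    -- the amoeba metric
    (φ : Seminorm ℝ (ℝ × ℝ)) (ν : ℝ → ℝ) (hφ : Amoeba.IsAmoebaNorm φ ν)
    -- the image domain, the image and the level-set function
    (Ω : Set Amoeba.Plane) (hΩ : IsCompact Ω) (hΩc : IsConnected Ω)
    (f u : Amoeba.Plane → ℝ) (hf : ContDiffOn ℝ ∞ f Ω) (hu : ContDiffOn ℝ ∞ u Ω)
    -- the reference point
    (x : Amoeba.Plane) (hx : x ∈ interior Ω)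
    (hfx : gradient f x ≠ 0) (hux : gradient u x ≠ 0)
    -- the local frames of `u` and `f`, and the angle between the gradient directions
    (η ξ χ ζ : Amoeba.Plane) (α : ℝ)
    (hη : η = (‖gradient u x‖)⁻¹ • gradient u x) (hξ : ‖ξ‖ = 1) (hξη : inner ℝ ξ η = 0)
    (hχ : χ = (‖gradient f x‖)⁻¹ • gradient f x) (hζ : ‖ζ‖ = 1) (hζχ : inner ℝ ζ χ = 0)
    (hα : η = Real.cos α • χ + Real.sin α • ζ) :
    -- the integrals that define `H₁`, `H₂`, `H₃` exist
    (IntervalIntegrable (Amoeba.weightH ν ‖gradient f x‖) volume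
      (α - Real.pi / 2) (α + Real.pi / 2)) ∧
    -- for small radii the median filter has a well-defined value at `x`
    (∀ᶠ ρ in 𝓝[>] (0 : ℝ), ∃! m : ℝ, Amoeba.IsMedianOn u (Amoeba.amoeba Ω φ f ρ x) m) ∧
    -- one filter step is a time step of size `ρ² / 6` up to an error `o(ρ²)`
    (∀ m : ℝ → ℝ,
      (∀ᶠ ρ in 𝓝[>] (0 : ℝ), Amoeba.IsMedianOn u (Amoeba.amoeba Ω φ f ρ x) (m ρ)) →
      Tendsto (fun ρ => (m ρ - u x) / (ρ ^ 2 / 6)) (𝓝[>] (0 : ℝ))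
        (𝓝 (Amoeba.aacRhs ν u f ξ χ ζ α x))) ∧
    -- reduction to the geodesic active contour equation
    (α = 0 → Amoeba.hess u x ξ η = 0 → Amoeba.hess f x ξ η = 0 →
      Amoeba.hess u x ξ ξ / ‖gradient u x‖ = Amoeba.hess f x ξ ξ / ‖gradient f x‖ →
      DifferentiableAt ℝ (Amoeba.gacFlux φ u f) x ∧
      Amoeba.aacRhs ν u f ξ χ ζ α x
        = ‖gradient u x‖ * Amoeba.divergence (Amoeba.gacFlux φ u f) x) := by
  have hxn := mem_interior_iff_mem_nhds.1 hx
  have hf2 : ContDiffAt ℝ 2 f x := by exact_mod_cast contDiffAt_infty.1 (hf.contDiffAt hxn) 2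
  have hu2 : ContDiffAt ℝ 2 u x := by exact_mod_cast contDiffAt_infty.1 (hu.contDiffAt hxn) 2
  have hz : 0 < ‖gradient f x‖ := norm_pos_iff.2 hfx
  have hU : 0 < ‖gradient u x‖ := norm_pos_iff.2 hux
  have hη1 : ‖η‖ = 1 := by rw [hη, norm_smul, norm_inv, norm_norm, inv_mul_cancel₀ hU.ne']
  have hχ1 : ‖χ‖ = 1 := by rw [hχ, norm_smul, norm_inv, norm_norm, inv_mul_cancel₀ hz.ne']
  have hχζ : inner ℝ χ ζ = 0 := by rw [real_inner_comm]; exact hζχ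
  have hχχ : inner ℝ χ χ = 1 := by rw [real_inner_self_eq_norm_sq, hχ1, one_pow]
  have hζζ : inner ℝ ζ ζ = 1 := by rw [real_inner_self_eq_norm_sq, hζ, one_pow]
  have hsc := Real.sin_sq_add_cos_sq α
  -- This tangent vector, turned consistently with `α`, completes `η` to the working frame. The
  -- given `ξ` is `e₁` or `-e₁`; it enters the right-hand side only through `u_ξξ`, where the sign
  -- drops out.
  set e₁ := Real.cos α • ζ - Real.sin α • χ with he₁
  have he₁1 : ‖e₁‖ = 1 := by
    rw [← sq_eq_sq₀ (norm_nonneg _) zero_le_one, ← real_inner_self_eq_norm_sq, he₁]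
    simp only [inner_sub_left, inner_sub_right, inner_smul_left, inner_smul_right, hχζ, hζχ, hχχ,
      hζζ, conj_trivial]
    linarith
  have hηe₁ : inner ℝ η e₁ = 0 := by
    rw [hα, he₁]
    simp only [inner_add_left, inner_sub_right, inner_smul_left, inner_smul_right, hχζ, hζχ, hχχ,
      hζζ, conj_trivial]
    ring
  obtain ⟨b, hb0, hb1⟩ := Amoeba.exists_frame hη1 he₁1 hηe₁
  have hfχ : gradient f x = ‖gradient f x‖ • χ := by rw [hχ, smul_inv_smul₀ hz.ne']
  have huη : gradient u x = ‖gradient u x‖ • b 0 := by rw [hb0, hη, smul_inv_smul₀ hU.ne']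
  have hf0 : inner ℝ (gradient f x) (b 0) = ‖gradient f x‖ * Real.cos α := by
    rw [hb0, hα]
    conv_lhs => rw [hfχ]
    simp only [inner_add_right, inner_smul_left, inner_smul_right, hχζ, hχχ, conj_trivial]
    ring
  have hf1 : inner ℝ (gradient f x) (b 1) = -(‖gradient f x‖ * Real.sin α) := by
    rw [hb1, he₁]
    conv_lhs => rw [hfχ]
    simp only [inner_sub_right, inner_smul_left, inner_smul_right, hχζ, hχχ, conj_trivial]
    ring
  have hu0 : inner ℝ (gradient u x) (b 0) = ‖gradient u x‖ := by
    conv_lhs => rw [huη, inner_smul_left, real_inner_self_eq_norm_sq, b.orthonormal.1 0]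
    simp
  have hu1 : inner ℝ (gradient u x) (b 1) = 0 := by
    rw [huη, inner_smul_left, b.orthonormal.2 (by decide), mul_zero]
  have hξb : ξ = inner ℝ (b 1) ξ • b 1 := by
    have h := b.sum_repr' ξ
    rw [Fin.sum_univ_two, hb0, real_inner_comm, hξη, zero_smul, zero_add] at h
    exact h.symm
  have hξs : inner ℝ (b 1) ξ ^ 2 = 1 := by
    have h : ‖ξ‖ = |inner ℝ (b 1) ξ| := by
      conv_lhs => rw [hξb, norm_smul, b.orthonormal.1 1, mul_one, Real.norm_eq_abs]
    rw [← sq_abs, ← h, hξ, one_pow]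
  have hhess (g : Amoeba.Plane → ℝ) : Amoeba.hess g x ξ ξ = Amoeba.hess g x (b 1) (b 1) := by
    rw [hξb, Amoeba.hess, Amoeba.hess]
    simp only [map_smul, smul_apply, smul_eq_mul]
    linear_combination (fderiv ℝ (fderiv ℝ g) x (b 1) (b 1)) * hξs
  have hbal := Amoeba.six_mul_balance (u := u) (ξ := ξ) hφ hf2 (hb0.trans hα) hb1 (hhess u)
  refine ⟨?_, ?_, fun m hm => ?_, fun hα0 _ _ hcurv => ?_⟩
  · simpa using hφ.intervalIntegrable_weightH_mul ‖gradient f x‖ (α - Real.pi / 2)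
      (α + Real.pi / 2) (h := fun _ => 1) continuous_const
  · exact Amoeba.eventually_existsUnique_median hφ hΩ hf hu hx hz.ne' hU hf0 hf1 hu0 hu1
  · rw [← hbal]
    exact Amoeba.tendsto_median hφ hΩ hf hu hx hz.ne' hU hf0 hf1 hu0 hu1 hm
  · have hb0χ : b 0 = χ := by rw [hb0, hα, hα0]; simp
    have hb1ζ : b 1 = ζ := by rw [hb1, he₁, hα0]; simp
    obtain ⟨hd, hdiv⟩ := hφ.divergence_gacFlux (b := b) hf2 hu2 (by rw [hb0χ]; exact hfχ) huη hfx hux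
    refine ⟨hd, ?_⟩
    rw [hdiv, Amoeba.aacRhs, Amoeba.coeffG, hα0, Amoeba.coeffH₂_zero, Real.sin_zero, mul_zero,
      hhess u, hb0χ, hb1ζ]
    have h0 : Amoeba.evenExt ν 0 = 1 := by simp [Amoeba.evenExt, hφ.apply_zero]
    rw [h0]
    rw [hhess u, hhess f, hb1ζ, div_eq_div_iff hU.ne' hz.ne'] at hcurv
    -- At `α = 0` one has `G = 1` and `H₂ = 0`; the two sides differ only by `|∇f| H₃ u_ξξ` against
    -- `|∇u| H₃ f_ζζ`, which agree by the equality of curvatures.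
    linear_combination Amoeba.coeffH₃ ν ‖gradient f x‖ 0 * hcurv
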